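/- Let $T>0$, $n\in\mathbb N$, and let $f\colon[0,T]\times\mathbb R^n\to\mathbb R$. Write $\nabla_xf$, $\nabla_x^2f$ for the gradient and Hessian in $x$, and let $Z_f$ be the set of $(t,\xi)\in[0,T]\times\mathbb R^n$ with $\nabla_xf(t,\xi)=0$ and $\det\nabla_x^2f(t,\xi)=0$. Assume: 1. $f$ is of class $C^3$ and there are $c_0>0$, $a_0\ge0$ with $\nabla_xf(t,x)\cdot x\ge c_0|x|^2-a_0$ for all $(t,x)\in[0,T]\times\mathbb R^n$. 2. $Z_f$ is finite, the projection $(t,\xi)\mapsto t$ is injective on $Z_f$, and its image contains neither $0$ nor $T$. 3. For every $(\tau,\xi)\in Z_f$ with $\nabla_x^2f(\tau,\xi)$ positive semidefinite there is $\ell\ne0$ with (a) $\ker\nabla_x^2f(\tau,\xi)=\operatorname{span}(\ell)$, (b) $\nabla_xf_t(\tau,\xi)\cdot\ell\ne0$, (c) $\sum_{i,j,k}f_{x_ix_jx_k}(\tau,\xi)\ell_i\ell_j\ell_k\ne0$. 4. For every $(\tau,\xi)\in Z_f$ with $\nabla_x^2f(\tau,\xi)$ positive semidefinite, if $w\colon\mathbb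 R\to\mathbb R^n$ is a nonconstant solution of $\dot w=-\nabla_xf(\tau,w)$ with $w(s)\to\xi$ as $s\to-\infty$ and $w(s)\to w_\infty$ as $s\to+\infty$, then $\nabla_x^2f(\tau,w_\infty)$ is positive definite. Let $y_0\in\mathbb R^n$ be such that $\nabla_xf(0,y_0)=0$ and $\nabla_x^2f(0,y_0)$ is positive definite. Then there exist $k\ge1$, times $0=t_0<t_1<\dots<t_k=T$, a function $u\colon[0,T]\to\mathbb R^n$, points $x_1,\dots,x_k\in\mathbb R^n$, and $C^2$ functions $v_1,\dots,v_{k-1}\colon\mathbb R\to\mathbb R^n$ such that - $u(0)=y_0$; on each $[t_{i-1},t_i)$, $1\le i\le k$, $u$ is of class $C^2$, $\nabla_xf(t,u(t))=0$ and $\nabla_x^2f(t,u(t))$ is positive definite; $\lim_{t\to t_i^-}u(t)=x_i$ for $1\le i\le k$, and $u(T)=x_k$; - for $1\le i\le k-1$: $(t_i,x_i)\in Z_f$, $\nabla_x^2f(t_i,x_i)$ is positive semidefinite, and for some $\ell\neq 0$ spanning its kernel the numbers in (b) and (c) at $(t_i,x_i)$ have the same sign; - for $1\le i\le k-1$: $\dot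 v_i=-\nabla_xf(t_i,v_i)$ on $\mathbb R$, $\lim_{s\to-\infty}v_i(s)=x_i$ and $\lim_{s\to+\infty}v_i(s)=u(t_i)$. Moreover, for all such data, and for all functions $u_\varepsilon\colon[0,T]\to\mathbb R^n$, $\varepsilon>0$, solving $$\varepsilon\dot u_\varepsilon(t)=-\nabla_xf(t,u_\varepsilon(t))\ \text{ on }[0,T],\qquad u_\varepsilon(0)=y_\varepsilon,$$ with $y_\varepsilon\to y_0$ as $\varepsilon\to0^+$, the following hold as $\varepsilon\to0^+$: (i) $u_\varepsilon\to u$ uniformly on compact subsets of $[0,T]\setminus\{t_1,\dots,t_{k-1}\}$. (ii) For every $i=1,\dots,k-1$ there are $t^i_\varepsilon\to t_i$ such that $u_\varepsilon(t^i_\varepsilon+\varepsilon s)\to v_i(s)$ uniformly for $s$ in compact subsets of $\mathbb R$. (iii) With $\gamma_i:=v_i(\mathbb R)\cup\{x_i,u(t_i)\}$ and $G:=\operatorname{graph}(u)\cup\bigcup_{i=1}^{k-1}(\{t_i\}\times\gamma_i)$, one has $\operatorname{dist}((t,u_\varepsilon(t)),G)\to0$ uniformly for $t\in[0,T]$. 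-/

import Mathlib

open Set Filter Topology

noncomputable section

namespace SlowGradient

/-- The state space `ℝⁿ` with its Euclidean structure. -/
abbrev E (n : ℕ) : Type := EuclideanSpace ℝ (Fin n)

variable {n : ℕ}

/-- The spatial gradient `∇ₓ f(t,x)`. -/
def gradX (f : ℝ → E n → ℝ) (t : ℝ) (x : E n) : E n := gradient (f t) x

/-- The spatial Hessian `∇ₓ² f(t,x)`, as a linear operator on `ℝⁿ`. -/
def hessX (f : ℝ → E n → ℝ) (t : ℝ) (x : E n) : E n →L[ℝ] E n :=
  fderiv ℝ (gradX f t) x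

/-- `∇ₓ² f(t,x)` is positive definite. -/
def HessPosDef (f : ℝ → E n → ℝ) (t : ℝ) (x : E n) : Prop :=
  ∀ z : E n, z ≠ 0 → 0 < inner ℝ (hessX f t x z) z

/-- `∇ₓ² f(t,x)` is positive semidefinite. -/
def HessPosSemidef (f : ℝ → E n → ℝ) (t : ℝ) (x : E n) : Prop :=
  ∀ z : E n, 0 ≤ inner ℝ (hessX f t x z) z

/-- The number `∇ₓ f_t(t,x) · l`; the time derivative is taken relative to `[0,T]`. -/
def mixedDeriv (T : ℝ) (f : ℝ → E n → ℝ) (t : ℝ) (x l : E n) : ℝ :=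
  inner ℝ (gradient (fun z : E n => derivWithin (fun s => f s z) (Icc 0 T) t) x) l

/-- The number `∑ᵢⱼₖ f_{xᵢxⱼxₖ}(t,x) lᵢ lⱼ lₖ`, i.e. the third spatial differential evaluated at
`(l,l,l)`. -/
def thirdDeriv (f : ℝ → E n → ℝ) (t : ℝ) (x l : E n) : ℝ :=
  iteratedFDeriv ℝ 3 (f t) x (fun _ => l)

/-- The set `Z_f` of pairs `(t,ξ)`, `t ∈ [0,T]`, such that `ξ` is a degenerate critical point
of `f(t,·)`. -/
def degenerateSet (T : ℝ) (f : ℝ → E n → ℝ) : Set (ℝ × E n) :=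
  {p | p.1 ∈ Icc 0 T ∧ gradX f p.1 p.2 = 0 ∧ (hessX f p.1 p.2).det = 0}

/-- `f` is of class `C³` on `[0,T] × ℝⁿ` and coercive. -/
def RegularCoercive (T : ℝ) (f : ℝ → E n → ℝ) : Prop :=
  ContDiffOn ℝ 3 (fun p : ℝ × E n => f p.1 p.2) (Icc 0 T ×ˢ univ) ∧
  ∃ c₀ a₀ : ℝ, 0 < c₀ ∧ 0 ≤ a₀ ∧
    ∀ t ∈ Icc 0 T, ∀ x : E n, c₀ * ‖x‖ ^ 2 - a₀ ≤ inner ℝ (gradX f t x) x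

/-- There are finitely many degenerate critical pairs, at distinct times different from
`0` and `T`. -/
def FiniteDegenerate (T : ℝ) (f : ℝ → E n → ℝ) : Prop :=
  (degenerateSet T f).Finite ∧ InjOn Prod.fst (degenerateSet T f) ∧
  (0 : ℝ) ∉ Prod.fst '' degenerateSet T f ∧ T ∉ Prod.fst '' degenerateSet T f

/-- At every degenerate critical pair with positive semidefinite Hessian, the kernel of the Hessian
is a line and the two transversality conditions hold. -/
def Transversal (T : ℝ) (f : ℝ → E n → ℝ) : Prop :=
  ∀ τ ξ, (τ, ξ) ∈ degenerateSet T f → HessPosSemidef f τ ξ →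
    ∃ l : E n, l ≠ 0 ∧
      LinearMap.ker (hessX f τ ξ : E n →ₗ[ℝ] E n) = Submodule.span ℝ {l} ∧
      mixedDeriv T f τ ξ l ≠ 0 ∧ thirdDeriv f τ ξ l ≠ 0

/-- `w : ℝ → ℝⁿ` solves the autonomous system `w' = -∇ₓ f(τ,w)`. -/
def IsFastSolution (f : ℝ → E n → ℝ) (τ : ℝ) (w : ℝ → E n) : Prop :=
  ∀ s : ℝ, HasDerivAt w (-gradX f τ (w s)) s

/-- Every heteroclinic (i.e. nonconstant) solution issuing from a degenerate critical point with
positive semidefinite Hessian can only have a limit at `+∞` where the Hessian is positive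
definite. -/
def HeteroclinicToMinimum (T : ℝ) (f : ℝ → E n → ℝ) : Prop :=
  ∀ τ ξ, (τ, ξ) ∈ degenerateSet T f → HessPosSemidef f τ ξ →
    ∀ w : ℝ → E n, IsFastSolution f τ w → (∃ s, w s ≠ ξ) → Tendsto w atBot (𝓝 ξ) →
      ∀ wInf : E n, Tendsto w atTop (𝓝 wInf) → HessPosDef f τ wInf

/-- The limit evolution starting from `y₀`: times `0 = t₀ < ⋯ < t_k = T`, a function `u` on
`[0,T]` which is a `C²` branch of nondegenerate minima on every `[t_i, t_{i+1})`, its left limits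
`x_i` at `t_i` (`1 ≤ i ≤ k`), and heteroclinic solutions `v_i` (`1 ≤ i ≤ k - 1`) joining
`x_i` to `u(t_i)`. At the final time, `u` takes the value of its left limit. Values of `t`, `x`, `v`
at other indices, and of `u` outside `[0,T]`, are irrelevant. -/
structure IsLimitEvolution (T : ℝ) (f : ℝ → E n → ℝ) (y₀ : E n) (k : ℕ) (t : ℕ → ℝ)
    (x : ℕ → E n) (u : ℝ → E n) (v : ℕ → ℝ → E n) : Prop where
  t_zero : t 0 = 0
  t_last : t k = T
  t_lt : ∀ i < k, t i < t (i + 1)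
  init : u 0 = y₀
  smooth : ∀ i < k, ContDiffOn ℝ 2 u (Ico (t i) (t (i + 1)))
  critical : ∀ i < k, ∀ s ∈ Ico (t i) (t (i + 1)), gradX f s (u s) = 0 ∧ HessPosDef f s (u s)
  left_limit : ∀ i, 1 ≤ i → i ≤ k → Tendsto u (𝓝[<] (t i)) (𝓝 (x i))
  final : u T = x k
  degenerate : ∀ i, 1 ≤ i → i < k → (t i, x i) ∈ degenerateSet T f ∧ HessPosSemidef f (t i) (x i)
  same_sign : ∀ i, 1 ≤ i → i < k → ∃ l : E n, l ≠ 0 ∧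
    LinearMap.ker (hessX f (t i) (x i) : E n →ₗ[ℝ] E n) = Submodule.span ℝ {l} ∧
    0 < mixedDeriv T f (t i) (x i) l * thirdDeriv f (t i) (x i) l
  v_smooth : ∀ i, 1 ≤ i → i < k → ContDiff ℝ 2 (v i)
  v_solution : ∀ i, 1 ≤ i → i < k → IsFastSolution f (t i) (v i)
  v_atBot : ∀ i, 1 ≤ i → i < k → Tendsto (v i) atBot (𝓝 (x i))
  v_atTop : ∀ i, 1 ≤ i → i < k → Tendsto (v i) atTop (𝓝 (u (t i)))

/-- The set of jump times `t₁, …, t_{k-1}`. -/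
def jumpTimes (k : ℕ) (t : ℕ → ℝ) : Set ℝ := {s | ∃ i, 1 ≤ i ∧ i < k ∧ s = t i}

/-- The graph of `u` on `[0,T]`, completed at every jump time `t_i` by
`γ_i = v_i(ℝ) ∪ {x_i, u(t_i)}`. -/
def completedGraph (T : ℝ) (k : ℕ) (t : ℕ → ℝ) (x : ℕ → E n) (u : ℝ → E n) (v : ℕ → ℝ → E n) :
    Set (ℝ × E n) :=
  {p | p.1 ∈ Icc 0 T ∧ p.2 = u p.1} ∪
  {p | ∃ i, 1 ≤ i ∧ i < k ∧ p.1 = t i ∧ p.2 ∈ range (v i) ∪ {x i, u (t i)}}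

/-- `w` solves `ε w' = -∇ₓ f(t,w)` on `[0,T]` with `w(0) = y` (for `ε > 0`). -/
def IsEpsSolution (T : ℝ) (f : ℝ → E n → ℝ) (ε : ℝ) (y : E n) (w : ℝ → E n) : Prop :=
  w 0 = y ∧ ∀ t ∈ Icc 0 T, HasDerivWithinAt w (-(ε⁻¹ • gradX f t (w t))) (Icc 0 T) t

end SlowGradient

end

/-! Along a branch of nondegenerate minima the gradient is uniformly strongly monotone, so for small
ε the field -ε⁻¹∇ₓf points into a thin moving tube around the branch, and a solution inside the tube
stays there (`IsBranch.exists_tracking`). The branch can stop before T only at a degenerate limit,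
whose Hessian is semidefinite and which is therefore a fold by transversality.

Near a fold write h = t - τ, a for the component of x - ξ along the kernel vector l, y for the norm
of the transverse part, and b, c for the mixed and third derivatives along l. The l-component of the
gradient is b h + c a²/2 up to small errors, and at critical points the transverse components force
y to be O(|h|) + o(|a|). When h b c ≥ 0 the two leading terms cannot cancel, so the fold is isolated
on that side in time (`IsFold.isolated`). A branch arriving from the left thus forces b c > 0, and
then no critical point survives nearby just after τ. The energy identity pushes the solution out of
the neighbourhood (`exists_eps_exit`).

Blowing up time at the first exit produces an orbit of the frozen gradient flow that remained near ξ
for all past time, hence emanates from ξ. Differences of two such orbits lie in a thin cone around l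
(`IsFold.cone`), so their exit point is unique (`IsFoldRadius.exit_unique`); every limit point is
therefore on the prescribed v_i and no subsequence is needed. Such an orbit exists as a limit of
trajectories started at ξ + s l. Its energy is strictly below that of ξ, so its limit at +∞ is not
the only degenerate critical point at time τ; the heteroclinic hypothesis makes the limit a
nondegenerate minimum (`exists_heteroclinic`). A small ball around it traps the solutions, and
tracking resumes.

Existence of the limit evolution is an induction on the number of degenerate pairs still ahead.
Convergence is an induction over the jumps: convergence up to a jump gives its description
(`IsJump`), which supplies the starting condition for the next branch. Coercivity keeps all
solutions in one ball, so the frozen field may be truncated to have a global Lipschitz flow. -/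

namespace SlowGradient

variable {n : ℕ} {T : ℝ} {f : ℝ → E n → ℝ}

/-! ### Regularity of the spatial gradient and Hessian. -/

/-- The space-time domain `[0,T] × ℝⁿ`. -/
abbrev strip (n : ℕ) (T : ℝ) : Set (ℝ × E n) := Icc 0 T ×ˢ univ

/-- The map `(t,x) ↦ f(t,x)` on the product space. -/
abbrev uncurryFun (f : ℝ → E n → ℝ) : ℝ × E n → ℝ := fun p => f p.1 p.2

/-- The spatial gradient as a map on the product space. -/
noncomputable abbrev gradFun (f : ℝ → E n → ℝ) : ℝ × E n → E n := fun p => gradX f p.1 p.2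

lemma uniqueDiffOn_strip (hT : 0 < T) : UniqueDiffOn ℝ (strip n T) :=
  (uniqueDiffOn_Icc hT).prod uniqueDiffOn_univ

/-- A derivative within the strip restricts to a genuine derivative in x, because the slice at any
time of [0,T], endpoints included, is the whole space. -/
lemma hasFDerivAt_slice {F' : Type*} [NormedAddCommGroup F'] [NormedSpace ℝ F']
    {G : ℝ × E n → F'} {L : ℝ × E n →L[ℝ] F'} {t : ℝ} {x : E n} (ht : t ∈ Icc 0 T)
    (hG : HasFDerivWithinAt G L (strip n T) (t, x)) :
    HasFDerivAt (fun z => G (t, z)) (L ∘L ContinuousLinearMap.inr ℝ ℝ (E n)) x := by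
  have h1 : HasFDerivWithinAt (fun z : E n => (t, z)) (ContinuousLinearMap.inr ℝ ℝ (E n)) univ x :=
    (hasFDerivAt_prodMk_right t x).hasFDerivWithinAt
  have h2 := HasFDerivWithinAt.comp x hG h1 (fun z _ => ⟨ht, mem_univ _⟩)
  exact hasFDerivWithinAt_univ.1 h2

lemma hasFDerivAt_clm_apply_const {A B D : Type*} [NormedAddCommGroup A] [NormedSpace ℝ A]
    [NormedAddCommGroup B] [NormedSpace ℝ B] [NormedAddCommGroup D] [NormedSpace ℝ D]
    {Φ : A → B →L[ℝ] D} {Φ' : A →L[ℝ] B →L[ℝ] D} {x : A} (h : HasFDerivAt Φ Φ' x) (w : B) :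
    HasFDerivAt (fun y => Φ y w) (Φ'.flip w) x := by
  simpa using h.clm_apply (hasFDerivAt_const w x)

lemma hasFDerivWithinAt_fun (h₁ : RegularCoercive T f) {p : ℝ × E n} (hp : p ∈ strip n T) :
    HasFDerivWithinAt (uncurryFun f) (fderivWithin ℝ (uncurryFun f) (strip n T) p)
      (strip n T) p :=
  ((h₁.1.differentiableOn (by norm_num)) p hp).hasFDerivWithinAt

lemma hasFDerivAt_space (h₁ : RegularCoercive T f) {t : ℝ} (ht : t ∈ Icc 0 T) (x : E n) :
    HasFDerivAt (f t) (fderivWithin ℝ (uncurryFun f) (strip n T) (t, x) ∘L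
      ContinuousLinearMap.inr ℝ ℝ (E n)) x :=
  hasFDerivAt_slice (G := uncurryFun f) ht (hasFDerivWithinAt_fun h₁ ⟨ht, mem_univ _⟩)

lemma gradX_eq (h₁ : RegularCoercive T f) {t : ℝ} (ht : t ∈ Icc 0 T) (x : E n) :
    gradX f t x = (InnerProductSpace.toDual ℝ (E n)).symm
      (fderivWithin ℝ (uncurryFun f) (strip n T) (t, x) ∘L ContinuousLinearMap.inr ℝ ℝ (E n)) := by
  rw [gradX, gradient, (hasFDerivAt_space h₁ ht x).fderiv]

lemma inner_gradX_eq (f : ℝ → E n → ℝ) (t : ℝ) (x z : E n) :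
    inner ℝ (gradX f t x) z = fderiv ℝ (f t) x z := by
  rw [gradX, gradient, InnerProductSpace.toDual_symm_apply]

lemma contDiff_space (h₁ : RegularCoercive T f) {t : ℝ} (ht : t ∈ Icc 0 T) :
    ContDiff ℝ 3 (f t) := by
  have h : ContDiff ℝ 3 (fun z : E n => (t, z)) := contDiff_const.prodMk contDiff_id
  exact contDiffOn_univ.1 (h₁.1.comp h.contDiffOn (fun z _ => ⟨ht, mem_univ _⟩))

lemma hasFDerivAt_space_inner (h₁ : RegularCoercive T f) {t : ℝ} (ht : t ∈ Icc 0 T) (x : E n) :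
    HasFDerivAt (f t) (innerSL ℝ (gradX f t x)) x := by
  have h := ((contDiff_space h₁ ht).differentiable (by norm_num) x).hasFDerivAt
  have e : innerSL ℝ (gradX f t x) = fderiv ℝ (f t) x :=
    ContinuousLinearMap.ext fun z => inner_gradX_eq f t x z
  rwa [e]

/-- The gradient is the Riesz dual of the x-part of the derivative within the strip, so one order of
smoothness is lost, and this holds up to the times 0 and T. -/
lemma contDiffOn_gradFun (hT : 0 < T) (h₁ : RegularCoercive T f) :
    ContDiffOn ℝ 2 (gradFun f) (strip n T) := by
  have h2 : ContDiffOn ℝ 2 (fderivWithin ℝ (uncurryFun f) (strip n T)) (strip n T) :=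
    h₁.1.fderivWithin (uniqueDiffOn_strip hT) (by norm_num)
  have h3 : ContDiffOn ℝ 2 (fun p => (InnerProductSpace.toDual ℝ (E n)).symm
      (fderivWithin ℝ (uncurryFun f) (strip n T) p ∘L ContinuousLinearMap.inr ℝ ℝ (E n)))
      (strip n T) :=
    (LinearIsometryEquiv.contDiff _).comp_contDiffOn (h2.clm_comp contDiffOn_const)
  exact h3.congr (fun p hp => gradX_eq h₁ hp.1 p.2)

/-- The derivative of the spatial gradient in `(t,x)`, relative to `[0,T] × ℝⁿ`. -/
noncomputable def gradDeriv (T : ℝ) (f : ℝ → E n → ℝ) (p : ℝ × E n) : ℝ × E n →L[ℝ] E n :=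
  fderivWithin ℝ (gradFun f) (strip n T) p

lemma hasFDerivWithinAt_gradFun (hT : 0 < T) (h₁ : RegularCoercive T f) {p : ℝ × E n}
    (hp : p ∈ strip n T) :
    HasFDerivWithinAt (gradFun f) (gradDeriv T f p) (strip n T) p :=
  (((contDiffOn_gradFun hT h₁).differentiableOn (by norm_num)) p hp).hasFDerivWithinAt

lemma continuousOn_gradFun (hT : 0 < T) (h₁ : RegularCoercive T f) :
    ContinuousOn (gradFun f) (strip n T) := (contDiffOn_gradFun hT h₁).continuousOn

lemma contDiffOn_gradDeriv (hT : 0 < T) (h₁ : RegularCoercive T f) :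
    ContDiffOn ℝ 1 (gradDeriv T f) (strip n T) :=
  (contDiffOn_gradFun hT h₁).fderivWithin (uniqueDiffOn_strip hT) (by norm_num)

lemma contDiff_gradX (hT : 0 < T) (h₁ : RegularCoercive T f) {t : ℝ} (ht : t ∈ Icc 0 T) :
    ContDiff ℝ 2 (gradX f t) := by
  have h : ContDiff ℝ 2 (fun z : E n => (t, z)) := contDiff_const.prodMk contDiff_id
  exact contDiffOn_univ.1 ((contDiffOn_gradFun hT h₁).comp h.contDiffOn
    (fun z _ => ⟨ht, mem_univ _⟩))

lemma hessX_eq (hT : 0 < T) (h₁ : RegularCoercive T f) {t : ℝ} (ht : t ∈ Icc 0 T) (x : E n) :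
    hessX f t x = gradDeriv T f (t, x) ∘L ContinuousLinearMap.inr ℝ ℝ (E n) :=
  (hasFDerivAt_slice (G := gradFun f) ht
    (hasFDerivWithinAt_gradFun hT h₁ (p := (t, x)) ⟨ht, mem_univ _⟩)).fderiv

lemma hasFDerivAt_gradX (hT : 0 < T) (h₁ : RegularCoercive T f) {t : ℝ} (ht : t ∈ Icc 0 T)
    (x : E n) : HasFDerivAt (gradX f t) (hessX f t x) x :=
  ((contDiff_gradX hT h₁ ht).differentiable (by norm_num) x).hasFDerivAt

lemma contDiffOn_hessX (hT : 0 < T) (h₁ : RegularCoercive T f) :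
    ContDiffOn ℝ 1 (fun p : ℝ × E n => hessX f p.1 p.2) (strip n T) :=
  ((contDiffOn_gradDeriv hT h₁).clm_comp contDiffOn_const).congr
    (fun p hp => hessX_eq hT h₁ hp.1 p.2)

lemma inner_hessX_eq (hT : 0 < T) (h₁ : RegularCoercive T f) {t : ℝ} (ht : t ∈ Icc 0 T)
    (x z w : E n) : inner ℝ (hessX f t x z) w = fderiv ℝ (fderiv ℝ (f t)) x z w := by
  have h1 : HasFDerivAt (fun y => inner ℝ (gradX f t y) w)
      ((innerSL ℝ w) ∘L hessX f t x) x := by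
    have := (innerSL ℝ w).hasFDerivAt.comp x (hasFDerivAt_gradX hT h₁ ht x)
    refine this.congr_of_eventuallyEq (Eventually.of_forall fun y => ?_)
    simp [real_inner_comm]
  have h2 : HasFDerivAt (fun y => fderiv ℝ (f t) y w)
      ((fderiv ℝ (fderiv ℝ (f t)) x).flip w) x := by
    have h3 : ContDiff ℝ 2 (fderiv ℝ (f t)) := (contDiff_space h₁ ht).fderiv_right (by norm_num)
    exact hasFDerivAt_clm_apply_const (h3.differentiable (by norm_num) x).hasFDerivAt w
  have h4 := h1.unique (h2.congr_of_eventuallyEq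
    (Eventually.of_forall fun y => inner_gradX_eq f t y w))
  have h5 := congrArg (fun L : E n →L[ℝ] ℝ => L z) h4
  simpa [real_inner_comm] using h5

lemma hessX_symm (hT : 0 < T) (h₁ : RegularCoercive T f) {t : ℝ} (ht : t ∈ Icc 0 T)
    (x z w : E n) : inner ℝ (hessX f t x z) w = inner ℝ z (hessX f t x w) := by
  have hs : IsSymmSndFDerivAt ℝ (f t) x :=
    ((contDiff_space h₁ ht).contDiffAt).isSymmSndFDerivAt (by simp; norm_num)
  rw [real_inner_comm _ z, inner_hessX_eq hT h₁ ht, inner_hessX_eq hT h₁ ht]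
  exact hs z w

lemma thirdDeriv_eq (f : ℝ → E n → ℝ) (t : ℝ) (x l : E n) :
    thirdDeriv f t x l = fderiv ℝ (fderiv ℝ (fderiv ℝ (f t))) x l l l := by
  rw [thirdDeriv, iteratedFDeriv_succ_apply_right, iteratedFDeriv_two_apply]
  rfl

lemma mem_nhds_strip {t : ℝ} (ht : t ∈ Ioo 0 T) (x : E n) : strip n T ∈ 𝓝 (t, x) :=
  prod_mem_nhds (Icc_mem_nhds ht.1 ht.2) univ_mem

lemma hasStrictFDerivAt_gradFun (hT : 0 < T) (h₁ : RegularCoercive T f) {t : ℝ}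
    (ht : t ∈ Ioo 0 T) (x : E n) :
    HasStrictFDerivAt (gradFun f) (gradDeriv T f (t, x)) (t, x) := by
  have h := ((contDiffOn_gradFun hT h₁).contDiffAt (mem_nhds_strip ht x)).hasStrictFDerivAt
    (by norm_num)
  rwa [← fderivWithin_of_mem_nhds (mem_nhds_strip ht x)] at h

/-- Schwarz's theorem for f as a function of (t,x). At interior times the derivative relative to
[0,T] is an ordinary one. -/
lemma mixedDeriv_eq (hT : 0 < T) (h₁ : RegularCoercive T f) {t : ℝ}
    (ht : t ∈ Ioo 0 T) (x l : E n) :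
    mixedDeriv T f t x l = inner ℝ (gradDeriv T f (t, x) (1, 0)) l := by
  have ht' : t ∈ Icc 0 T := Ioo_subset_Icc_self ht
  set F := uncurryFun f
  have hF : ContDiffAt ℝ 3 F (t, x) := h₁.1.contDiffAt (mem_nhds_strip ht x)
  have hD : HasFDerivAt (fderiv ℝ F) (fderiv ℝ (fderiv ℝ F) (t, x)) (t, x) :=
    ((hF.fderiv_right (m := 2) (by norm_num)).differentiableAt (by norm_num)).hasFDerivAt
  have hFd : ∀ z, HasFDerivAt F (fderiv ℝ F (t, z)) (t, z) := fun z =>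
    ((h₁.1.contDiffAt (mem_nhds_strip ht z)).differentiableAt (by norm_num)).hasFDerivAt
  have e1 : ∀ z, derivWithin (fun s => f s z) (Icc 0 T) t = fderiv ℝ F (t, z) (1, 0) := by
    intro z
    rw [derivWithin_of_mem_nhds (Icc_mem_nhds ht.1 ht.2)]
    have := (hFd z).comp t (hasFDerivAt_prodMk_left (𝕜 := ℝ) t z)
    have h8 := this.hasDerivAt.deriv
    simp only [ContinuousLinearMap.comp_apply, ContinuousLinearMap.inl_apply] at h8
    exact h8
  have e2 : HasFDerivAt (fun z => fderiv ℝ F (t, z) (1, 0))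
      (((fderiv ℝ (fderiv ℝ F) (t, x)).flip (1, 0)) ∘L ContinuousLinearMap.inr ℝ ℝ (E n)) x := by
    exact (hasFDerivAt_clm_apply_const hD (1, 0)).comp x (hasFDerivAt_prodMk_right t x)
  have e3 : mixedDeriv T f t x l = fderiv ℝ (fderiv ℝ F) (t, x) (0, l) (1, 0) := by
    rw [mixedDeriv]
    simp_rw [e1]
    rw [gradient, e2.fderiv, InnerProductSpace.toDual_symm_apply]
    simp
  have e4 : HasFDerivAt (fun p => fderiv ℝ F p (0, l))
      ((fderiv ℝ (fderiv ℝ F) (t, x)).flip (0, l)) (t, x) := by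
    exact hasFDerivAt_clm_apply_const hD (0, l)
  have e5 : HasFDerivAt (fun p => inner ℝ (gradFun f p) l)
      ((innerSL ℝ l) ∘L gradDeriv T f (t, x)) (t, x) := by
    have := (innerSL ℝ l).hasFDerivAt.comp (t, x)
      (hasStrictFDerivAt_gradFun hT h₁ ht x).hasFDerivAt
    refine this.congr_of_eventuallyEq (Eventually.of_forall fun y => ?_)
    simp [real_inner_comm]
  have e6 : (fun p => inner ℝ (gradFun f p) l) =ᶠ[𝓝 (t, x)] fun p => fderiv ℝ F p (0, l) := by
    have hnear : ∀ᶠ p : ℝ × E n in 𝓝 (t, x), p.1 ∈ Ioo 0 T :=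
      continuous_fst.continuousAt.eventually (isOpen_Ioo.mem_nhds ht)
    filter_upwards [hnear] with p hp
    rw [inner_gradX_eq]
    have := (((h₁.1.contDiffAt (mem_nhds_strip hp p.2)).differentiableAt
      (by norm_num)).hasFDerivAt).comp p.2 (hasFDerivAt_prodMk_right p.1 p.2)
    have h7 : fderiv ℝ (f p.1) p.2 = _ := this.fderiv
    rw [h7]
    simp [F]
  have e7 := congrArg (fun L : ℝ × E n →L[ℝ] ℝ => L (1, 0))
    ((e4.congr_of_eventuallyEq e6).unique e5)
  have hs : IsSymmSndFDerivAt ℝ F (t, x) := hF.isSymmSndFDerivAt (by simp; norm_num)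
  rw [e3, hs (0, l) (1, 0)]
  simpa [real_inner_comm] using e7

/-! ### Invariant balls, global flows, Grönwall estimates and convergence of gradient-like curves.
-/

section Abstract

variable {V : Type*} [NormedAddCommGroup V] [InnerProductSpace ℝ V]

lemma HasDerivWithinAt.Ici_of_Icc {W : Type*} [NormedAddCommGroup W] [NormedSpace ℝ W]
    {e : ℝ → W} {e' : W} {a b t : ℝ} (h : HasDerivWithinAt e e' (Icc a b) t) (ht : t ∈ Ico a b) :
    HasDerivWithinAt e e' (Ici t) t :=
  h.mono_of_mem_nhdsWithin (Icc_mem_nhdsGE_of_mem ht)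

/-- A curve whose velocity points strictly inward on the sphere of radius `η` does not leave the
ball of radius `η`. -/
lemma norm_le_of_inward {e e' : ℝ → V} {a b η : ℝ} (hη : 0 ≤ η)
    (he : ∀ t ∈ Icc a b, HasDerivWithinAt e (e' t) (Icc a b) t) (h0 : ‖e a‖ ≤ η)
    (hin : ∀ t ∈ Ico a b, ‖e t‖ = η → inner ℝ (e t) (e' t) < 0) :
    ∀ t ∈ Icc a b, ‖e t‖ ≤ η := by
  have hd : ∀ t ∈ Icc a b, HasDerivWithinAt (fun s => ‖e s‖ ^ 2) (2 * inner ℝ (e t) (e' t))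
      (Icc a b) t := fun t ht => (he t ht).norm_sq
  intro t ht
  have := image_le_of_deriv_right_lt_deriv_boundary' (f := fun s => ‖e s‖ ^ 2)
    (f' := fun t => 2 * inner ℝ (e t) (e' t)) (B := fun _ => η ^ 2) (B' := fun _ => 0)
    (fun t ht => (hd t ht).continuousWithinAt)
    (fun t ht => HasDerivWithinAt.Ici_of_Icc (hd t (Ico_subset_Icc_self ht)) ht)
    (by gcongr) continuousOn_const (fun t _ => hasDerivWithinAt_const _ _ _)
    (fun t ht h => by
      have h1 : ‖e t‖ = η := by
        rwa [sq_eq_sq₀ (norm_nonneg _) hη] at h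
      have := hin t ht h1
      linarith) ht
  exact (sq_le_sq₀ (norm_nonneg _) hη).1 this

/-- The first time at which a continuous function reaches the level `ρ`. -/
lemma exists_first_exit {h : ℝ → ℝ} {a b ρ : ℝ} (hab : a ≤ b) (hc : ContinuousOn h (Icc a b))
    (ha : h a < ρ) (hb : ρ ≤ h b) :
    ∃ σ ∈ Ioc a b, h σ = ρ ∧ ∀ t ∈ Ico a σ, h t < ρ := by
  have hcl : IsCompact (Icc a b ∩ h ⁻¹' Ici ρ) :=
    isCompact_Icc.of_isClosed_subset (hc.preimage_isClosed_of_isClosed isClosed_Icc isClosed_Ici)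
      inter_subset_left
  obtain ⟨σ, hσ, hmin⟩ := hcl.exists_isLeast ⟨b, ⟨hab, le_rfl⟩, hb⟩
  have haσ : a < σ := by
    rcases hσ.1.1.eq_or_lt with h' | h'
    · subst h'; exact absurd hσ.2 (not_le.2 ha)
    · exact h'
  have hlt : ∀ t ∈ Ico a σ, h t < ρ := by
    intro t ht
    by_contra hcon
    exact absurd (hmin ⟨⟨ht.1, ht.2.le.trans hσ.1.2⟩, not_lt.1 hcon⟩) (not_le.2 ht.2)
  refine ⟨σ, ⟨haσ, hσ.1.2⟩, ?_, hlt⟩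
  refine le_antisymm ?_ hσ.2
  have hcw : ContinuousWithinAt h (Ico a σ) σ :=
    (hc σ hσ.1).mono fun t ht => ⟨ht.1, ht.2.le.trans hσ.1.2⟩
  have : σ ∈ closure (Ico a σ) := by
    rw [closure_Ico haσ.ne]; exact ⟨haσ.le, le_rfl⟩
  have : (𝓝[Ico a σ] σ).NeBot := mem_closure_iff_nhdsWithin_neBot.1 this
  exact le_of_tendsto hcw (eventually_mem_nhdsWithin.mono fun t ht => (hlt t ht).le)

/-- A bounded globally Lipschitz vector field is complete. -/
lemma exists_global_solution [CompleteSpace V] {X : V → V} {K : NNReal} (hX : LipschitzWith K X)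
    {M : ℝ} (hM : ∀ x, ‖X x‖ ≤ M) (p : V) :
    ∃ w : ℝ → V, w 0 = p ∧ ∀ s, HasDerivAt w (X (w s)) s := by
  have hM0 : 0 ≤ M := (norm_nonneg _).trans (hM p)
  have hex : ∀ N : ℕ, ∃ α : ℝ → V, α 0 = p ∧ ∀ t ∈ Ioo (-((N : ℝ) + 1)) (N + 1),
      HasDerivAt α (X (α t)) t := by
    intro N
    have hN : (0 : ℝ) ∈ Icc (-((N : ℝ) + 1)) (N + 1) := ⟨by linarith [N.cast_nonneg (α := ℝ)],
      by positivity⟩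
    -- The speed bound confines the solution during time N + 1 to a ball of radius M (N + 1), so the
    -- local existence theorem covers the whole interval.
    have hP : IsPicardLindelof (fun _ => X) (⟨0, hN⟩ : Icc (-((N : ℝ) + 1)) (N + 1)) p
        (⟨M * (N + 1), by positivity⟩) 0 ⟨M, hM0⟩ K :=
      { lipschitzOnWith := fun t _ => hX.lipschitzOnWith
        continuousOn := fun x _ => continuousOn_const
        norm_le := fun t _ x _ => hM x
        mul_max_le := by simp; exact le_rfl }
    obtain ⟨α, h0, hα⟩ := hP.exists_eq_forall_mem_Icc_hasDerivWithinAt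
      (x := p) (Metric.mem_closedBall_self (by simp))
    exact ⟨α, h0, fun t ht => (hα t (Ioo_subset_Icc_self ht)).hasDerivAt
      (Icc_mem_nhds ht.1 ht.2)⟩
  choose α h0 hα using hex
  have hagree : ∀ N N' : ℕ, N ≤ N' → EqOn (α N) (α N') (Ioo (-((N : ℝ) + 1)) (N + 1)) := by
    intro N N' hle
    have hle' : (N : ℝ) ≤ N' := by exact_mod_cast hle
    refine ODE_solution_unique_of_mem_Ioo (v := fun _ => X) (s := fun _ => univ) (K := K)
      (t₀ := 0) (fun t _ => hX.lipschitzOnWith)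
      ⟨by linarith [N.cast_nonneg (α := ℝ)], by positivity⟩ (fun t ht => ⟨hα N t ht, mem_univ _⟩)
      (fun t ht => ⟨hα N' t ⟨by linarith [ht.1], by linarith [ht.2]⟩, mem_univ _⟩) ?_
    rw [h0, h0]
  -- At time s the solution of index ⌈|s|⌉ is used; by uniqueness the glued curve coincides near s
  -- with the single solution of the next index.
  refine ⟨fun s => α ⌈|s|⌉₊ s, by simp [h0], fun s => ?_⟩
  set N := ⌈|s|⌉₊ + 1
  have hw : ∀ r ∈ Ioo (-(N : ℝ)) N, α ⌈|r|⌉₊ r = α N r := by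
    intro r hr
    have hr' : |r| < N := abs_lt.2 hr
    have h1 : ⌈|r|⌉₊ ≤ N := Nat.ceil_le.2 hr'.le
    refine hagree _ _ h1 ?_
    have := Nat.le_ceil |r|
    exact abs_lt.1 (by linarith)
  have hsN : s ∈ Ioo (-(N : ℝ)) N := by
    refine abs_lt.1 ?_
    have := Nat.le_ceil |s|
    push_cast [N]; linarith
  have hd : HasDerivAt (α N) (X (α N s)) s :=
    hα N s ⟨by linarith [hsN.1], by linarith [hsN.2]⟩
  have heq : (fun r => α ⌈|r|⌉₊ r) =ᶠ[𝓝 s] α N := by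
    filter_upwards [isOpen_Ioo.mem_nhds hsN] with r hr using hw r hr
  show HasDerivAt _ (X (α ⌈|s|⌉₊ s)) s
  rw [hw s hsN]
  exact hd.congr_of_eventuallyEq heq

/-- Grönwall's inequality, where 1 ≤ K lets the factor κ / K be replaced by κ. -/
lemma approx_solution_forward {X : V → V} {K : NNReal} (hK : 1 ≤ K) (hX : LipschitzWith K X)
    {w z z' : ℝ → V} {S κ : ℝ} (hκ0 : 0 ≤ κ)
    (hw : ∀ s ∈ Icc 0 S, HasDerivWithinAt w (X (w s)) (Icc 0 S) s)
    (hz : ∀ s ∈ Icc 0 S, HasDerivWithinAt z (z' s) (Icc 0 S) s)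
    (hκ : ∀ s ∈ Icc 0 S, ‖z' s - X (z s)‖ ≤ κ) :
    ∀ s ∈ Icc 0 S, ‖z s - w s‖ ≤ (‖z 0 - w 0‖ + κ) * Real.exp (K * S) := by
  intro s hs
  have h := dist_le_of_approx_trajectories_ODE (v := fun _ => X) (K := K) (f := z) (g := w)
    (f' := z') (g' := fun s => X (w s)) (a := 0) (b := S) (εf := κ) (εg := 0)
    (δ := ‖z 0 - w 0‖) (fun _ => hX)
    (fun t ht => (hz t ht).continuousWithinAt)
    (fun t ht => HasDerivWithinAt.Ici_of_Icc (hz t (Ico_subset_Icc_self ht)) ht)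
    (fun t ht => by rw [dist_eq_norm]; exact hκ t (Ico_subset_Icc_self ht))
    (fun t ht => (hw t ht).continuousWithinAt)
    (fun t ht => HasDerivWithinAt.Ici_of_Icc (hw t (Ico_subset_Icc_self ht)) ht)
    (fun t _ => by simp) (by rw [dist_eq_norm]) s hs
  have hK' : (1 : ℝ) ≤ K := by exact_mod_cast hK
  rw [dist_eq_norm, gronwallBound_of_K_ne_0 (by positivity), add_zero, sub_zero] at h
  refine h.trans ?_
  have h1 : Real.exp (K * s) ≤ Real.exp (K * S) := by
    gcongr; exact hs.2
  have h2 : κ / K ≤ κ := div_le_self hκ0 hK'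
  have h3 : κ / K * (Real.exp (K * s) - 1) ≤ κ * Real.exp (K * S) :=
    mul_le_mul h2 (by linarith) (by
      have := Real.one_le_exp (x := K * s) (mul_nonneg (by positivity) hs.1)
      linarith) hκ0
  have h4 : ‖z 0 - w 0‖ * Real.exp (K * s) ≤ ‖z 0 - w 0‖ * Real.exp (K * S) := by gcongr
  linarith

/-- Two-sided Grönwall estimate between a solution and an approximate solution. -/
lemma approx_solution_bound {X : V → V} {K : NNReal} (hK : 1 ≤ K) (hX : LipschitzWith K X)
    {w z z' : ℝ → V} {S κ : ℝ} (hκ0 : 0 ≤ κ)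
    (hw : ∀ s, HasDerivAt w (X (w s)) s)
    (hz : ∀ s ∈ Icc (-S) S, HasDerivWithinAt z (z' s) (Icc (-S) S) s)
    (hκ : ∀ s ∈ Icc (-S) S, ‖z' s - X (z s)‖ ≤ κ) :
    ∀ s ∈ Icc (-S) S, ‖z s - w s‖ ≤ (‖z 0 - w 0‖ + κ) * Real.exp (K * S) := by
  intro s hs
  have hS : 0 ≤ S := by linarith [hs.1, hs.2]
  have hsub : Icc 0 S ⊆ Icc (-S) S := Icc_subset_Icc_left (by linarith)
  rcases le_total 0 s with h0 | h0
  · exact approx_solution_forward hK hX hκ0 (fun s _ => (hw s).hasDerivWithinAt)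
      (fun s hs => (hz s (hsub hs)).mono hsub) (fun s hs => hκ s (hsub hs)) s ⟨h0, hs.2⟩
  -- Negative times are positive times for the reversed field.
  · have hneg : ∀ r ∈ Icc 0 S, -r ∈ Icc (-S) S := fun r hr => ⟨by linarith [hr.2], by
      linarith [hr.1]⟩
    have := approx_solution_forward (X := fun x => -X x) (w := fun r => w (-r))
      (z := fun r => z (-r)) (z' := fun r => -z' (-r)) (S := S) (κ := κ) hK
      hX.neg hκ0
      (fun r _ => by
        have := (hw (-r)).scomp r (hasDerivAt_neg r)
        simpa [Function.comp_def] using this.hasDerivWithinAt)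
      (fun r hr => by
        have := (hz (-r) (hneg r hr)).scomp r (hasDerivWithinAt_neg r (Icc 0 S))
          (fun q hq => hneg q hq)
        simpa [Function.comp_def] using this)
      (fun r hr => by
        have := hκ (-r) (hneg r hr)
        rwa [← norm_neg, show -(-z' (-r) - -X (z (-r))) = z' (-r) - X (z (-r)) by abel])
      (-s) ⟨by linarith, by linarith [hs.1]⟩
    simpa using this

/-- Along a solution with convergent energy the velocity tends to zero. -/
lemma velocity_tendsto_zero {X : V → V} {K : NNReal} (hX : LipschitzWith K X)
    {M : ℝ} (hM : ∀ x, ‖X x‖ ≤ M) {w : ℝ → V} (hw : ∀ s, HasDerivAt w (X (w s)) s)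
    {φ : ℝ → ℝ} {L : ℝ} {l : Filter ℝ} (hl : ∀ δ : ℝ, Tendsto (fun s => s + δ) l l)
    (hφ : Tendsto φ l (𝓝 L))
    (hd : ∀ᶠ s in l, ∀ r ∈ Icc s (s + 1), HasDerivAt φ (-‖X (w r)‖ ^ 2) r) :
    Tendsto (fun s => X (w s)) l (𝓝 0) := by
  rw [Metric.tendsto_nhds]
  intro η hη
  have hM0 : 0 ≤ M := (norm_nonneg _).trans (hM 0)
  -- Within time δ the velocity field along the curve varies by at most K M δ ≤ η / 2, while the
  -- mean value theorem for φ yields a time in that interval with speed below η / 2.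
  set δ : ℝ := min 1 (η / (2 * (K * M + 1)))
  have hKM : 0 < K * M + 1 := by positivity
  have hδ : 0 < δ := lt_min one_pos (by positivity)
  have hδ1 : δ ≤ 1 := min_le_left _ _
  have hδ2 : K * M * δ ≤ η / 2 := by
    have : δ ≤ η / (2 * (K * M + 1)) := min_le_right _ _
    calc K * M * δ ≤ (K * M + 1) * (η / (2 * (K * M + 1))) := by gcongr; linarith
      _ = η / 2 := by field_simp
  have hdiff : Tendsto (fun s => φ s - φ (s + δ)) l (𝓝 0) := by
    simpa using hφ.sub (hφ.comp (hl δ))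
  have hsmall : ∀ᶠ s in l, φ s - φ (s + δ) < δ * (η / 2) ^ 2 :=
    hdiff.eventually (gt_mem_nhds (by positivity))
  filter_upwards [hd, hsmall] with s hs1 hs2
  obtain ⟨r, hr, hr'⟩ := exists_hasDerivAt_eq_slope φ (fun r => -‖X (w r)‖ ^ 2)
    (by linarith : s < s + δ)
    (fun r hr => (hs1 r ⟨hr.1, by linarith [hr.2]⟩).continuousAt.continuousWithinAt)
    (fun r hr => hs1 r ⟨hr.1.le, by linarith [hr.2]⟩)
  have h1 : ‖X (w r)‖ ^ 2 < (η / 2) ^ 2 := by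
    have h2 : φ s - φ (s + δ) = δ * ‖X (w r)‖ ^ 2 := by
      rw [eq_div_iff (by linarith)] at hr'
      linarith
    rw [h2] at hs2
    exact lt_of_mul_lt_mul_left hs2 hδ.le
  have h3 : ‖X (w r)‖ < η / 2 := lt_of_pow_lt_pow_left₀ 2 (by positivity) h1
  have h4 : ‖w s - w r‖ ≤ M * ‖s - r‖ :=
    (convex_univ).norm_image_sub_le_of_norm_hasDerivWithin_le
      (fun x _ => (hw x).hasDerivWithinAt) (fun x _ => hM _) (mem_univ _) (mem_univ _)
  have h5 : ‖s - r‖ ≤ δ := by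
    rw [Real.norm_eq_abs, abs_le]; constructor <;> linarith [hr.1, hr.2]
  have h6 : ‖X (w s) - X (w r)‖ ≤ η / 2 := by
    have := hX.dist_le_mul (w s) (w r)
    rw [dist_eq_norm, dist_eq_norm] at this
    calc _ ≤ K * ‖w s - w r‖ := this
      _ ≤ K * (M * δ) := by gcongr; exact h4.trans (by gcongr)
      _ = K * M * δ := by ring
      _ ≤ _ := hδ2
  rw [dist_zero_right]
  calc ‖X (w s)‖ = ‖(X (w s) - X (w r)) + X (w r)‖ := by congr 1; abel
    _ ≤ _ := norm_add_le _ _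
    _ < η := by linarith

/-- A curve along which `g` tends to zero converges to each of its cluster points that is an
isolated zero of `g`. -/
lemma tendsto_of_mapClusterPt_isolated {V : Type*} [NormedAddCommGroup V]
    [ProperSpace V] {W : Type*} [NormedAddCommGroup W]
    {w : ℝ → V} {l : Filter ℝ}
    (hl : ∀ U ∈ l, ∃ U' ∈ l, U' ⊆ U ∧ IsPreconnected U' ∧ ContinuousOn w U')
    {g : V → W} (hg : Continuous g) (hgw : Tendsto (fun s => g (w s)) l (𝓝 0)) {p : V}
    (hp : MapClusterPt p l w) {r : ℝ} (hr : 0 < r)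
    (hiso : ∀ x ∈ Metric.closedBall p r, g x = 0 → x = p) :
    Tendsto w l (𝓝 p) := by
  have key : ∀ r' ∈ Ioc 0 r, ∀ᶠ s in l, dist (w s) p < r' := by
    intro r' hr'
    -- On the sphere ‖g‖ has a positive minimum, so the curve eventually avoids it. Since it is
    -- frequently inside and connected on a tail, it remains inside.
    have hU : ∀ᶠ s in l, dist (w s) p ≠ r' := by
      rcases (Metric.sphere p r').eq_empty_or_nonempty with he | hne
      · exact Eventually.of_forall fun s hs => by
          have : w s ∈ Metric.sphere p r' := hs
          rw [he] at this; exact this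
      obtain ⟨x₀, hx₀, hmin⟩ := (isCompact_sphere p r').exists_isMinOn hne
        (hg.norm.continuousOn)
      have hpos : 0 < ‖g x₀‖ := by
        rw [norm_pos_iff]
        intro h0
        have h1 := hiso x₀ (Metric.closedBall_subset_closedBall hr'.2
          (Metric.sphere_subset_closedBall hx₀)) h0
        rw [h1, Metric.mem_sphere, dist_self] at hx₀
        exact hr'.1.ne hx₀
      have h2 : ∀ᶠ s in l, ‖g (w s)‖ < ‖g x₀‖ := by
        have := hgw.norm
        rw [norm_zero] at this
        exact this.eventually (gt_mem_nhds hpos)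
      filter_upwards [h2] with s hs heq
      exact absurd (hmin (show w s ∈ Metric.sphere p r' from heq)) (not_le.2 hs)
    obtain ⟨U', hU', hsub, hpre, hcont⟩ := hl _ hU
    have hfr : ∃ᶠ s in l, w s ∈ Metric.ball p r' := by
      rw [mapClusterPt_iff_frequently] at hp
      exact hp _ (Metric.ball_mem_nhds p hr'.1)
    obtain ⟨s₀, hs₀, hs₀'⟩ := (hfr.and_eventually hU').exists
    filter_upwards [hU'] with s hs
    by_contra hcon
    have hd : ContinuousOn (fun s => dist (w s) p) U' :=
      (continuous_id.dist continuous_const).comp_continuousOn hcont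
    obtain ⟨q, hq, hq'⟩ := hpre.intermediate_value hs₀' hs hd
      ⟨(show dist (w s₀) p < r' from hs₀).le, not_lt.1 hcon⟩
    exact hsub hq hq'
  rw [Metric.tendsto_nhds]
  intro η hη
  filter_upwards [key (min η r) ⟨lt_min hη hr, min_le_right _ _⟩] with s hs
  exact hs.trans_le (min_le_left _ _)

/-- A `C¹` vector field agrees on a given ball with a bounded globally Lipschitz one. -/
lemma exists_truncation [FiniteDimensional ℝ V] {h : V → V} (hh : ContDiff ℝ 1 h) {R : ℝ}
    (hR : 0 < R) :
    ∃ (X : V → V) (K : NNReal) (M : ℝ), 1 ≤ K ∧ LipschitzWith K X ∧ (∀ x, ‖X x‖ ≤ M) ∧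
      ∀ x, ‖x‖ ≤ R → X x = h x := by
  let χ : ContDiffBump (0 : V) := ⟨R, R + 1, hR, by linarith⟩
  have hc : HasCompactSupport (fun x => χ x • h x) := χ.hasCompactSupport.smul_right
  have hs : ContDiff ℝ 1 (fun x => χ x • h x) := χ.contDiff.smul hh
  obtain ⟨K, hK⟩ := hs.lipschitzWith_of_hasCompactSupport hc (by norm_num)
  obtain ⟨M, hM⟩ := hs.continuous.bounded_above_of_compact_support hc
  refine ⟨_, max 1 K, M, le_max_left _ _, hK.weaken (le_max_right _ _), hM, fun x hx => ?_⟩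
  have : χ x = 1 := χ.one_of_mem_closedBall (by simpa using hx)
  simp [this]

end Abstract

/-! ### Positive definite and semidefinite Hessians. -/

lemma exists_pos_lower_bound (L : E n →L[ℝ] E n) (P : Submodule ℝ (E n))
    (h : ∀ z ∈ P, z ≠ 0 → 0 < inner ℝ (L z) z) :
    ∃ m > 0, ∀ z ∈ P, m * ‖z‖ ^ 2 ≤ inner ℝ (L z) z := by
  have hcomp : IsCompact (Metric.sphere (0 : E n) 1 ∩ P) :=
    (isCompact_sphere 0 1).inter_right P.closed_of_finiteDimensional
  have hcont : Continuous fun z : E n => inner ℝ (L z) z := by fun_prop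
  rcases (Metric.sphere (0 : E n) 1 ∩ P).eq_empty_or_nonempty with he | hne
  · refine ⟨1, one_pos, fun z hz => ?_⟩
    rcases eq_or_ne z 0 with rfl | h0
    · simp
    · have : (‖z‖⁻¹ • z) ∈ Metric.sphere (0 : E n) 1 ∩ P :=
        ⟨by simp [norm_smul, h0], P.smul_mem _ hz⟩
      rw [he] at this
      exact this.elim
  · obtain ⟨z₀, hz₀, hmin⟩ := hcomp.exists_isMinOn hne hcont.continuousOn
    have hz₀0 : z₀ ≠ 0 := by
      rintro rfl
      simpa using hz₀.1
    refine ⟨inner ℝ (L z₀) z₀, h z₀ hz₀.2 hz₀0, fun z hz => ?_⟩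
    rcases eq_or_ne z 0 with rfl | h0
    · simp
    · have hzn : 0 < ‖z‖ := norm_pos_iff.2 h0
      have hmem : (‖z‖⁻¹ • z) ∈ Metric.sphere (0 : E n) 1 ∩ P :=
        ⟨by simp [norm_smul, h0], P.smul_mem _ hz⟩
      have := hmin hmem
      simp only [mem_ofPred_eq, map_smul, inner_smul_left, inner_smul_right] at this
      simp only [conj_trivial] at this
      calc inner ℝ (L z₀) z₀ * ‖z‖ ^ 2
          ≤ (‖z‖⁻¹ * (‖z‖⁻¹ * inner ℝ (L z) z)) * ‖z‖ ^ 2 := by gcongr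
        _ = inner ℝ (L z) z := by field_simp

lemma HessPosDef.exists_bound {t : ℝ} {x : E n} (h : HessPosDef f t x) :
    ∃ m > 0, ∀ z : E n, m * ‖z‖ ^ 2 ≤ inner ℝ (hessX f t x z) z := by
  obtain ⟨m, hm, h'⟩ := exists_pos_lower_bound (hessX f t x) ⊤ (fun z _ hz => h z hz)
  exact ⟨m, hm, fun z => h' z trivial⟩

lemma HessPosDef.posSemidef {t : ℝ} {x : E n} (h : HessPosDef f t x) : HessPosSemidef f t x := by
  intro z
  rcases eq_or_ne z 0 with rfl | hz
  · simp
  · exact (h z hz).le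

/-- A zero of a nonnegative quadratic form is a minimum, so the first-order term vanishes in the
direction L z; by symmetry that term is 2‖L z‖². -/
lemma HessPosSemidef.apply_eq_zero (hT : 0 < T) (h₁ : RegularCoercive T f) {t : ℝ}
    (ht : t ∈ Icc 0 T) {x : E n} (h : HessPosSemidef f t x) {z : E n}
    (hz : inner ℝ (hessX f t x z) z = 0) : hessX f t x z = 0 := by
  set L := hessX f t x
  have hsym : ∀ u v, inner ℝ (L u) v = inner ℝ u (L v) := hessX_symm hT h₁ ht x
  by_contra hne
  have hpos : 0 < ‖L z‖ ^ 2 := by positivity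
  set q := inner ℝ (L (L z)) (L z)
  have hq : 0 ≤ q := h (L z)
  have key : ∀ s : ℝ, 0 ≤ 2 * s * ‖L z‖ ^ 2 + s ^ 2 * q := by
    intro s
    have := h (z + s • L z)
    have e : inner ℝ (L (z + s • L z)) (z + s • L z) = 2 * s * ‖L z‖ ^ 2 + s ^ 2 * q := by
      simp only [map_add, map_smul, inner_add_left, inner_add_right, inner_smul_left,
        inner_smul_right, conj_trivial]
      rw [hz, hsym (L z) z, real_inner_self_eq_norm_sq]
      ring
    rwa [e] at this
  -- At this parameter the negative linear term beats the quadratic one; the + 1 avoids division by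
  -- zero when q = 0.
  have h2 := key (-(‖L z‖ ^ 2 / (q + 1)))
  have h3 : 2 * -(‖L z‖ ^ 2 / (q + 1)) * ‖L z‖ ^ 2 + (-(‖L z‖ ^ 2 / (q + 1))) ^ 2 * q
      = - ((‖L z‖ ^ 2) ^ 2 / (q + 1)) * (2 - q / (q + 1)) := by
    field_simp
    ring
  rw [h3] at h2
  have h4 : q / (q + 1) < 1 := by rw [div_lt_one (by positivity)]; linarith
  have h5 : 0 < (‖L z‖ ^ 2) ^ 2 / (q + 1) := by positivity
  nlinarith

lemma HessPosSemidef.posDef_of_det_ne_zero (hT : 0 < T) (h₁ : RegularCoercive T f) {t : ℝ}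
    (ht : t ∈ Icc 0 T) {x : E n} (h : HessPosSemidef f t x) (hdet : (hessX f t x).det ≠ 0) :
    HessPosDef f t x := by
  intro z hz
  refine (h z).lt_of_ne fun h0 => hz ?_
  have h1 := h.apply_eq_zero hT h₁ ht h0.symm
  by_contra hne
  refine hdet (LinearMap.det_eq_zero_iff_ker_ne_bot.2 ?_)
  rw [Submodule.ne_bot_iff]
  exact ⟨z, h1, hne⟩

lemma HessPosDef.det_ne_zero {t : ℝ} {x : E n} (h : HessPosDef f t x) :
    (hessX f t x).det ≠ 0 := by
  intro h0
  have := LinearMap.det_eq_zero_iff_ker_ne_bot.1 h0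
  rw [Submodule.ne_bot_iff] at this
  obtain ⟨z, hz, hne⟩ := this
  have h2 : hessX f t x z = 0 := hz
  have h1 := h z hne
  rw [h2, inner_zero_left] at h1
  exact lt_irrefl _ h1

/-! ### Monotonicity, trapping spheres and inward balls. -/

/-- Near a point the gradient differs from its linearization by a map with small Lipschitz
constant. -/
lemma exists_gradX_approx_linear (hT : 0 < T) (h₁ : RegularCoercive T f) {t₀ : ℝ}
    (ht₀ : t₀ ∈ Icc 0 T) (p : E n) {δ : ℝ} (hδ : 0 < δ) :
    ∃ r > 0, ∀ t ∈ Icc 0 T, |t - t₀| ≤ r → ∀ x ∈ Metric.closedBall p r,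
      ∀ y ∈ Metric.closedBall p r,
      ‖gradX f t x - gradX f t y - hessX f t₀ p (x - y)‖ ≤ δ * ‖x - y‖ := by
  have hc := (contDiffOn_hessX hT h₁).continuousOn (t₀, p) ⟨ht₀, mem_univ _⟩
  rw [Metric.continuousWithinAt_iff] at hc
  obtain ⟨r, hr, hc⟩ := hc δ hδ
  refine ⟨r / 2, by positivity, fun t ht htt x hx y hy => ?_⟩
  refine (convex_closedBall p (r / 2)).norm_image_sub_le_of_norm_hasFDerivWithin_le'
    (f' := fun z => hessX f t z)
    (fun z _ => (hasFDerivAt_gradX hT h₁ ht z).hasFDerivWithinAt) (fun z hz => ?_) hy hx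
  have h2 := hc (x := (t, z)) ⟨ht, mem_univ _⟩ (by
    rw [Prod.dist_eq, max_lt_iff]
    refine ⟨?_, (Metric.mem_closedBall.1 hz).trans_lt (by linarith)⟩
    rw [Real.dist_eq]
    exact htt.trans_lt (by linarith))
  rw [dist_eq_norm] at h2
  exact h2.le

/-- Uniform strong monotonicity of the gradient near a nondegenerate minimum. -/
lemma HessPosDef.strong_monotone (hT : 0 < T) (h₁ : RegularCoercive T f) {t₀ : ℝ}
    (ht₀ : t₀ ∈ Icc 0 T) {p : E n} (hp : HessPosDef f t₀ p) :
    ∃ m > 0, ∃ r > 0, ∀ t ∈ Icc 0 T, |t - t₀| ≤ r → ∀ x ∈ Metric.closedBall p r,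
      ∀ y ∈ Metric.closedBall p r,
      m * ‖x - y‖ ^ 2 ≤ inner ℝ (gradX f t x - gradX f t y) (x - y) := by
  obtain ⟨m, hm, hb⟩ := hp.exists_bound
  obtain ⟨r, hr, h⟩ := exists_gradX_approx_linear hT h₁ ht₀ p (half_pos hm)
  refine ⟨m / 2, half_pos hm, r, hr, fun t ht htt x hx y hy => ?_⟩
  have h2 := h t ht htt x hx y hy
  have h3 := hb (x - y)
  have h4 := abs_real_inner_le_norm (gradX f t x - gradX f t y - hessX f t₀ p (x - y)) (x - y)
  have h5 : |inner ℝ (gradX f t x - gradX f t y - hessX f t₀ p (x - y)) (x - y)|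
      ≤ m / 2 * ‖x - y‖ ^ 2 := by
    refine h4.trans ?_
    calc _ ≤ (m / 2 * ‖x - y‖) * ‖x - y‖ := by gcongr
      _ = _ := by ring
  rw [inner_sub_left] at h5
  linarith [(abs_le.1 h5).1]

/-- With R₀ = a₀ / c₀ + 1 ≥ 1 one has c₀ R² ≥ c₀ R ≥ a₀ + c₀ for R ≥ R₀, so coercivity gives a
positive radial component. -/
lemma RegularCoercive.exists_trapping (h₁ : RegularCoercive T f) :
    ∃ R₀ > 0, ∀ R ≥ R₀, ∀ t ∈ Icc 0 T, ∀ x : E n, ‖x‖ = R → 0 < inner ℝ (gradX f t x) x := by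
  obtain ⟨-, c₀, a₀, hc, ha, h⟩ := h₁
  refine ⟨a₀ / c₀ + 1, by positivity, fun R hR t ht x hx => lt_of_lt_of_le ?_ (h t ht x)⟩
  have h0 : 0 ≤ a₀ / c₀ := by positivity
  have h1 : a₀ / c₀ + 1 ≤ R ^ 2 := by nlinarith
  have h2 : a₀ + c₀ ≤ c₀ * R ^ 2 := by
    calc a₀ + c₀ = c₀ * (a₀ / c₀ + 1) := by field_simp
      _ ≤ _ := by gcongr
  rw [hx]; linarith

/-- Small balls around a nondegenerate minimum are inward for all nearby times. -/
lemma exists_inward_ball (hT : 0 < T) (h₁ : RegularCoercive T f) {t₀ : ℝ}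
    (ht₀ : t₀ ∈ Icc 0 T) {p : E n} (hcrit : gradX f t₀ p = 0) (hp : HessPosDef f t₀ p)
    {η : ℝ} (hη : 0 < η) :
    ∃ η' ∈ Ioc 0 η, ∃ δ > 0, ∀ t ∈ Icc 0 T, |t - t₀| ≤ δ → ∀ x, ‖x - p‖ = η' →
      0 < inner ℝ (gradX f t x) (x - p) := by
  obtain ⟨m, hm, r, hr, h⟩ := hp.strong_monotone hT h₁ ht₀
  set η' := min η r
  have hη' : 0 < η' := lt_min hη hr
  have hc := (continuousOn_gradFun hT h₁).comp (f := fun t : ℝ => (t, p)) (s := Icc 0 T)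
    (by fun_prop) (fun t ht => ⟨ht, mem_univ _⟩) t₀ ht₀
  rw [Metric.continuousWithinAt_iff] at hc
  -- On the sphere monotonicity contributes m η'², which beats ‖∇ₓf(t,p)‖ η' once the gradient at p
  -- is below m η'.
  obtain ⟨δ, hδ, hc⟩ := hc (m * η') (by positivity)
  refine ⟨η', ⟨hη', min_le_left _ _⟩, min r (δ / 2), by positivity, fun t ht htt x hx => ?_⟩
  have h2 := h t ht (htt.trans (min_le_left _ _)) x
    (by rw [mem_closedBall_iff_norm, hx]; exact min_le_right _ _) p (by simp [hr.le])
  have h3 : ‖gradX f t p‖ < m * η' := by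
    have := hc ht (by
      rw [Real.dist_eq]
      exact (htt.trans (min_le_right _ _)).trans_lt (by linarith))
    simpa [hcrit, dist_eq_norm] using this
  have h4 := abs_real_inner_le_norm (gradX f t p) (x - p)
  rw [inner_sub_left, hx] at h2
  rw [hx] at h4
  have h5 := (abs_le.1 h4).1
  have h6 : ‖gradX f t p‖ * η' < m * η' * η' := by gcongr
  nlinarith

/-! ### A priori estimates for the perturbed equation. -/

section EpsSolution

variable {ε : ℝ} {y : E n} {w : ℝ → E n}

lemma IsEpsSolution.continuousOn (hw : IsEpsSolution T f ε y w) : ContinuousOn w (Icc 0 T) :=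
  fun t ht => (hw.2 t ht).continuousWithinAt

/-- The factor ε⁻¹ does not affect the sign of the radial velocity, so one inward ball serves all ε.
-/
lemma IsEpsSolution.mem_closedBall (hw : IsEpsSolution T f ε y w) (hε : 0 < ε) {a b : ℝ}
    (ha : 0 ≤ a) (hb : b ≤ T) {p : E n} {η : ℝ} (hη : 0 ≤ η)
    (hin : ∀ t ∈ Icc a b, ∀ x, ‖x - p‖ = η → 0 < inner ℝ (gradX f t x) (x - p))
    (h0 : ‖w a - p‖ ≤ η) : ∀ t ∈ Icc a b, ‖w t - p‖ ≤ η := by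
  have hsub : Icc a b ⊆ Icc 0 T := Icc_subset_Icc ha hb
  refine norm_le_of_inward (e := fun t => w t - p) (e' := fun t => -(ε⁻¹ • gradX f t (w t))) hη
    (fun t ht => ((hw.2 t (hsub ht)).mono hsub).sub_const p) h0 (fun t ht h => ?_)
  have := hin t (Ico_subset_Icc_self ht) _ h
  rw [inner_neg_right, inner_smul_right, real_inner_comm]
  have h2 : 0 < ε⁻¹ := inv_pos.2 hε
  have := mul_pos h2 this
  linarith

lemma IsEpsSolution.norm_le (hw : IsEpsSolution T f ε y w) (hε : 0 < ε) {R : ℝ} (hR : 0 ≤ R)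
    (htrap : ∀ t ∈ Icc 0 T, ∀ x : E n, ‖x‖ = R → 0 < inner ℝ (gradX f t x) x)
    (hy : ‖y‖ ≤ R) : ∀ t ∈ Icc 0 T, ‖w t‖ ≤ R := by
  have := hw.mem_closedBall hε (le_refl 0) (le_refl T) (p := 0) hR
    (fun t ht x hx => by simpa using htrap t ht x (by simpa using hx))
    (by simpa [hw.1] using hy)
  simpa using this

/-- The energy identity: the time part of the chain rule gives f_t, and the velocity -ε⁻¹∇ₓf gives
the dissipation. -/
lemma IsEpsSolution.hasDerivWithinAt_energy (h₁ : RegularCoercive T f)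
    (hw : IsEpsSolution T f ε y w) {t : ℝ} (ht : t ∈ Icc 0 T) :
    HasDerivWithinAt (fun t => f t (w t))
      (fderivWithin ℝ (uncurryFun f) (strip n T) (t, w t) (1, 0) - ε⁻¹ * ‖gradX f t (w t)‖ ^ 2)
      (Icc 0 T) t := by
  have h2 : HasDerivWithinAt (fun t => (t, w t)) (1, -(ε⁻¹ • gradX f t (w t))) (Icc 0 T) t :=
    (hasDerivWithinAt_id t _).prodMk (hw.2 t ht)
  have hmaps : MapsTo (fun t => (t, w t)) (Icc 0 T) (strip n T) := fun s hs => ⟨hs, mem_univ _⟩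
  have h3 := (hasFDerivWithinAt_fun h₁ (hmaps ht)).comp_hasDerivWithinAt t h2 hmaps
  refine h3.congr_deriv ?_
  have e : ((1 : ℝ), -(ε⁻¹ • gradX f t (w t))) = (1, 0) + (0, -(ε⁻¹ • gradX f t (w t))) := by simp
  have e2 : fderivWithin ℝ (uncurryFun f) (strip n T) (t, w t) (0, -(ε⁻¹ • gradX f t (w t)))
      = fderiv ℝ (f t) (w t) (-(ε⁻¹ • gradX f t (w t))) := by
    rw [(hasFDerivAt_space h₁ ht (w t)).fderiv]; simp
  rw [e, map_add, e2, ← inner_gradX_eq, inner_neg_right, inner_smul_right,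
    real_inner_self_eq_norm_sq]
  ring

/-- For small `ε` a solution cannot stay during a fixed time interval in a compact set free of
critical points. -/
lemma exists_eps_exit (hT : 0 < T) (h₁ : RegularCoercive T f) {c d : ℝ} (hc : 0 ≤ c) (hcd : c < d)
    (hd : d ≤ T) {C : Set (E n)} (hC : IsCompact C)
    (hne : ∀ t ∈ Icc c d, ∀ x ∈ C, gradX f t x ≠ 0) :
    ∃ ε₀ > 0, ∀ ε ∈ Ioo 0 ε₀, ∀ (y : E n) (w : ℝ → E n), IsEpsSolution T f ε y w →
      ∃ t ∈ Icc c d, w t ∉ C := by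
  have hsub : Icc c d ⊆ Icc 0 T := Icc_subset_Icc hc hd
  have hK : IsCompact (Icc c d ×ˢ C) := isCompact_Icc.prod hC
  have hKs : Icc c d ×ˢ C ⊆ strip n T := prod_mono hsub (subset_univ _)
  rcases C.eq_empty_or_nonempty with rfl | hCne
  · exact ⟨1, one_pos, fun ε _ y w _ => ⟨c, ⟨le_rfl, hcd.le⟩, notMem_empty _⟩⟩
  have hKne : (Icc c d ×ˢ C).Nonempty := ⟨(c, hCne.some), ⟨⟨le_rfl, hcd.le⟩, hCne.some_mem⟩⟩
  obtain ⟨m, hm, hmin⟩ : ∃ m > 0, ∀ t ∈ Icc c d, ∀ x ∈ C, m ≤ ‖gradX f t x‖ := by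
    obtain ⟨p₀, hp₀, hmin⟩ := hK.exists_isMinOn hKne ((continuousOn_gradFun hT h₁).mono hKs).norm
    exact ⟨‖gradFun f p₀‖, norm_pos_iff.2 (hne p₀.1 hp₀.1 p₀.2 hp₀.2),
      fun t ht x hx => isMinOn_iff.1 hmin (t, x) ⟨ht, hx⟩⟩
  obtain ⟨B, hB⟩ := hK.exists_bound_of_continuousOn (h₁.1.continuousOn.mono hKs)
  have hft : ContinuousOn (fun p => fderivWithin ℝ (uncurryFun f) (strip n T) p (1, 0))
      (strip n T) :=
    ((h₁.1.fderivWithin (m := 2) (uniqueDiffOn_strip hT) (by norm_num)).continuousOn).clm_apply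
      continuousOn_const
  obtain ⟨M, hM⟩ := hK.exists_bound_of_continuousOn (hft.mono hKs)
  have hB0 : 0 ≤ B := (norm_nonneg _).trans (hB _ hKne.some_mem)
  have hM0 : 0 ≤ M := (norm_nonneg _).trans (hM _ hKne.some_mem)
  -- If the curve stayed in C, the energy would have mean slope at least -2B/(d - c), whereas its
  -- derivative is at most M - m²/ε. For ε < m²/A these are incompatible.
  set A := M + 2 * B / (d - c) + 1
  have hdc : 0 < d - c := by linarith
  have hA : 0 < A := by positivity
  refine ⟨m ^ 2 / A, by positivity, fun ε hε y w hw => ?_⟩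
  by_contra! hcon
  obtain ⟨t, ht, hslope⟩ := exists_hasDerivAt_eq_slope (fun t => f t (w t))
    (fun t => fderivWithin ℝ (uncurryFun f) (strip n T) (t, w t) (1, 0)
      - ε⁻¹ * ‖gradX f t (w t)‖ ^ 2) hcd
    (fun t ht => ((hw.hasDerivWithinAt_energy h₁ (hsub ht)).mono hsub).continuousWithinAt)
    (fun t ht => (hw.hasDerivWithinAt_energy h₁ (hsub (Ioo_subset_Icc_self ht))).hasDerivAt
      (Icc_mem_nhds (by linarith [ht.1]) (by linarith [ht.2])))
  have htI := Ioo_subset_Icc_self ht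
  have hmem : (t, w t) ∈ Icc c d ×ˢ C := ⟨htI, hcon t htI⟩
  have h1 : fderivWithin ℝ (uncurryFun f) (strip n T) (t, w t) (1, 0) ≤ M :=
    (Real.le_norm_self _).trans (hM _ hmem)
  have h2 : m ≤ ‖gradX f t (w t)‖ := hmin t htI _ (hcon t htI)
  have h3 : f c (w c) ≤ B :=
    (Real.le_norm_self _).trans (hB (c, w c) ⟨⟨le_rfl, hcd.le⟩, hcon c ⟨le_rfl, hcd.le⟩⟩)
  have h4 : -f d (w d) ≤ B :=
    (neg_le_abs _).trans (hB (d, w d) ⟨⟨hcd.le, le_rfl⟩, hcon d ⟨hcd.le, le_rfl⟩⟩)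
  have h5 : -(2 * B / (d - c)) ≤ (f d (w d) - f c (w c)) / (d - c) := by
    rw [← neg_div]
    exact div_le_div_of_nonneg_right (by linarith) hdc.le
  have h6 : A < ε⁻¹ * ‖gradX f t (w t)‖ ^ 2 := by
    have h7 : ε * A < m ^ 2 := (lt_div_iff₀ hA).1 hε.2
    have h8 : m ^ 2 ≤ ‖gradX f t (w t)‖ ^ 2 := by gcongr
    calc A = ε⁻¹ * (ε * A) := by rw [← mul_assoc, inv_mul_cancel₀ hε.1.ne', one_mul]
      _ < ε⁻¹ * ‖gradX f t (w t)‖ ^ 2 :=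
        mul_lt_mul_of_pos_left (h7.trans_le h8) (inv_pos.2 hε.1)
  linarith

/-- Rescaled solutions follow the fast flow. -/
lemma exists_blowup_bound (hT : 0 < T) (h₁ : RegularCoercive T f) {τ : ℝ} (hτ : τ ∈ Ioo 0 T)
    {R : ℝ} {X : E n → E n} {K : NNReal} (hK : 1 ≤ K) (hX : LipschitzWith K X)
    (hXg : ∀ x, ‖x‖ ≤ R → X x = -gradX f τ x) (S : ℝ) {η : ℝ} (hη : 0 < η) :
    ∃ δ > 0, ∀ ε > 0, ∀ (y : E n) (w : ℝ → E n), IsEpsSolution T f ε y w →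
      (∀ t ∈ Icc 0 T, ‖w t‖ ≤ R) → ∀ σ, |σ - τ| + ε * S ≤ δ →
      ∀ z : ℝ → E n, (∀ s, HasDerivAt z (X (z s)) s) → ‖w σ - z 0‖ ≤ δ →
      ∀ s ∈ Icc (-S) S, σ + ε * s ∈ Icc 0 T ∧ ‖w (σ + ε * s) - z s‖ ≤ η := by
  -- An initial error and a defect of at most κ each are amplified by Grönwall to at most η.
  set κ := η / (2 * Real.exp (K * S))
  have hκ : 0 < κ := by positivity
  have hτ' : τ ∈ Icc 0 T := Ioo_subset_Icc_self hτ
  have huc : UniformContinuousOn (gradFun f) (Icc 0 T ×ˢ Metric.closedBall 0 R) :=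
    (isCompact_Icc.prod (isCompact_closedBall 0 R)).uniformContinuousOn_of_continuous
      ((continuousOn_gradFun hT h₁).mono (prod_mono le_rfl (subset_univ _)))
  rw [Metric.uniformContinuousOn_iff] at huc
  obtain ⟨δ₁, hδ₁, huc⟩ := huc κ hκ
  have hτ1 := hτ.1
  have hτ2 : 0 < T - τ := by linarith [hτ.2]
  -- The term δ₁ / 2 keeps the gradient within κ of the frozen one; the last two keep the rescaled
  -- window inside [0,T].
  refine ⟨min (min κ (δ₁ / 2)) (min τ (T - τ)), by positivity, ?_⟩
  intro ε hε y w hw hwR σ hσ z hz hz0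
  have hσ1 : |σ - τ| + ε * S ≤ δ₁ / 2 := hσ.trans ((min_le_left _ _).trans (min_le_right _ _))
  have hσ2 : |σ - τ| + ε * S ≤ τ := hσ.trans ((min_le_right _ _).trans (min_le_left _ _))
  have hσ3 : |σ - τ| + ε * S ≤ T - τ := hσ.trans ((min_le_right _ _).trans (min_le_right _ _))
  have hz1 : ‖w σ - z 0‖ ≤ κ := hz0.trans ((min_le_left _ _).trans (min_le_left _ _))
  have habs := abs_le.1 (le_refl |σ - τ|)
  have hbound : ∀ s ∈ Icc (-S) S, |σ + ε * s - τ| ≤ |σ - τ| + ε * S := by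
    intro s hs
    calc |σ + ε * s - τ| = |(σ - τ) + ε * s| := by congr 1; ring
      _ ≤ |σ - τ| + |ε * s| := abs_add_le _ _
      _ ≤ _ := by
        rw [abs_mul, abs_of_pos hε]
        gcongr
        exact abs_le.2 hs
  have hmem : ∀ s ∈ Icc (-S) S, σ + ε * s ∈ Icc 0 T := by
    intro s hs
    have := abs_le.1 (hbound s hs)
    exact ⟨by linarith [this.1], by linarith [this.2]⟩
  have hmain := approx_solution_bound hK hX (w := z) (z := fun s => w (σ + ε * s))
    (z' := fun s => -gradX f (σ + ε * s) (w (σ + ε * s))) (S := S) hκ.le hz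
    (fun s hs => by
      have h2 : HasDerivWithinAt (fun s => σ + ε * s) ε (Icc (-S) S) s := by
        simpa using ((hasDerivWithinAt_id s (Icc (-S) S)).const_mul ε).const_add σ
      have h3 := (hw.2 _ (hmem s hs)).scomp s h2 (fun r hr => hmem r hr)
      simpa [Function.comp_def, smul_smul, hε.ne'] using h3)
    (fun s hs => by
      have hR := hwR _ (hmem s hs)
      rw [hXg _ hR]
      have := huc (σ + ε * s, w (σ + ε * s)) ⟨hmem s hs, by simpa using hR⟩
        (τ, w (σ + ε * s)) ⟨hτ', by simpa using hR⟩ (by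
          rw [Prod.dist_eq]
          simp only [dist_self]
          rw [max_lt_iff]
          refine ⟨?_, hδ₁⟩
          rw [Real.dist_eq]
          have := hbound s hs
          linarith)
      rw [dist_eq_norm] at this
      rw [← norm_neg]
      refine le_trans (le_of_eq ?_) this.le
      congr 1
      simp only [gradFun]
      abel)
  intro s hs
  refine ⟨hmem s hs, (hmain s hs).trans ?_⟩
  simp only [mul_zero, add_zero]
  calc (‖w σ - z 0‖ + κ) * Real.exp (K * S) ≤ (κ + κ) * Real.exp (K * S) := by gcongr
    _ = η := by simp only [κ]; field_simp; ring

end EpsSolution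

/-! ### The frozen fast flow: energy decay and limits at infinity. -/

/-- `X` is a bounded globally Lipschitz field which agrees with `-∇ₓ f(τ,·)` on the ball of
radius `R`. -/
structure IsTruncation (f : ℝ → E n → ℝ) (τ R : ℝ) (X : E n → E n) (K : NNReal) (M : ℝ) :
    Prop where
  one_le : 1 ≤ K
  lipschitz : LipschitzWith K X
  bound : ∀ x, ‖X x‖ ≤ M
  agree : ∀ x, ‖x‖ ≤ R → X x = -gradX f τ x

/-- `w` is an integral curve of `X` defined on the whole line. -/
def IsFlowLine (X : E n → E n) (w : ℝ → E n) : Prop := ∀ s, HasDerivAt w (X (w s)) s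

lemma exists_isTruncation (hT : 0 < T) (h₁ : RegularCoercive T f) {τ : ℝ} (hτ : τ ∈ Icc 0 T)
    {R : ℝ} (hR : 0 < R) : ∃ X K M, IsTruncation f τ R X K M := by
  obtain ⟨X, K, M, h1, h2, h3, h4⟩ := exists_truncation (h := fun x => -gradX f τ x)
    ((contDiff_gradX hT h₁ hτ).neg.of_le (by norm_num)) hR
  exact ⟨X, K, M, h1, h2, h3, h4⟩

section Flow

variable {τ R M : ℝ} {X : E n → E n} {K : NNReal} {w : ℝ → E n}

lemma IsFlowLine.continuous (hw : IsFlowLine X w) : Continuous w :=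
  continuous_iff_continuousAt.2 fun s => (hw s).continuousAt

lemma IsFlowLine.shift (hw : IsFlowLine X w) (a : ℝ) : IsFlowLine X (fun s => w (a + s)) := by
  intro s
  simpa using (hw (a + s)).comp_const_add a s

lemma IsTruncation.exists_flowLine (hX : IsTruncation f τ R X K M) (p : E n) :
    ∃ w, w 0 = p ∧ IsFlowLine X w := exists_global_solution hX.lipschitz hX.bound p

lemma IsTruncation.dist_le (hX : IsTruncation f τ R X K M) {w z : ℝ → E n} (hw : IsFlowLine X w)
    (hz : IsFlowLine X z) {S s : ℝ} (hs : s ∈ Icc (-S) S) :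
    ‖z s - w s‖ ≤ ‖z 0 - w 0‖ * Real.exp (K * S) := by
  have := approx_solution_bound hX.one_le hX.lipschitz (w := w) (z := z) (S := S) (κ := 0) le_rfl
    hw (fun s _ => (hz s).hasDerivWithinAt) (fun s _ => by simp) s hs
  simpa using this

lemma IsFastSolution.isFlowLine (hX : IsTruncation f τ R X K M) (hw : IsFastSolution f τ w)
    (hR : ∀ s, ‖w s‖ ≤ R) : IsFlowLine X w := fun s => by
  rw [hX.agree _ (hR s)]; exact hw s

lemma IsFlowLine.isFastSolution (hX : IsTruncation f τ R X K M) (hw : IsFlowLine X w)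
    (hR : ∀ s, ‖w s‖ ≤ R) : IsFastSolution f τ w := fun s => by
  rw [← hX.agree _ (hR s)]; exact hw s

lemma IsFlowLine.hasDerivAt_energy (h₁ : RegularCoercive T f) (hτ : τ ∈ Icc 0 T)
    (hX : IsTruncation f τ R X K M) (hw : IsFlowLine X w) {s : ℝ} (hs : ‖w s‖ ≤ R) :
    HasDerivAt (fun s => f τ (w s)) (-‖X (w s)‖ ^ 2) s := by
  have h := (hasFDerivAt_space_inner h₁ hτ (w s)).comp_hasDerivAt s (hw s)
  refine h.congr_deriv ?_
  have : gradX f τ (w s) = -X (w s) := by rw [hX.agree _ hs, neg_neg]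
  rw [innerSL_apply_apply, this, inner_neg_left, real_inner_self_eq_norm_sq]

/-- On the sphere of radius R the truncated field is still the true one, which points inward there.
-/
lemma IsFlowLine.norm_le_forward (hτ : τ ∈ Icc 0 T)
    (hX : IsTruncation f τ R X K M) (hw : IsFlowLine X w) (hR : 0 ≤ R)
    (htrap : ∀ t ∈ Icc 0 T, ∀ x : E n, ‖x‖ = R → 0 < inner ℝ (gradX f t x) x) {a : ℝ}
    (ha : ‖w a‖ ≤ R) : ∀ s, a ≤ s → ‖w s‖ ≤ R := by
  intro s hs
  refine norm_le_of_inward (e := w) (e' := fun s => X (w s)) (a := a) (b := s) hR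
    (fun t _ => (hw t).hasDerivWithinAt) ha (fun t _ h => ?_) s ⟨hs, le_rfl⟩
  rw [hX.agree _ h.le, inner_neg_right, real_inner_comm]
  linarith [htrap τ hτ _ h]

lemma IsFlowLine.energy_antitoneOn (h₁ : RegularCoercive T f) (hτ : τ ∈ Icc 0 T)
    (hX : IsTruncation f τ R X K M) (hw : IsFlowLine X w) {D : Set ℝ} (hD : Convex ℝ D)
    (hs : ∀ s ∈ D, ‖w s‖ ≤ R) : AntitoneOn (fun s => f τ (w s)) D := by
  refine antitoneOn_of_hasDerivWithinAt_nonpos (f' := fun s => -‖X (w s)‖ ^ 2) hD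
    (fun s hs' => (hw.hasDerivAt_energy h₁ hτ hX (hs s hs')).continuousAt.continuousWithinAt)
    (fun s hs' => (hw.hasDerivAt_energy h₁ hτ hX
      (hs s (interior_subset hs'))).hasDerivWithinAt) (fun s _ => ?_)
  have := sq_nonneg ‖X (w s)‖
  linarith

lemma exists_energy_bound (h₁ : RegularCoercive T f) (hτ : τ ∈ Icc 0 T) (R : ℝ) :
    ∃ B, ∀ x : E n, ‖x‖ ≤ R → |f τ x| ≤ B := by
  obtain ⟨B, hB⟩ := (isCompact_closedBall (0 : E n) R).exists_bound_of_continuousOn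
    (contDiff_space h₁ hτ).continuous.continuousOn
  exact ⟨B, fun x hx => hB x (by simpa using hx)⟩

/-- The energy is nonincreasing and bounded below, hence convergent, and then the velocity tends to
zero by `velocity_tendsto_zero`. -/
lemma IsFlowLine.gradX_tendsto_atTop (h₁ : RegularCoercive T f) (hτ : τ ∈ Icc 0 T)
    (hX : IsTruncation f τ R X K M) (hw : IsFlowLine X w) (hs : ∀ s, 0 ≤ s → ‖w s‖ ≤ R) :
    Tendsto (fun s => gradX f τ (w s)) atTop (𝓝 0) := by
  obtain ⟨B, hB⟩ := exists_energy_bound h₁ hτ R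
  have hanti := hw.energy_antitoneOn h₁ hτ hX (convex_Ici 0) (fun s hs' => hs s hs')
  -- Stopping the curve before time 0 makes the energy antitone on the whole line without changing
  -- its limit at +∞.
  have hψ : Antitone fun s => f τ (w (max s 0)) := fun s t hst =>
    hanti (mem_Ici.2 (le_max_right _ _)) (mem_Ici.2 (le_max_right _ _)) (max_le_max_right 0 hst)
  have hbdd : BddBelow (range fun s => f τ (w (max s 0))) :=
    ⟨-B, by rintro _ ⟨s, rfl⟩; exact (abs_le.1 (hB _ (hs _ (le_max_right _ _)))).1⟩
  have hlim := tendsto_atTop_ciInf hψ hbdd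
  have hlim' : Tendsto (fun s => f τ (w s)) atTop (𝓝 (⨅ s, f τ (w (max s 0)))) := by
    refine hlim.congr' ?_
    filter_upwards [eventually_ge_atTop 0] with s hs'
    rw [max_eq_left hs']
  have := velocity_tendsto_zero hX.lipschitz hX.bound hw
    (fun δ => tendsto_atTop_add_const_right _ δ tendsto_id) hlim' (by
      filter_upwards [eventually_ge_atTop 0] with s hs' r hr
      exact hw.hasDerivAt_energy h₁ hτ hX (hs r (hs'.trans hr.1)))
  have h2 := this.neg
  rw [neg_zero] at h2
  refine h2.congr' ?_
  filter_upwards [eventually_ge_atTop 0] with s hs'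
  rw [hX.agree _ (hs s hs'), neg_neg]

lemma IsFlowLine.gradX_tendsto_atBot (h₁ : RegularCoercive T f) (hτ : τ ∈ Icc 0 T)
    (hX : IsTruncation f τ R X K M) (hw : IsFlowLine X w) (hs : ∀ s, s ≤ 0 → ‖w s‖ ≤ R) :
    Tendsto (fun s => gradX f τ (w s)) atBot (𝓝 0) := by
  obtain ⟨B, hB⟩ := exists_energy_bound h₁ hτ R
  have hanti := hw.energy_antitoneOn h₁ hτ hX (convex_Iic 0) (fun s hs' => hs s hs')
  have hψ : Antitone fun s => f τ (w (min s 0)) := fun s t hst =>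
    hanti (mem_Iic.2 (min_le_right _ _)) (mem_Iic.2 (min_le_right _ _)) (min_le_min_right 0 hst)
  have hbdd : BddAbove (range fun s => f τ (w (min s 0))) :=
    ⟨B, by rintro _ ⟨s, rfl⟩; exact (abs_le.1 (hB _ (hs _ (min_le_right _ _)))).2⟩
  have hlim := tendsto_atBot_ciSup hψ hbdd
  have hlim' : Tendsto (fun s => f τ (w s)) atBot (𝓝 (⨆ s, f τ (w (min s 0)))) := by
    refine hlim.congr' ?_
    filter_upwards [eventually_le_atBot 0] with s hs'
    rw [min_eq_left hs']
  have := velocity_tendsto_zero hX.lipschitz hX.bound hw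
    (fun δ => tendsto_atBot_add_const_right _ δ tendsto_id) hlim' (by
      filter_upwards [eventually_le_atBot (-1)] with s hs' r hr
      exact hw.hasDerivAt_energy h₁ hτ hX (hs r (by linarith [hr.2])))
  have h2 := this.neg
  rw [neg_zero] at h2
  refine h2.congr' ?_
  filter_upwards [eventually_le_atBot 0] with s hs'
  rw [hX.agree _ (hs s hs'), neg_neg]

/-- Every cluster point in A is a zero of g, hence equals ξ, and compactness turns a unique cluster
point into a limit. -/
lemma tendsto_of_unique_zero {ι W : Type*} [NormedAddCommGroup W] {l : Filter ι} {w : ι → E n}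
    {A : Set (E n)} (hA : IsCompact A) (hwA : ∀ᶠ s in l, w s ∈ A) {g : E n → W}
    (hg : Continuous g) (hgw : Tendsto (fun s => g (w s)) l (𝓝 0)) {ξ : E n}
    (hu : ∀ x ∈ A, g x = 0 → x = ξ) : Tendsto w l (𝓝 ξ) := by
  refine hA.tendsto_nhds_of_unique_mapClusterPt hwA fun x hx hcl => hu x hx ?_
  have h1 : MapClusterPt (g x) l (g ∘ w) := hcl.continuousAt_comp hg.continuousAt
  have h2 : ClusterPt (g x) (𝓝 0) := ClusterPt.mono h1 hgw
  exact eq_of_nhds_neBot h2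

lemma IsFlowLine.tendsto_atBot (hT : 0 < T) (h₁ : RegularCoercive T f) (hτ : τ ∈ Icc 0 T)
    (hX : IsTruncation f τ R X K M) (hw : IsFlowLine X w) {A : Set (E n)} (hA : IsCompact A)
    (hAR : ∀ x ∈ A, ‖x‖ ≤ R) (hwA : ∀ s, s ≤ 0 → w s ∈ A) {ξ : E n}
    (hu : ∀ x ∈ A, gradX f τ x = 0 → x = ξ) : Tendsto w atBot (𝓝 ξ) :=
  tendsto_of_unique_zero hA ((eventually_le_atBot 0).mono hwA)
    (contDiff_gradX hT h₁ hτ).continuous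
    (hw.gradX_tendsto_atBot h₁ hτ hX fun s hs => hAR _ (hwA s hs)) hu

lemma IsFlowLine.tendsto_atTop (hT : 0 < T) (h₁ : RegularCoercive T f) (hτ : τ ∈ Icc 0 T)
    (hX : IsTruncation f τ R X K M) (hw : IsFlowLine X w) {A : Set (E n)} (hA : IsCompact A)
    (hAR : ∀ x ∈ A, ‖x‖ ≤ R) (hwA : ∀ s, 0 ≤ s → w s ∈ A) {ξ : E n}
    (hu : ∀ x ∈ A, gradX f τ x = 0 → x = ξ) : Tendsto w atTop (𝓝 ξ) :=
  tendsto_of_unique_zero hA ((eventually_ge_atTop 0).mono hwA)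
    (contDiff_gradX hT h₁ hτ).continuous
    (hw.gradX_tendsto_atTop h₁ hτ hX fun s hs => hAR _ (hwA s hs)) hu

/-- A flow line issuing from `ξ` at `-∞` with energy not below that of `ξ` is constant up to
that time. -/
lemma IsFlowLine.eq_of_energy_ge (h₁ : RegularCoercive T f) (hτ : τ ∈ Icc 0 T)
    (hX : IsTruncation f τ R X K M) (hw : IsFlowLine X w) {a : ℝ} (hs : ∀ s ≤ a, ‖w s‖ ≤ R)
    {ξ : E n} (hlim : Tendsto w atBot (𝓝 ξ)) (hE : f τ ξ ≤ f τ (w a)) : w a = ξ := by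
  have hanti := hw.energy_antitoneOn h₁ hτ hX (convex_Iic a) (fun s hs' => hs s hs')
  have hElim : Tendsto (fun s => f τ (w s)) atBot (𝓝 (f τ ξ)) :=
    ((contDiff_space h₁ hτ).continuous.tendsto ξ).comp hlim
  -- The energy decreases from its limit f(ξ) at -∞. The hypothesis at time a forces it to be
  -- constant, so the velocity vanishes and the curve rests at ξ.
  have hle : ∀ s ≤ a, f τ (w s) ≤ f τ ξ := fun s hs' =>
    ge_of_tendsto hElim ((eventually_le_atBot s).mono fun r hr =>
      hanti (show r ≤ a from hr.trans hs') hs' hr)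
  have hconst : ∀ s ≤ a, f τ (w s) = f τ ξ := fun s hs' =>
    le_antisymm (hle s hs') (hE.trans (hanti hs' (le_refl a) hs'))
  have hzero : ∀ s < a, X (w s) = 0 := by
    intro s hs'
    have h1 := hw.hasDerivAt_energy h₁ hτ hX (hs s hs'.le)
    have h2 : HasDerivAt (fun s => f τ (w s)) 0 s := by
      refine (hasDerivAt_const s (f τ ξ)).congr_of_eventuallyEq ?_
      filter_upwards [Iio_mem_nhds hs'] with r hr using hconst r (le_of_lt hr)
    have h3 := h1.unique h2
    have h4 : ‖X (w s)‖ ^ 2 = 0 := by linarith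
    simpa using h4
  have hc : ∀ s ≤ a, w s = w a := by
    intro s hs'
    rcases hs'.eq_or_lt with rfl | hlt
    · rfl
    have := constant_of_has_deriv_right_zero (f := w) (a := s) (b := a) hw.continuous.continuousOn
      (fun r hr => by
        have := (hw r).hasDerivWithinAt (s := Ici r)
        rwa [hzero r hr.2] at this) a ⟨hlt.le, le_rfl⟩
    exact this.symm
  exact tendsto_nhds_unique (tendsto_const_nhds.congr' ((eventually_le_atBot a).mono
    fun s hs' => (hc s hs').symm)) hlim

end Flow

/-! ### Local analysis at fold points: expansion, isolation and the cone estimate. -/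

/-- A degenerate critical pair with positive semidefinite Hessian, whose kernel is spanned by the
unit vector `l`, oriented so that the third derivative along `l` is negative. -/
structure IsFold (T : ℝ) (f : ℝ → E n → ℝ) (τ : ℝ) (ξ l : E n) : Prop where
  mem : τ ∈ Ioo 0 T
  crit : gradX f τ ξ = 0
  psd : HessPosSemidef f τ ξ
  norm_eq : ‖l‖ = 1
  ker : LinearMap.ker (hessX f τ ξ : E n →ₗ[ℝ] E n) = Submodule.span ℝ {l}
  mixed_ne : mixedDeriv T f τ ξ l ≠ 0
  third_neg : thirdDeriv f τ ξ l < 0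

/-- The component of `z` orthogonal to the unit vector `l`. -/
noncomputable def perp (l : E n) : E n →L[ℝ] E n :=
  ContinuousLinearMap.id ℝ (E n) - (innerSL ℝ l).smulRight l

/-- The gauge `max (|⟨l,z⟩|, ‖z - ⟨l,z⟩ l‖)`. -/
noncomputable def foldGauge (l z : E n) : ℝ := max |inner ℝ l z| ‖perp l z‖

lemma perp_apply (l z : E n) : perp l z = z - (inner ℝ l z : ℝ) • l := by
  simp [perp]

lemma eq_add_perp (l z : E n) : z = (inner ℝ l z : ℝ) • l + perp l z := by
  rw [perp_apply]; abel

lemma inner_perp (hl : ‖l‖ = 1) (z : E n) : inner ℝ l (perp l z) = 0 := by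
  rw [perp_apply, inner_sub_right, inner_smul_right, real_inner_self_eq_norm_sq, hl]; ring

lemma norm_sq_eq_perp (hl : ‖l‖ = 1) (z : E n) :
    ‖z‖ ^ 2 = (inner ℝ l z) ^ 2 + ‖perp l z‖ ^ 2 := by
  conv_lhs => rw [eq_add_perp l z]
  rw [norm_add_sq_real, inner_smul_left, inner_perp hl, norm_smul, hl, Real.norm_eq_abs]
  simp

lemma abs_inner_le_norm' (hl : ‖l‖ = 1) (z : E n) : |inner ℝ l z| ≤ ‖z‖ := by
  simpa [hl] using abs_real_inner_le_norm l z

lemma norm_perp_le (hl : ‖l‖ = 1) (z : E n) : ‖perp l z‖ ≤ ‖z‖ := by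
  have := norm_sq_eq_perp hl z
  exact abs_le_of_sq_le_sq' (by nlinarith [sq_nonneg (inner ℝ l z : ℝ)]) (norm_nonneg _) |>.2

lemma norm_le_abs_add_perp (hl : ‖l‖ = 1) (z : E n) : ‖z‖ ≤ |inner ℝ l z| + ‖perp l z‖ := by
  conv_lhs => rw [eq_add_perp l z]
  refine (norm_add_le _ _).trans ?_
  rw [norm_smul, hl, mul_one, Real.norm_eq_abs]

lemma continuous_foldGauge (l : E n) : Continuous (foldGauge l) := by
  unfold foldGauge; fun_prop

lemma foldGauge_le_norm (hl : ‖l‖ = 1) (z : E n) : foldGauge l z ≤ ‖z‖ :=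
  max_le (abs_inner_le_norm' hl z) (norm_perp_le hl z)

lemma norm_le_foldGauge (hl : ‖l‖ = 1) (z : E n) : ‖z‖ ≤ 2 * foldGauge l z := by
  have h1 : |inner ℝ l z| ≤ foldGauge l z := le_max_left _ _
  have h2 : ‖perp l z‖ ≤ foldGauge l z := le_max_right _ _
  linarith [norm_le_abs_add_perp hl z]

lemma isCompact_foldGauge (hl : ‖l‖ = 1) (ξ : E n) (ρ : ℝ) :
    IsCompact {x | foldGauge l (x - ξ) ≤ ρ} := by
  refine (isCompact_closedBall ξ (2 * ρ)).of_isClosed_subset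
    (isClosed_le ((continuous_foldGauge l).comp (continuous_id.sub continuous_const))
      continuous_const) (fun x hx => ?_)
  rw [mem_closedBall_iff_norm]
  have h : foldGauge l (x - ξ) ≤ ρ := hx
  linarith [norm_le_foldGauge hl (x - ξ)]

/-- A degenerate critical pair satisfying the transversality conditions can be brought into
normalized form. -/
lemma exists_isFold (h₂ : FiniteDegenerate T f) (hZ : (τ, ξ) ∈ degenerateSet T f)
    (hpsd : HessPosSemidef f τ ξ) {l₀ : E n} (hl₀ : l₀ ≠ 0)
    (hker : LinearMap.ker (hessX f τ ξ : E n →ₗ[ℝ] E n) = Submodule.span ℝ {l₀})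
    (hb : mixedDeriv T f τ ξ l₀ ≠ 0) (hc : thirdDeriv f τ ξ l₀ ≠ 0) :
    ∃ s : ℝ, s ≠ 0 ∧ IsFold T f τ ξ (s • l₀) ∧
      mixedDeriv T f τ ξ (s • l₀) * thirdDeriv f τ ξ (s • l₀) =
        s ^ 4 * (mixedDeriv T f τ ξ l₀ * thirdDeriv f τ ξ l₀) := by
  have hm : ∀ s : ℝ, mixedDeriv T f τ ξ (s • l₀) = s * mixedDeriv T f τ ξ l₀ := fun s => by
    simp [mixedDeriv, inner_smul_right]
  have ht : ∀ s : ℝ, thirdDeriv f τ ξ (s • l₀) = s ^ 3 * thirdDeriv f τ ξ l₀ := fun s => by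
    unfold thirdDeriv
    have := (iteratedFDeriv ℝ 3 (f τ) ξ).map_smul_univ (fun _ => s) (fun _ => l₀)
    simpa using this
  have hτ : τ ∈ Ioo 0 T := by
    refine ⟨hZ.1.1.lt_of_ne fun h => h₂.2.2.1 ⟨_, hZ, h.symm⟩, hZ.1.2.lt_of_ne fun h =>
      h₂.2.2.2 ⟨_, hZ, h⟩⟩
  have hn : 0 < ‖l₀‖ := norm_pos_iff.2 hl₀
  -- The third derivative is odd in s, so a choice of sign makes it negative; the product with the
  -- mixed derivative scales by s⁴ and keeps its sign.
  have main : ∀ s : ℝ, |s| = ‖l₀‖⁻¹ → s * thirdDeriv f τ ξ l₀ < 0 →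
      s ≠ 0 ∧ IsFold T f τ ξ (s • l₀) ∧
      mixedDeriv T f τ ξ (s • l₀) * thirdDeriv f τ ξ (s • l₀) =
        s ^ 4 * (mixedDeriv T f τ ξ l₀ * thirdDeriv f τ ξ l₀) := by
    intro s hs hneg
    have hs0 : s ≠ 0 := by
      rintro rfl; simp at hneg
    refine ⟨hs0, ⟨hτ, hZ.2.1, hpsd, ?_, ?_, ?_, ?_⟩, by rw [hm, ht]; ring⟩
    · rw [norm_smul, Real.norm_eq_abs, hs, inv_mul_cancel₀ hn.ne']
    · rw [hker, Submodule.span_singleton_smul_eq (IsUnit.mk0 s hs0)]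
    · rw [hm]; exact mul_ne_zero hs0 hb
    · rw [ht]
      have : 0 < s ^ 2 := by positivity
      nlinarith
  rcases hc.lt_or_gt with h | h
  · exact ⟨‖l₀‖⁻¹, main _ (abs_of_pos (by positivity)) (mul_neg_of_pos_of_neg (by positivity) h)⟩
  · exact ⟨-‖l₀‖⁻¹, main _ (by rw [abs_neg, abs_of_pos (by positivity)])
      (mul_neg_of_neg_of_pos (by simpa using hn) h)⟩

set_option maxSynthPendingDepth 3 in
/-- Second-order expansion of a directional derivative whose differential vanishes at `ξ`. -/
lemma exists_directional_expansion {V : Type*} [NormedAddCommGroup V] [NormedSpace ℝ V] {h : V → ℝ}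
    (hh : ContDiff ℝ 3 h) (ξ : V) {l : V} (hl : ‖l‖ = 1)
    (hD2 : ∀ z, fderiv ℝ (fderiv ℝ h) ξ z l = 0) :
    ∃ C ≥ 0, (∀ u v, |fderiv ℝ (fderiv ℝ (fderiv ℝ h)) ξ u v l| ≤ C * ‖u‖ * ‖v‖) ∧
      ∀ θ > 0, ∃ r > 0, ∀ z : V, ‖z‖ ≤ r →
        |fderiv ℝ h (ξ + z) l - fderiv ℝ h ξ l - fderiv ℝ (fderiv ℝ (fderiv ℝ h)) ξ z z l / 2| ≤
          θ * ‖z‖ ^ 2 := by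
  set D2 := fderiv ℝ (fderiv ℝ h)
  set D3 := fderiv ℝ D2 ξ
  refine ⟨‖D3‖, norm_nonneg _, fun u v => ?_, fun θ hθ => ?_⟩
  · have h1 := ContinuousLinearMap.le_opNorm₂ (D3 u) v l
    have h2 := D3.le_opNorm u
    rw [hl, mul_one] at h1
    exact h1.trans (by gcongr)
  have hC2 : ContDiff ℝ 2 (fderiv ℝ h) := hh.fderiv_right (by norm_num)
  have hC1 : ContDiff ℝ 1 D2 := hC2.fderiv_right (by norm_num)
  have hD3 : HasFDerivAt D2 D3 ξ := (hC1.differentiable (by norm_num) ξ).hasFDerivAt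
  rw [hasFDerivAt_iff_isLittleO_nhds_zero] at hD3
  have hev := hD3.def hθ
  obtain ⟨r, hr, hball⟩ := Metric.eventually_nhds_iff.1 hev
  refine ⟨r / 2, half_pos hr, fun z hz => ?_⟩
  -- Compare the directional derivative with its quadratic model along the segment. Since D²h(ξ)(·,
  -- l) = 0, the derivative of the difference is the remainder in the differentiability of D²h at ξ.
  have hder : ∀ s ∈ Icc (0 : ℝ) 1, HasDerivWithinAt
      (fun s : ℝ => fderiv ℝ h (ξ + s • z) l - s ^ 2 * (D3 z z l / 2))
      (D2 (ξ + s • z) z l - s * D3 z z l) (Icc 0 1) s := by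
    intro s _
    have e1 : HasDerivAt (fun s : ℝ => ξ + s • z) z s := by
      simpa using ((hasDerivAt_id s).smul_const z).const_add ξ
    have e2 := (hasFDerivAt_clm_apply_const
      (hC2.differentiable (by norm_num) (ξ + s • z)).hasFDerivAt l).comp_hasDerivAt s e1
    have e3 : HasDerivAt (fun s : ℝ => s ^ 2 * (D3 z z l / 2)) (s * D3 z z l) s := by
      refine ((hasDerivAt_pow 2 s).mul_const _).congr_deriv ?_
      norm_num; ring
    exact (e2.sub e3).hasDerivWithinAt
  have hb : ∀ s ∈ Ico (0 : ℝ) 1, ‖D2 (ξ + s • z) z l - s * D3 z z l‖ ≤ θ * ‖z‖ ^ 2 := by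
    intro s hs
    have hsz : ‖s • z‖ ≤ ‖z‖ := by
      rw [norm_smul, Real.norm_eq_abs, abs_of_nonneg hs.1]
      exact mul_le_of_le_one_left (norm_nonneg _) hs.2.le
    have h3 := hball (y := s • z) (by rw [dist_zero_right]; linarith)
    have e : D2 (ξ + s • z) z l - s * D3 z z l = (D2 (ξ + s • z) - D2 ξ - D3 (s • z)) z l := by
      simp [hD2]
    rw [e]
    calc _ ≤ ‖D2 (ξ + s • z) - D2 ξ - D3 (s • z)‖ * ‖z‖ * ‖l‖ :=
          ContinuousLinearMap.le_opNorm₂ _ _ _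
      _ ≤ (θ * ‖z‖) * ‖z‖ * 1 := by
          rw [hl]; gcongr; exact h3.trans (by gcongr)
      _ = _ := by ring
  have := norm_image_sub_le_of_norm_deriv_le_segment_01' hder hb
  simp only [one_smul, one_pow, one_mul, zero_smul, add_zero, ne_eq, OfNat.ofNat_ne_zero,
    not_false_eq_true, zero_pow, zero_mul, sub_zero] at this
  rw [Real.norm_eq_abs] at this
  refine le_trans (le_of_eq ?_) this
  congr 1; ring

namespace IsFold

lemma mem_Icc (hF : IsFold T f τ ξ l) : τ ∈ Icc 0 T := Ioo_subset_Icc_self hF.mem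

lemma hess_l (hF : IsFold T f τ ξ l) : hessX f τ ξ l = 0 := by
  have : l ∈ LinearMap.ker (hessX f τ ξ : E n →ₗ[ℝ] E n) := by
    rw [hF.ker]; exact Submodule.mem_span_singleton_self l
  exact this

lemma inner_hess (hT : 0 < T) (h₁ : RegularCoercive T f) (hF : IsFold T f τ ξ l) (z : E n) :
    inner ℝ l (hessX f τ ξ z) = 0 := by
  rw [← hessX_symm hT h₁ hF.mem_Icc ξ l z, hF.hess_l, inner_zero_left]

lemma hess_perp (hF : IsFold T f τ ξ l) (z : E n) : hessX f τ ξ (perp l z) = hessX f τ ξ z := by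
  rw [perp_apply, map_sub, map_smul, hF.hess_l, smul_zero, sub_zero]

/-- A vector orthogonal to l on which the form vanishes is in the kernel, the line of l, hence zero;
compactness makes positivity uniform. -/
lemma exists_perp_bound (hT : 0 < T) (h₁ : RegularCoercive T f) (hF : IsFold T f τ ξ l) :
    ∃ μ > 0, ∀ z : E n, μ * ‖perp l z‖ ^ 2 ≤ inner ℝ (hessX f τ ξ z) (perp l z) := by
  obtain ⟨μ, hμ, h⟩ := exists_pos_lower_bound (hessX f τ ξ) (ℝ ∙ l)ᗮ (by
    intro z hz hne
    refine (hF.psd z).lt_of_ne fun h0 => hne ?_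
    have h1 : z ∈ LinearMap.ker (hessX f τ ξ : E n →ₗ[ℝ] E n) :=
      hF.psd.apply_eq_zero hT h₁ hF.mem_Icc h0.symm
    rw [hF.ker] at h1
    have h2 := Submodule.inner_right_of_mem_orthogonal h1 hz
    simpa using h2)
  refine ⟨μ, hμ, fun z => ?_⟩
  have := h (perp l z) (Submodule.mem_orthogonal_singleton_iff_inner_right.2
    (inner_perp hF.norm_eq z))
  rwa [hF.hess_perp] at this

/-- Second-order expansion of the component of the gradient along the kernel. -/
lemma exists_inner_gradX_expansion (hT : 0 < T) (h₁ : RegularCoercive T f)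
    (hF : IsFold T f τ ξ l) :
    ∃ C ≥ 0, ∀ θ > 0, ∃ r > 0, ∀ z : E n, ‖z‖ ≤ r →
      |inner ℝ l (gradX f τ (ξ + z)) - thirdDeriv f τ ξ l / 2 * (inner ℝ l z) ^ 2| ≤
        θ * ‖z‖ ^ 2 + C * (|inner ℝ l z| * ‖perp l z‖ + ‖perp l z‖ ^ 2) := by
  have hl := hF.norm_eq
  obtain ⟨C, hC, hop, hexp'⟩ := exists_directional_expansion (contDiff_space h₁ hF.mem_Icc) ξ hl
    (fun z => by
      rw [← inner_hessX_eq hT h₁ hF.mem_Icc, real_inner_comm]; exact hF.inner_hess hT h₁ z)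
  refine ⟨C, hC, fun θ hθ => ?_⟩
  obtain ⟨r, hr, hball⟩ := hexp' θ hθ
  refine ⟨r, hr, fun z hz => ?_⟩
  have hquad := hball z hz
  rw [← inner_gradX_eq, ← inner_gradX_eq, hF.crit, inner_zero_left, sub_zero,
    real_inner_comm] at hquad
  have hthird := thirdDeriv_eq f τ ξ l
  set D3 := fderiv ℝ (fderiv ℝ (fderiv ℝ (f τ))) ξ
  -- Splitting z along l and transversally, all terms but the pure l-term carry a factor of the
  -- transverse part.
  have hexp : D3 z z l = thirdDeriv f τ ξ l * (inner ℝ l z) ^ 2 +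
      ((inner ℝ l z) * D3 l (perp l z) l + (inner ℝ l z) * D3 (perp l z) l l
        + D3 (perp l z) (perp l z) l) := by
    rw [hthird]
    conv_lhs => rw [eq_add_perp l z]
    simp only [map_add, map_smul, add_apply, smul_apply,
      smul_eq_mul]
    ring
  have ha := hop l (perp l z)
  have hb := hop (perp l z) l
  have hc := hop (perp l z) (perp l z)
  rw [hl] at ha hb
  set a := (inner ℝ l z : ℝ)
  set y := ‖perp l z‖
  have hrest : |a * D3 l (perp l z) l + a * D3 (perp l z) l l + D3 (perp l z) (perp l z) l| ≤
      2 * (C * (|a| * y + y ^ 2)) := by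
    refine (abs_add_three _ _ _).trans ?_
    rw [abs_mul, abs_mul]
    have h1 : |a| * |D3 l (perp l z) l| ≤ |a| * (C * 1 * y) := by gcongr
    have h2 : |a| * |D3 (perp l z) l l| ≤ |a| * (C * y * 1) := by gcongr
    have h3 : 0 ≤ C * y * y := by positivity
    nlinarith
  have e : inner ℝ l (gradX f τ (ξ + z)) - thirdDeriv f τ ξ l / 2 * a ^ 2 =
      (inner ℝ l (gradX f τ (ξ + z)) - D3 z z l / 2) +
      (a * D3 l (perp l z) l + a * D3 (perp l z) l l + D3 (perp l z) (perp l z) l) / 2 := by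
    rw [hexp]; ring
  rw [e]
  refine (abs_add_le _ _).trans ?_
  rw [abs_div, abs_two]
  linarith

end IsFold

lemma abs_add_of_mul_nonneg {x y : ℝ} (h : 0 ≤ x * y) : |x + y| = |x| + |y| :=
  (abs_add_eq_add_abs_iff x y).2 (mul_nonneg_iff.1 h)

/-- Scalar estimate behind the isolation of fold points. -/
lemma exists_scalar_fold_constants {μ G C b c : ℝ} (hμ : 0 < μ) (hG : 0 ≤ G) (hC : 0 ≤ C)
    (hb : b ≠ 0) (hc : c ≠ 0) :
    ∃ θ > 0, ∃ r > 0, ∀ h a y : ℝ, 0 ≤ y → |h| ≤ r → |a| ≤ r → 0 ≤ h * (b * c) →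
      μ * y ≤ G * |h| + θ * (|h| + (|a| + y)) →
      |b * h + c / 2 * a ^ 2| ≤ θ * |h| + θ * (a ^ 2 + y ^ 2) + C * (|a| * y + y ^ 2) →
      h = 0 ∧ a = 0 ∧ y = 0 := by
  -- β bounds the leading coefficients from below; θ and r are chosen so that the error terms
  -- consume only a fixed fraction of it.
  set β := min |b| (|c| / 2)
  have hβ : 0 < β := lt_min (abs_pos.2 hb) (by positivity)
  set A := 2 * (G + 1) / μ
  have hA : 0 < A := by positivity
  set θ := min (min (μ / 2) 1) (min (β / 4) (μ * β / (16 * (1 + C))))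
  have hθ : 0 < θ := by positivity
  have hθ1 : θ ≤ μ / 2 := (min_le_left _ _).trans (min_le_left _ _)
  have hθ2 : θ ≤ 1 := (min_le_left _ _).trans (min_le_right _ _)
  have hθ3 : θ ≤ β / 4 := (min_le_right _ _).trans (min_le_left _ _)
  have hθ4 : θ ≤ μ * β / (16 * (1 + C)) := (min_le_right _ _).trans (min_le_right _ _)
  set q := 2 * θ / μ
  have hq0 : 0 < q := by positivity
  have hq1 : q ≤ 1 := by
    rw [div_le_one hμ]; linarith
  have hq2 : (1 + C) * q ≤ β / 8 := by
    have e : (1 + C) * (2 * (μ * β / (16 * (1 + C))) / μ) = β / 8 := by field_simp; ring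
    rw [← e]
    refine mul_le_mul_of_nonneg_left ?_ (by positivity)
    exact div_le_div_of_nonneg_right (by linarith) hμ.le
  set r := β / (4 * (1 + C) * (2 * A ^ 2 + A))
  have hr : 0 < r := by positivity
  have hr' : (1 + C) * (2 * A ^ 2 + A) * r = β / 4 := by
    simp only [r]; field_simp
  refine ⟨θ, hθ, r, hr, fun h a y hy hh ha hsign h1 h2 => ?_⟩
  -- The transverse inequality eliminates y: the errors |a| y and y² become small multiples of |h|
  -- and a².
  have hy1 : y ≤ A * |h| + q * |a| := by
    have h3 : μ / 2 * y ≤ (G + 1) * |h| + θ * |a| := by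
      have := abs_nonneg h
      have := abs_nonneg a
      nlinarith
    have e : A * |h| + q * |a| = 2 / μ * ((G + 1) * |h| + θ * |a|) := by
      simp only [A, q]; field_simp
    rw [e]
    calc y = 2 / μ * (μ / 2 * y) := by field_simp
      _ ≤ _ := by gcongr
  have hh0 := abs_nonneg h
  have ha0 := abs_nonneg a
  have hasq : |a| ^ 2 = a ^ 2 := sq_abs a
  have hay : |a| * y ≤ A * r * |h| + q * a ^ 2 := by
    calc |a| * y ≤ |a| * (A * |h| + q * |a|) := by gcongr
      _ = A * |a| * |h| + q * |a| ^ 2 := by ring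
      _ ≤ A * r * |h| + q * |a| ^ 2 := by gcongr
      _ = _ := by rw [hasq]
  have hyy : y ^ 2 ≤ 2 * A ^ 2 * r * |h| + 2 * q * a ^ 2 := by
    calc y ^ 2 ≤ (A * |h| + q * |a|) ^ 2 := by gcongr
      _ ≤ 2 * (A * |h|) ^ 2 + 2 * (q * |a|) ^ 2 := by nlinarith [sq_nonneg (A * |h| - q * |a|)]
      _ = 2 * A ^ 2 * |h| * |h| + 2 * (q * q) * |a| ^ 2 := by ring
      _ ≤ 2 * A ^ 2 * r * |h| + 2 * (q * 1) * |a| ^ 2 := by gcongr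
      _ = _ := by rw [hasq]; ring
  -- The sign condition forbids cancellation between the two leading terms; this is where
  -- one-sidedness in time enters.
  have hlow : β * |h| + β * a ^ 2 ≤ |b * h + c / 2 * a ^ 2| := by
    rw [abs_add_of_mul_nonneg (by nlinarith [mul_nonneg hsign (sq_nonneg a)]), abs_mul, abs_mul,
      abs_div, abs_two, abs_of_nonneg (sq_nonneg a)]
    gcongr
    · exact min_le_left _ _
    · exact min_le_right _ _
  have hup : |b * h + c / 2 * a ^ 2| ≤ (β / 4 + β / 4) * |h| + (β / 4 + 3 * (β / 8)) * a ^ 2 := by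
    refine h2.trans ?_
    calc θ * |h| + θ * (a ^ 2 + y ^ 2) + C * (|a| * y + y ^ 2)
        = θ * |h| + θ * a ^ 2 + (θ + C) * y ^ 2 + C * (|a| * y) := by ring
      _ ≤ β / 4 * |h| + β / 4 * a ^ 2 + (1 + C) * (2 * A ^ 2 * r * |h| + 2 * q * a ^ 2)
          + (1 + C) * (A * r * |h| + q * a ^ 2) := by
        gcongr
        linarith
      _ = (β / 4 + (1 + C) * (2 * A ^ 2 + A) * r) * |h|
          + (β / 4 + 3 * ((1 + C) * q)) * a ^ 2 := by ring
      _ ≤ _ := by rw [hr']; gcongr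
  have hfin : β / 2 * |h| + 3 / 8 * β * a ^ 2 ≤ 0 := by linarith
  have hz1 : 0 ≤ β / 2 * |h| := by positivity
  have hz2 : 0 ≤ 3 / 8 * β * a ^ 2 := by positivity
  have hh' : |h| = 0 := by
    have : β / 2 * |h| = 0 := by linarith
    rcases mul_eq_zero.1 this with h' | h'
    · linarith
    · exact h'
  have ha' : a = 0 := by
    have : 3 / 8 * β * a ^ 2 = 0 := by linarith
    rcases mul_eq_zero.1 this with h' | h'
    · linarith
    · exact pow_eq_zero_iff (by norm_num) |>.1 h'
  refine ⟨abs_eq_zero.1 hh', ha', ?_⟩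
  rw [hh', ha', abs_zero, mul_zero, mul_zero, add_zero] at hy1
  linarith

namespace IsFold

/-- A fold point is isolated among the critical points on one side in time. -/
lemma isolated (hT : 0 < T) (h₁ : RegularCoercive T f) (hF : IsFold T f τ ξ l) :
    ∃ r > 0, ∀ t x, |t - τ| ≤ r → ‖x - ξ‖ ≤ r →
      0 ≤ (t - τ) * (mixedDeriv T f τ ξ l * thirdDeriv f τ ξ l) → gradX f t x = 0 →
      t = τ ∧ x = ξ := by
  have hl := hF.norm_eq
  obtain ⟨μ, hμ, hperp⟩ := hF.exists_perp_bound hT h₁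
  obtain ⟨C, hC, hexp⟩ := hF.exists_inner_gradX_expansion hT h₁
  set L := gradDeriv T f (τ, ξ)
  obtain ⟨θ, hθ, r₀, hr₀, hcore⟩ := exists_scalar_fold_constants hμ (norm_nonneg (L (1, 0))) hC
    hF.mixed_ne hF.third_neg.ne
  obtain ⟨r₁, hr₁, hexp⟩ := hexp θ hθ
  have hs := (hasStrictFDerivAt_gradFun hT h₁ hF.mem ξ).isLittleO.def hθ
  obtain ⟨r₂, hr₂, hs⟩ := Metric.eventually_nhds_iff.1 hs
  refine ⟨min (min r₀ r₁) (r₂ / 2), by positivity, fun t x ht hx hsign hcrit => ?_⟩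
  have ht0 : |t - τ| ≤ r₀ := ht.trans ((min_le_left _ _).trans (min_le_left _ _))
  have ht2 : |t - τ| < r₂ := (ht.trans (min_le_right _ _)).trans_lt (by linarith)
  have hx0 : ‖x - ξ‖ ≤ r₀ := hx.trans ((min_le_left _ _).trans (min_le_left _ _))
  have hx1 : ‖x - ξ‖ ≤ r₁ := hx.trans ((min_le_left _ _).trans (min_le_right _ _))
  have hx2 : ‖x - ξ‖ < r₂ := (hx.trans (min_le_right _ _)).trans_lt (by linarith)
  set z := x - ξ
  set h := t - τ
  have hxz : x = ξ + z := by simp [z]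
  have hLh : L (h, 0) = h • L (1, 0) := by rw [← map_smul]; simp
  have hLz : L (0, z) = hessX f τ ξ z := by rw [hessX_eq hT h₁ hF.mem_Icc]; simp [L]
  -- Moving only the time gives an error o(|t - τ|) without any x - ξ. This matters along l, where
  -- the gradient at time τ is only quadratic in x - ξ. Moving both variables suffices for the
  -- transverse part.
  have e1 := hs (y := ((t, x), (τ, x))) (by
    rw [Prod.dist_eq, Prod.dist_eq, Prod.dist_eq]
    simp only [max_lt_iff, dist_self, Real.dist_eq]
    rw [dist_eq_norm]
    exact ⟨⟨ht2, hx2⟩, hr₂, hx2⟩)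
  have e2 := hs (y := ((t, x), (τ, ξ))) (by
    rw [Prod.dist_eq, Prod.dist_eq, Prod.dist_eq]
    simp only [max_lt_iff, dist_self, Real.dist_eq]
    rw [dist_eq_norm]
    exact ⟨⟨ht2, hx2⟩, hr₂, hr₂⟩)
  have d1 : ((t, x) - (τ, x) : ℝ × E n) = (h, 0) := by simp [h]
  have d2 : ((t, x) - (τ, ξ) : ℝ × E n) = (h, 0) + (0, z) := by simp [h, z]
  simp only [gradFun, hcrit, hF.crit] at e1 e2
  rw [d1, hLh, zero_sub] at e1
  rw [d2, map_add, hLh, hLz, sub_zero, zero_sub] at e2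
  have n1 : ‖((h, 0) : ℝ × E n)‖ = |h| := by simp [Prod.norm_def]
  have n2 : ‖((h, 0) + (0, z) : ℝ × E n)‖ ≤ |h| + ‖z‖ := by
    refine (norm_add_le _ _).trans ?_
    simp [Prod.norm_def]
  rw [n1] at e1
  have hyp1 : μ * ‖perp l z‖ ≤ ‖L (1, 0)‖ * |h| + θ * (|h| + (|inner ℝ l z| + ‖perp l z‖)) := by
    have k1 : ‖hessX f τ ξ z‖ ≤ ‖L (1, 0)‖ * |h| + θ * (|h| + (|inner ℝ l z| + ‖perp l z‖)) := by
      have k2 : hessX f τ ξ z = -(-(h • L (1, 0) + hessX f τ ξ z)) - h • L (1, 0) := by abel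
      rw [k2]
      refine (norm_sub_le _ _).trans ?_
      rw [norm_neg, norm_smul, Real.norm_eq_abs, add_comm, mul_comm]
      gcongr
      refine e2.trans ?_
      gcongr
      exact n2.trans (by gcongr; exact norm_le_abs_add_perp hl z)
    rcases eq_or_lt_of_le (norm_nonneg (perp l z)) with h0 | h0
    · rw [← h0, mul_zero]; rw [← h0] at k1; exact (norm_nonneg _).trans k1
    · refine le_trans ?_ k1
      have k3 := (hperp z).trans (real_inner_le_norm _ _)
      rw [sq, ← mul_assoc] at k3
      exact le_of_mul_le_mul_right k3 h0
  have hyp2 : |mixedDeriv T f τ ξ l * h + thirdDeriv f τ ξ l / 2 * (inner ℝ l z) ^ 2| ≤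
      θ * |h| + θ * ((inner ℝ l z) ^ 2 + ‖perp l z‖ ^ 2)
        + C * (|inner ℝ l z| * ‖perp l z‖ + ‖perp l z‖ ^ 2) := by
    have k1 := hexp z hx1
    rw [← hxz, norm_sq_eq_perp hl] at k1
    have k2 : |inner ℝ l (-gradX f τ x - h • L (1, 0))| ≤ θ * |h| :=
      (abs_inner_le_norm' hl _).trans e1
    rw [mixedDeriv_eq hT h₁ hF.mem]
    have k3 : inner ℝ (L (1, 0)) l * h + thirdDeriv f τ ξ l / 2 * (inner ℝ l z) ^ 2
        = -(inner ℝ l (-gradX f τ x - h • L (1, 0)) +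
          (inner ℝ l (gradX f τ x) - thirdDeriv f τ ξ l / 2 * (inner ℝ l z) ^ 2)) := by
      rw [inner_sub_right l (-gradX f τ x), inner_neg_right, inner_smul_right, real_inner_comm l]
      ring
    change |inner ℝ (L (1, 0)) l * h + _| ≤ _
    rw [k3, abs_neg]
    refine (abs_add_le _ _).trans ?_
    linarith
  obtain ⟨r1, r2, r3⟩ := hcore h (inner ℝ l z) ‖perp l z‖ (norm_nonneg _) ht0
    ((abs_inner_le_norm' hl z).trans hx0) hsign hyp1 hyp2
  refine ⟨sub_eq_zero.1 r1, sub_eq_zero.1 (norm_le_zero_iff.1 ?_)⟩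
  refine (norm_le_abs_add_perp hl z).trans ?_
  rw [r2, r3]; simp

/-- The differences of trajectories emanating from a fold point lie in a thin cone around the
kernel direction. -/
lemma cone (hT : 0 < T) (h₁ : RegularCoercive T f) (hF : IsFold T f τ ξ l) {κ : ℝ} (hκ : 0 < κ)
    (hκ1 : κ ≤ 1) :
    ∃ r > 0, ∀ w₁ w₂ : ℝ → E n, (∀ s ≤ 0, HasDerivAt w₁ (-gradX f τ (w₁ s)) s) →
      (∀ s ≤ 0, HasDerivAt w₂ (-gradX f τ (w₂ s)) s) →
      (∀ s ≤ 0, ‖w₁ s - ξ‖ ≤ r) → (∀ s ≤ 0, ‖w₂ s - ξ‖ ≤ r) →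
      Tendsto w₁ atBot (𝓝 ξ) → Tendsto w₂ atBot (𝓝 ξ) →
      ∀ s ≤ 0, ‖perp l (w₁ s - w₂ s)‖ ≤ κ * |inner ℝ l (w₁ s - w₂ s)| := by
  have hl := hF.norm_eq
  obtain ⟨μ, hμ, hperp⟩ := hF.exists_perp_bound hT h₁
  -- Outside the cone κ²‖d‖² ≤ 2‖perp l d‖², so the linearization error δ‖d‖² is at most (μ/4)‖perp
  -- l d‖², below the transverse contraction.
  set δ := μ * κ ^ 2 / 8
  have hδ : 0 < δ := by positivity
  obtain ⟨r, hr, hlin⟩ := exists_gradX_approx_linear hT h₁ hF.mem_Icc ξ hδ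
  refine ⟨r, hr, fun w₁ w₂ hw₁ hw₂ hb₁ hb₂ hl₁ hl₂ s₁ hs₁ => ?_⟩
  set d : ℝ → E n := fun s => w₁ s - w₂ s
  set d' : ℝ → E n := fun s => -gradX f τ (w₁ s) - -gradX f τ (w₂ s)
  have hd : ∀ s ≤ 0, HasDerivAt d (d' s) s := fun s hs => (hw₁ s hs).sub (hw₂ s hs)
  -- V is positive exactly outside the cone, and there it strictly decreases in time. A positive
  -- value would persist backward in time, contradicting V → 0 at -∞.
  set V : ℝ → ℝ := fun s => ‖perp l (d s)‖ ^ 2 - κ ^ 2 * (inner ℝ l (d s)) ^ 2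
  set V' : ℝ → ℝ := fun s => 2 * inner ℝ (perp l (d s)) (perp l (d' s))
    - κ ^ 2 * (2 * inner ℝ l (d s) * inner ℝ l (d' s))
  have hV : ∀ s ≤ 0, HasDerivAt V (V' s) s := by
    intro s hs
    have k1 : HasDerivAt (fun s => perp l (d s)) (perp l (d' s)) s :=
      (perp l).hasFDerivAt.comp_hasDerivAt s (hd s hs)
    have k2 : HasDerivAt (fun s => (inner ℝ l (d s) : ℝ)) (inner ℝ l (d' s)) s :=
      (innerSL ℝ l).hasFDerivAt.comp_hasDerivAt s (hd s hs)
    refine (k1.norm_sq.sub ((k2.pow 2).const_mul (κ ^ 2))).congr_deriv ?_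
    simp [V']
  have hV' : ∀ s ≤ 0, 0 < V s → V' s < 0 := by
    intro s hs hpos
    have k := hlin τ hF.mem_Icc (by simpa using hr.le) (w₁ s) (by
      rw [mem_closedBall_iff_norm]; exact hb₁ s hs) (w₂ s) (by
      rw [mem_closedBall_iff_norm]; exact hb₂ s hs)
    set e := gradX f τ (w₁ s) - gradX f τ (w₂ s) - hessX f τ ξ (w₁ s - w₂ s)
    have hd'e : d' s = -(hessX f τ ξ (d s)) - e := by simp only [d', d, e]; abel
    change ‖e‖ ≤ δ * ‖d s‖ at k
    have p1 : inner ℝ l (d' s) = -inner ℝ l e := by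
      rw [hd'e, inner_sub_right, inner_neg_right, hF.inner_hess hT h₁]; ring
    have p2 : perp l (d' s) = -(hessX f τ ξ (d s)) - perp l e := by
      rw [hd'e, map_sub, map_neg, perp_apply l (hessX f τ ξ (d s)), hF.inner_hess hT h₁]
      simp
    have p3 : V' s = -2 * inner ℝ (hessX f τ ξ (d s)) (perp l (d s))
        - 2 * inner ℝ (perp l (d s)) (perp l e)
        + 2 * κ ^ 2 * (inner ℝ l (d s) * inner ℝ l e) := by
      simp only [V']
      rw [p1, p2, inner_sub_right, inner_neg_right, real_inner_comm (hessX f τ ξ (d s))]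
      ring
    have q1 := hperp (d s)
    have q2 : |inner ℝ (perp l (d s)) (perp l e)| ≤ δ * ‖d s‖ ^ 2 := by
      refine (abs_real_inner_le_norm _ _).trans ?_
      calc _ ≤ ‖d s‖ * (δ * ‖d s‖) := by
            gcongr
            · exact norm_perp_le hl _
            · exact (norm_perp_le hl _).trans k
        _ = _ := by ring
    have q3 : |inner ℝ l (d s) * inner ℝ l e| ≤ δ * ‖d s‖ ^ 2 := by
      rw [abs_mul]
      calc _ ≤ ‖d s‖ * (δ * ‖d s‖) := by
            gcongr
            · exact abs_inner_le_norm' hl _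
            · exact (abs_inner_le_norm' hl _).trans k
        _ = _ := by ring
    have q4 := norm_sq_eq_perp hl (d s)
    have hpos' : κ ^ 2 * (inner ℝ l (d s)) ^ 2 < ‖perp l (d s)‖ ^ 2 := by
      simpa [V] using hpos
    have hκ2 : κ ^ 2 ≤ 1 := pow_le_one₀ hκ.le hκ1
    have q5 : κ ^ 2 * ‖d s‖ ^ 2 ≤ 2 * ‖perp l (d s)‖ ^ 2 := by
      rw [q4, mul_add]
      nlinarith [sq_nonneg ‖perp l (d s)‖]
    have q6 : 0 < ‖perp l (d s)‖ ^ 2 := lt_of_le_of_lt (by positivity) hpos'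
    have q7 : δ * ‖d s‖ ^ 2 ≤ μ / 4 * ‖perp l (d s)‖ ^ 2 := by
      have : δ * ‖d s‖ ^ 2 = μ / 8 * (κ ^ 2 * ‖d s‖ ^ 2) := by simp only [δ]; ring
      rw [this]
      nlinarith
    have q8 : κ ^ 2 * (inner ℝ l (d s) * inner ℝ l e) ≤ δ * ‖d s‖ ^ 2 := by
      refine (le_abs_self _).trans ?_
      rw [abs_mul, abs_of_nonneg (sq_nonneg κ)]
      exact (mul_le_of_le_one_left (abs_nonneg _) hκ2).trans q3
    rw [p3]
    have q9 := (abs_le.1 q2).1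
    nlinarith [mul_pos hμ q6]
  have hVle : V s₁ ≤ 0 := by
    by_contra! hpos
    have hge : ∀ q, 0 ≤ q → V s₁ ≤ V (s₁ - q) := by
      intro q hq
      have := image_le_of_deriv_right_lt_deriv_boundary' (f := fun q => -V (s₁ - q))
        (f' := fun q => V' (s₁ - q)) (a := 0) (b := q) (B := fun _ => -V s₁) (B' := fun _ => 0)
        (fun p hp => by
          have k := (hV (s₁ - p) (by linarith [hp.1])).comp_const_sub s₁ p
          exact (k.neg).continuousAt.continuousWithinAt)
        (fun p hp => by
          have k := (hV (s₁ - p) (by linarith [hp.1])).comp_const_sub s₁ p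
          exact (k.neg.congr_deriv (neg_neg _)).hasDerivWithinAt)
        (by simp) continuousOn_const (fun p _ => hasDerivWithinAt_const _ _ _)
        (fun p hp h => hV' _ (by linarith [hp.1]) (by
          have : V (s₁ - p) = V s₁ := by linarith
          rwa [this])) (x := q) ⟨hq, le_rfl⟩
      simpa using this
    have hlim : Tendsto V atBot (𝓝 0) := by
      have k1 : Tendsto d atBot (𝓝 0) := by simpa using hl₁.sub hl₂
      have k2 : Continuous fun z : E n => ‖perp l z‖ ^ 2 - κ ^ 2 * (inner ℝ l z) ^ 2 := by
        fun_prop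
      have := (k2.tendsto 0).comp k1
      simpa [Function.comp_def] using this
    have : V s₁ ≤ 0 := ge_of_tendsto hlim ((eventually_le_atBot s₁).mono fun s hs => by
      have := hge (s₁ - s) (by linarith)
      simpa using this)
    linarith
  have hfin : ‖perp l (d s₁)‖ ^ 2 ≤ (κ * |inner ℝ l (d s₁)|) ^ 2 := by
    rw [mul_pow, sq_abs]; simpa [V] using hVle
  exact (sq_le_sq₀ (norm_nonneg _) (by positivity)).1 hfin

end IsFold

/-! ### Fold neighbourhoods and the unique outgoing trajectory. -/

/-- `ρ` is a radius within which the local picture around the fold point `(τ,ξ)` is valid. -/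
structure IsFoldRadius (T : ℝ) (f : ℝ → E n → ℝ) (τ : ℝ) (ξ l : E n) (ρ : ℝ) : Prop where
  pos : 0 < ρ
  crit : ∀ x, foldGauge l (x - ξ) ≤ ρ → gradX f τ x = 0 → x = ξ
  later : 0 < mixedDeriv T f τ ξ l * thirdDeriv f τ ξ l →
    ∃ δ > 0, ∀ t, τ < t → t ≤ τ + δ → ∀ x, foldGauge l (x - ξ) ≤ ρ → gradX f t x ≠ 0
  unique : ∀ w₁ w₂ : ℝ → E n, (∀ s ≤ 0, HasDerivAt w₁ (-gradX f τ (w₁ s)) s) →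
    (∀ s ≤ 0, HasDerivAt w₂ (-gradX f τ (w₂ s)) s) →
    (∀ s ≤ 0, foldGauge l (w₁ s - ξ) ≤ ρ) → (∀ s ≤ 0, foldGauge l (w₂ s - ξ) ≤ ρ) →
    Tendsto w₁ atBot (𝓝 ξ) → Tendsto w₂ atBot (𝓝 ξ) →
    foldGauge l (w₁ 0 - ξ) = foldGauge l (w₂ 0 - ξ) → w₁ 0 = w₂ 0
  descent : ∀ s ∈ Ioc 0 ρ, f τ (ξ + s • l) < f τ ξ

lemma IsFoldRadius.mono {ρ ρ' : ℝ} (h : IsFoldRadius T f τ ξ l ρ) (h0 : 0 < ρ') (hle : ρ' ≤ ρ) :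
    IsFoldRadius T f τ ξ l ρ' where
  pos := h0
  crit x hx := h.crit x (hx.trans hle)
  later hs := by
    obtain ⟨δ, hδ, hl⟩ := h.later hs
    exact ⟨δ, hδ, fun t ht ht' x hx => hl t ht ht' x (hx.trans hle)⟩
  unique w₁ w₂ a b c d := h.unique w₁ w₂ a b (fun s hs => (c s hs).trans hle)
    (fun s hs => (d s hs).trans hle)
  descent s hs := h.descent s ⟨hs.1, hs.2.trans hle⟩

namespace IsFold

/-- Inside the cone the l-component of the gradient is at most (c/8)⟨l,z⟩² with c < 0, so emanating
trajectories move towards +l and their gauge equals ⟨l,·⟩. Two of them at the same gauge differ by a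
vector of the cone without l-component, that is, by zero. -/
lemma exists_isFoldRadius (hT : 0 < T) (h₁ : RegularCoercive T f) (hF : IsFold T f τ ξ l) :
    ∃ ρ, IsFoldRadius T f τ ξ l ρ := by
  have hl := hF.norm_eq
  obtain ⟨C, hC, hexp⟩ := hF.exists_inner_gradX_expansion hT h₁
  have hc := hF.third_neg
  set c := thirdDeriv f τ ξ l
  have hc' : 0 < -c := by linarith
  obtain ⟨r₁, hr₁, hexp⟩ := hexp (-c / 8) (by linarith)
  set κ := min (1 / 2) (-c / (8 * (C + 1)))
  have hκ : 0 < κ := by positivity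
  have hκ1 : κ ≤ 1 / 2 := min_le_left _ _
  have hκ2 : C * κ ≤ -c / 8 := by
    have h1 : κ ≤ -c / (8 * (C + 1)) := min_le_right _ _
    calc C * κ ≤ (C + 1) * (-c / (8 * (C + 1))) := by gcongr; linarith
      _ = -c / 8 := by field_simp
  obtain ⟨r₂, hr₂, hcone⟩ := hF.cone hT h₁ hκ (by linarith)
  obtain ⟨r₃, hr₃, hiso⟩ := hF.isolated hT h₁
  set ρ := min r₁ (min r₂ r₃) / 2
  have hρ : 0 < ρ := by positivity
  have hρ1 : 2 * ρ ≤ r₁ := by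
    have : min r₁ (min r₂ r₃) ≤ r₁ := min_le_left _ _
    simp only [ρ]; linarith
  have hρ2 : 2 * ρ ≤ r₂ := by
    have : min r₁ (min r₂ r₃) ≤ r₂ := (min_le_right _ _).trans (min_le_left _ _)
    simp only [ρ]; linarith
  have hρ3 : 2 * ρ ≤ r₃ := by
    have : min r₁ (min r₂ r₃) ≤ r₃ := (min_le_right _ _).trans (min_le_right _ _)
    simp only [ρ]; linarith
  have hnorm : ∀ z : E n, foldGauge l z ≤ ρ → ‖z‖ ≤ 2 * ρ := fun z hz => by
    linarith [norm_le_foldGauge hl z]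
  have hsignφ : ∀ z : E n, ‖z‖ ≤ r₁ → ‖perp l z‖ ≤ κ * |inner ℝ l z| →
      inner ℝ l (gradX f τ (ξ + z)) ≤ c / 8 * (inner ℝ l z) ^ 2 := by
    intro z hz hy
    have k := (abs_le.1 (hexp z hz)).2
    rw [norm_sq_eq_perp hl] at k
    set a := (inner ℝ l z : ℝ)
    set y := ‖perp l z‖
    have hy0 : 0 ≤ y := norm_nonneg _
    have ha0 := abs_nonneg a
    have hasq := sq_abs a
    have k1 : |a| * y ≤ κ * a ^ 2 := by
      calc |a| * y ≤ |a| * (κ * |a|) := by gcongr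
        _ = κ * |a| ^ 2 := by ring
        _ = _ := by rw [hasq]
    have k2 : y ^ 2 ≤ κ * κ * a ^ 2 := by
      calc y ^ 2 ≤ (κ * |a|) ^ 2 := by gcongr
        _ = _ := by rw [mul_pow, hasq]; ring
    have k3 : y ^ 2 ≤ κ / 2 * a ^ 2 := by
      refine k2.trans ?_
      have : κ * κ ≤ κ / 2 := by nlinarith
      gcongr
    have ha2 := sq_nonneg a
    have k5 : C * (|a| * y + y ^ 2) ≤ C * κ * (3 / 2 * a ^ 2) := by
      calc _ ≤ C * (κ * a ^ 2 + κ / 2 * a ^ 2) := by gcongr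
        _ = _ := by ring
    have k6 : C * κ * (3 / 2 * a ^ 2) ≤ -c / 8 * (3 / 2 * a ^ 2) := by gcongr
    have k7 : -c / 8 * (a ^ 2 + y ^ 2) ≤ -c / 8 * (a ^ 2 + 1 / 4 * a ^ 2) := by
      have : y ^ 2 ≤ 1 / 4 * a ^ 2 := by nlinarith
      gcongr
    have k8 : 0 ≤ -c * a ^ 2 := by positivity
    nlinarith
  have hpos : ∀ w : ℝ → E n, (∀ s ≤ 0, HasDerivAt w (-gradX f τ (w s)) s) →
      (∀ s ≤ 0, foldGauge l (w s - ξ) ≤ ρ) → Tendsto w atBot (𝓝 ξ) →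
      inner ℝ l (w 0 - ξ) = foldGauge l (w 0 - ξ) := by
    intro w hw hg hlim
    -- This compares w with the constant trajectory at ξ.
    have hcw : ∀ s ≤ 0, ‖perp l (w s - ξ)‖ ≤ κ * |inner ℝ l (w s - ξ)| :=
      hcone w (fun _ => ξ) hw (fun s _ => by
        rw [hF.crit, neg_zero]; exact hasDerivAt_const s ξ)
        (fun s hs => (hnorm _ (hg s hs)).trans hρ2) (fun s _ => by simp [hr₂.le]) hlim
        tendsto_const_nhds
    have hmono : MonotoneOn (fun s => (inner ℝ l (w s - ξ) : ℝ)) (Iic 0) := by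
      have hda : ∀ s ≤ 0, HasDerivAt (fun s => (inner ℝ l (w s - ξ) : ℝ))
          (-inner ℝ l (gradX f τ (w s))) s := fun s hs => by
        have := (innerSL ℝ l).hasFDerivAt.comp_hasDerivAt s ((hw s hs).sub_const ξ)
        simpa [Function.comp_def] using this
      refine monotoneOn_of_hasDerivWithinAt_nonneg (convex_Iic 0)
        (fun s hs => (hda s hs).continuousAt.continuousWithinAt)
        (fun s hs => (hda s (mem_Iic.1 (interior_subset hs))).hasDerivWithinAt) (fun s hs => ?_)
      have hs0 : s ≤ 0 := mem_Iic.1 (interior_subset hs)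
      have k := hsignφ (w s - ξ) ((hnorm _ (hg s hs0)).trans hρ1) (hcw s hs0)
      rw [add_sub_cancel] at k
      have := sq_nonneg (inner ℝ l (w s - ξ) : ℝ)
      nlinarith
    have hlim0 : Tendsto (fun s => (inner ℝ l (w s - ξ) : ℝ)) atBot (𝓝 0) := by
      have k : Continuous fun x : E n => (inner ℝ l (x - ξ) : ℝ) := by fun_prop
      have := (k.tendsto ξ).comp hlim
      simpa [Function.comp_def] using this
    have h0 : 0 ≤ (inner ℝ l (w 0 - ξ) : ℝ) := by
      refine le_of_tendsto hlim0 ((eventually_le_atBot 0).mono fun s hs => ?_)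
      exact hmono (mem_Iic.2 hs) (mem_Iic.2 le_rfl) hs
    have h2 := hcw 0 le_rfl
    rw [foldGauge, max_eq_left, abs_of_nonneg h0]
    refine h2.trans ?_
    exact mul_le_of_le_one_left (abs_nonneg _) (by linarith)
  refine ⟨ρ, hρ, fun x hx hcx => ?_, fun hs => ?_, ?_, ?_⟩
  · exact (hiso τ x (by simpa using hr₃.le) ((hnorm _ hx).trans hρ3) (by simp) hcx).2
  · refine ⟨r₃, hr₃, fun t ht ht' x hx hcx => ?_⟩
    have := hiso t x (by rw [abs_of_pos (by linarith)]; linarith) ((hnorm _ hx).trans hρ3)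
      (mul_nonneg (by linarith) hs.le) hcx
    exact ht.ne' this.1
  · intro w₁ w₂ hw₁ hw₂ hg₁ hg₂ hl₁ hl₂ heq
    have e1 := hpos w₁ hw₁ hg₁ hl₁
    have e2 := hpos w₂ hw₂ hg₂ hl₂
    have hd := hcone w₁ w₂ hw₁ hw₂ (fun s hs => (hnorm _ (hg₁ s hs)).trans hρ2)
      (fun s hs => (hnorm _ (hg₂ s hs)).trans hρ2) hl₁ hl₂ 0 le_rfl
    have h0 : (inner ℝ l (w₁ 0 - w₂ 0) : ℝ) = 0 := by
      have : w₁ 0 - w₂ 0 = (w₁ 0 - ξ) - (w₂ 0 - ξ) := by abel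
      rw [this, inner_sub_right, e1, e2, heq, sub_self]
    rw [h0, abs_zero, mul_zero] at hd
    have := norm_le_abs_add_perp hl (w₁ 0 - w₂ 0)
    rw [h0, abs_zero, zero_add] at this
    exact sub_eq_zero.1 (norm_le_zero_iff.1 (this.trans hd))
  · have hder : ∀ s : ℝ, HasDerivAt (fun s : ℝ => f τ (ξ + s • l))
        (inner ℝ (gradX f τ (ξ + s • l)) l) s := fun s => by
      have e1 : HasDerivAt (fun s : ℝ => ξ + s • l) l s := by
        simpa using ((hasDerivAt_id s).smul_const l).const_add ξ
      exact (hasFDerivAt_space_inner h₁ hF.mem_Icc (ξ + s • l)).comp_hasDerivAt s e1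
    have hanti : StrictAntiOn (fun s : ℝ => f τ (ξ + s • l)) (Icc 0 ρ) := by
      refine strictAntiOn_of_hasDerivWithinAt_neg (convex_Icc 0 ρ)
        (fun s _ => (hder s).continuousAt.continuousWithinAt)
        (fun s _ => (hder s).hasDerivWithinAt) (fun s hs => ?_)
      rw [interior_Icc] at hs
      have hin : (inner ℝ l (s • l) : ℝ) = s := by
        rw [inner_smul_right, real_inner_self_eq_norm_sq, hl]; ring
      have hp0 : perp l (s • l) = 0 := by rw [perp_apply, hin, sub_self]
      have hn : ‖s • l‖ = s := by
        rw [norm_smul, hl, Real.norm_eq_abs, abs_of_pos hs.1, mul_one]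
      have k := hsignφ (s • l) (by rw [hn]; linarith [hs.2]) (by
        rw [hp0, norm_zero]; positivity)
      rw [hin] at k
      rw [real_inner_comm]
      have : 0 < s ^ 2 := by have := hs.1; positivity
      nlinarith
    intro s hs
    have := hanti ⟨le_rfl, hρ.le⟩ ⟨hs.1.le, hs.2⟩ hs.1
    simpa using this

end IsFold

section FoldFlow

variable {R M ρ : ℝ} {X : E n → E n} {K : NNReal}

lemma norm_le_of_foldGauge_le (hl : ‖l‖ = 1) (hR : ‖ξ‖ + 2 * ρ ≤ R) {x : E n}
    (hx : foldGauge l (x - ξ) ≤ ρ) : ‖x‖ ≤ R := by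
  have h2 := norm_le_foldGauge hl (x - ξ)
  have h3 := norm_le_norm_add_norm_sub ξ x
  rw [norm_sub_rev] at h3
  linarith

/-- The point at which trajectories emanating from a fold point leave the `ρ`-neighbourhood is
unique. -/
lemma IsFoldRadius.exit_unique (hT : 0 < T) (h₁ : RegularCoercive T f) (hF : IsFold T f τ ξ l)
    (hρ : IsFoldRadius T f τ ξ l ρ) (hX : IsTruncation f τ R X K M) (hR : ‖ξ‖ + 2 * ρ ≤ R)
    {w₁ w₂ : ℝ → E n} (hw₁ : IsFlowLine X w₁) (hw₂ : IsFlowLine X w₂)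
    (hg₁ : ∀ s ≤ 0, foldGauge l (w₁ s - ξ) ≤ ρ) (hg₂ : ∀ s ≤ 0, foldGauge l (w₂ s - ξ) ≤ ρ)
    (heq : foldGauge l (w₁ 0 - ξ) = foldGauge l (w₂ 0 - ξ)) : w₁ 0 = w₂ 0 := by
  have hAR : ∀ x ∈ {x | foldGauge l (x - ξ) ≤ ρ}, ‖x‖ ≤ R := fun x hx =>
    norm_le_of_foldGauge_le hF.norm_eq hR hx
  have key : ∀ w : ℝ → E n, IsFlowLine X w → (∀ s ≤ 0, foldGauge l (w s - ξ) ≤ ρ) →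
      Tendsto w atBot (𝓝 ξ) ∧ ∀ s ≤ 0, HasDerivAt w (-gradX f τ (w s)) s := fun w hw hg =>
    ⟨hw.tendsto_atBot hT h₁ hF.mem_Icc hX (isCompact_foldGauge hF.norm_eq ξ ρ) hAR hg hρ.crit,
      fun s hs => by rw [← hX.agree _ (hAR _ (hg s hs))]; exact hw s⟩
  exact hρ.unique w₁ w₂ (key w₁ hw₁ hg₁).2 (key w₂ hw₂ hg₂).2 hg₁ hg₂ (key w₁ hw₁ hg₁).1
    (key w₂ hw₂ hg₂).1 heq

/-- There is a trajectory emanating from a fold point and leaving its neighbourhood. -/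
lemma IsFoldRadius.exists_exit (hT : 0 < T) (h₁ : RegularCoercive T f) (hF : IsFold T f τ ξ l)
    (hρ : IsFoldRadius T f τ ξ l ρ) (hX : IsTruncation f τ R X K M) (hR : ‖ξ‖ + 2 * ρ ≤ R) :
    ∃ w, IsFlowLine X w ∧ foldGauge l (w 0 - ξ) = ρ ∧ ∀ s ≤ 0, foldGauge l (w s - ξ) ≤ ρ := by
  have hl := hF.norm_eq
  have hρ0 := hρ.pos
  have hAR : ∀ x, foldGauge l (x - ξ) ≤ ρ → ‖x‖ ≤ R := fun x hx =>
    norm_le_of_foldGauge_le hl hR hx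
  have hcg : Continuous fun x : E n => foldGauge l (x - ξ) :=
    (continuous_foldGauge l).comp (continuous_id.sub continuous_const)
  -- trajectories starting at `ξ + s l` leave the neighbourhood
  have hexit : ∀ s ∈ Ioo 0 ρ, ∃ w, IsFlowLine X w ∧ w 0 = ξ + s • l ∧ ∃ σ > 0,
      foldGauge l (w σ - ξ) = ρ ∧ ∀ r ∈ Ico 0 σ, foldGauge l (w r - ξ) < ρ := by
    intro s hs
    obtain ⟨w, hw0, hw⟩ := hX.exists_flowLine (ξ + s • l)
    refine ⟨w, hw, hw0, ?_⟩
    have hstart : foldGauge l (w 0 - ξ) < ρ := by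
      refine (foldGauge_le_norm hl _).trans_lt ?_
      rw [hw0, add_sub_cancel_left, norm_smul, hl, Real.norm_eq_abs, abs_of_pos hs.1, mul_one]
      exact hs.2
    -- A trajectory that never left would converge to ξ with nonincreasing energy, although it
    -- starts strictly below f(ξ).
    obtain ⟨b, hb0, hb⟩ : ∃ b, 0 ≤ b ∧ ρ ≤ foldGauge l (w b - ξ) := by
      by_contra! hcon
      have hin : ∀ r, 0 ≤ r → foldGauge l (w r - ξ) ≤ ρ := fun r hr => (hcon r hr).le
      have htop := hw.tendsto_atTop hT h₁ hF.mem_Icc hX (isCompact_foldGauge hl ξ ρ)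
        (fun x hx => hAR x hx) (fun r hr => hin r hr) hρ.crit
      have hanti := hw.energy_antitoneOn h₁ hF.mem_Icc hX (convex_Ici 0)
        (fun r hr => hAR _ (hin r hr))
      have hle : f τ ξ ≤ f τ (w 0) := by
        refine le_of_tendsto (((contDiff_space h₁ hF.mem_Icc).continuous.tendsto ξ).comp htop) ?_
        exact (eventually_ge_atTop 0).mono fun r hr => hanti (mem_Ici.2 le_rfl) (mem_Ici.2 hr) hr
      rw [hw0] at hle
      exact absurd (hρ.descent s ⟨hs.1, hs.2.le⟩) (not_lt.2 hle)
    obtain ⟨σ, hσ, hσ1, hσ2⟩ := exists_first_exit (h := fun r => foldGauge l (w r - ξ)) hb0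
      (hcg.comp hw.continuous).continuousOn hstart hb
    exact ⟨σ, hσ.1, hσ1, hσ2⟩
  have hseq : ∀ j : ℕ, ρ / (j + 2) ∈ Ioo 0 ρ := fun j =>
    ⟨by positivity, div_lt_self hρ0 (by linarith [j.cast_nonneg (α := ℝ)])⟩
  choose w hw hw0 σ hσ hσρ hσlt using fun j : ℕ => hexit _ (hseq j)
  -- the exit times tend to infinity
  have hstart : Tendsto (fun j : ℕ => ‖w j 0 - ξ‖) atTop (𝓝 0) := by
    have : (fun j : ℕ => ‖w j 0 - ξ‖) = fun j : ℕ => ρ / ((j + 2 : ℕ) : ℝ) := by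
      funext j
      rw [hw0, add_sub_cancel_left, norm_smul, hl, Real.norm_eq_abs, abs_of_pos (hseq j).1,
        mul_one]
      push_cast; rfl
    rw [this]
    exact (tendsto_const_div_atTop_nhds_zero_nat ρ).comp (tendsto_add_atTop_nat 2)
  have hconst : IsFlowLine X (fun _ => ξ) := fun s => by
    have : X ξ = 0 := by rw [hX.agree ξ (by linarith), hF.crit, neg_zero]
    rw [this]; exact hasDerivAt_const s ξ
  have hσtop : Tendsto σ atTop atTop := by
    rw [tendsto_atTop]
    intro S
    have hev : ∀ᶠ j in atTop, ‖w j 0 - ξ‖ * Real.exp (K * |S|) < ρ := by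
      have := hstart.mul_const (Real.exp (K * |S|))
      rw [zero_mul] at this
      exact this.eventually (gt_mem_nhds hρ0)
    filter_upwards [hev] with j hj
    by_contra! hcon
    have hmem : σ j ∈ Icc (-|S|) |S| :=
      ⟨by linarith [hσ j, abs_nonneg S], hcon.le.trans (le_abs_self S)⟩
    have h2 := hX.dist_le hconst (hw j) hmem
    have h3 := foldGauge_le_norm hl (w j (σ j) - ξ)
    rw [hσρ j] at h3
    linarith
  -- a cluster point of the exit points
  obtain ⟨q, hq, hcl⟩ := (isCompact_foldGauge hl ξ ρ).exists_mapClusterPt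
    (f := (atTop : Filter ℕ)) (u := fun j => w j (σ j))
    (by
      rw [le_principal_iff, mem_map]
      exact Eventually.of_forall fun j => (hσρ j).le)
  obtain ⟨φ, hφ, hφlim⟩ := hcl.tendsto_subseq
  obtain ⟨z, hz0, hz⟩ := hX.exists_flowLine q
  refine ⟨z, hz, ?_, fun s hs => ?_⟩
  · rw [hz0]
    exact tendsto_nhds_unique ((hcg.tendsto q).comp hφlim)
      (tendsto_const_nhds.congr fun j => (hσρ (φ j)).symm)
  · have hlim : Tendsto (fun j => w (φ j) (σ (φ j) + s)) atTop (𝓝 (z s)) := by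
      rw [tendsto_iff_norm_sub_tendsto_zero]
      have hb : Tendsto (fun j => ‖w (φ j) (σ (φ j)) - q‖ * Real.exp (K * |s|)) atTop (𝓝 0) := by
        have := (tendsto_iff_norm_sub_tendsto_zero.1 hφlim).mul_const (Real.exp (K * |s|))
        simpa using this
      refine squeeze_zero (fun _ => norm_nonneg _) (fun j => ?_) hb
      have := hX.dist_le hz ((hw (φ j)).shift (σ (φ j))) (S := |s|) (s := s)
        ⟨neg_abs_le s, le_abs_self s⟩
      simpa [hz0] using this
    -- As the exit times tend to infinity, a fixed s ≤ 0 eventually corresponds to a time between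
    -- start and exit, so the limit stays in the neighbourhood for all past time.
    refine le_of_tendsto ((hcg.tendsto (z s)).comp hlim) ?_
    have hev := (hσtop.comp hφ.tendsto_atTop).eventually (eventually_ge_atTop (-s))
    filter_upwards [hev] with j hj
    have hj' : -s ≤ σ (φ j) := hj
    rcases hs.eq_or_lt with rfl | hs0
    · simpa using (hσρ (φ j)).le
    · exact (hσlt (φ j) _ ⟨by linarith, by linarith⟩).le

end FoldFlow

/-! ### Connecting orbits from folds to nondegenerate minima. -/

lemma IsFastSolution.contDiff (hT : 0 < T) (h₁ : RegularCoercive T f) (hτ : τ ∈ Icc 0 T)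
    {w : ℝ → E n} (hw : IsFastSolution f τ w) : ContDiff ℝ 2 w := by
  have hg := contDiff_gradX hT h₁ hτ
  have hd : deriv w = fun s => -gradX f τ (w s) := funext fun s => (hw s).deriv
  have hdiff : Differentiable ℝ w := fun s => (hw s).differentiableAt
  have h1 : ContDiff ℝ 1 w := by
    rw [show (1 : WithTop ℕ∞) = 0 + 1 by norm_num, contDiff_succ_iff_deriv]
    refine ⟨hdiff, by simp, ?_⟩
    rw [hd, contDiff_zero]
    exact (hg.continuous.comp hdiff.continuous).neg
  rw [show (2 : WithTop ℕ∞) = 1 + 1 by norm_num, contDiff_succ_iff_deriv]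
  refine ⟨hdiff, by simp, ?_⟩
  rw [hd]
  exact ((hg.of_le (by norm_num)).comp h1).neg

/-- A nondegenerate critical point is isolated. -/
lemma exists_isolated_of_det_ne_zero (hT : 0 < T) (h₁ : RegularCoercive T f) (hτ : τ ∈ Icc 0 T)
    {p : E n} (hdet : (hessX f τ p).det ≠ 0) :
    ∃ r > 0, ∀ x ∈ Metric.closedBall p r, gradX f τ x = 0 → x = p := by
  have hker : LinearMap.ker (hessX f τ p : E n →ₗ[ℝ] E n) = ⊥ := by
    by_contra hne
    exact hdet (LinearMap.det_eq_zero_iff_ker_ne_bot.2 hne)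
  obtain ⟨C, -, hC⟩ := LinearMap.exists_antilipschitzWith (hessX f τ p : E n →ₗ[ℝ] E n) hker
  have := (hasFDerivAt_gradX hT h₁ hτ p).eventually_ne (c := 0) ⟨C, hC⟩
  rw [eventually_nhdsWithin_iff, Metric.eventually_nhds_iff] at this
  obtain ⟨r, hr, h⟩ := this
  refine ⟨r / 2, half_pos hr, fun x hx h0 => ?_⟩
  by_contra hne
  exact h ((Metric.mem_closedBall.1 hx).trans_lt (by linarith)) hne h0

/-- From every fold point there emanates a heteroclinic trajectory to a nondegenerate minimum. -/
lemma exists_heteroclinic (hT : 0 < T) (h₁ : RegularCoercive T f) (h₂ : FiniteDegenerate T f)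
    (h₄ : HeteroclinicToMinimum T f) (hZ : (τ, ξ) ∈ degenerateSet T f)
    (hF : IsFold T f τ ξ l) :
    ∃ (v : ℝ → E n) (y : E n), ContDiff ℝ 2 v ∧ IsFastSolution f τ v ∧ Tendsto v atBot (𝓝 ξ) ∧
      Tendsto v atTop (𝓝 y) ∧ gradX f τ y = 0 ∧ HessPosDef f τ y := by
  have hτ := hF.mem_Icc
  obtain ⟨ρ, hρ⟩ := hF.exists_isFoldRadius hT h₁
  obtain ⟨R₀, hR₀, htrap⟩ := h₁.exists_trapping
  set R := max R₀ (‖ξ‖ + 2 * ρ)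
  have hR : 0 < R := lt_of_lt_of_le hR₀ (le_max_left _ _)
  obtain ⟨X, K, M, hX⟩ := exists_isTruncation hT h₁ hτ hR
  obtain ⟨w, hw, hw0, hwg⟩ := hρ.exists_exit hT h₁ hF hX (le_max_right _ _)
  have hwneg : ∀ s ≤ 0, ‖w s‖ ≤ R := fun s hs =>
    norm_le_of_foldGauge_le hF.norm_eq (le_max_right _ _) (hwg s hs)
  have hwpos : ∀ s, 0 ≤ s → ‖w s‖ ≤ R :=
    hw.norm_le_forward hτ hX hR.le (htrap R (le_max_left _ _)) (hwneg 0 le_rfl)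
  have hwR : ∀ s, ‖w s‖ ≤ R := fun s => (le_total s 0).elim (hwneg s) (hwpos s)
  have hfast := hw.isFastSolution hX hwR
  have hbot : Tendsto w atBot (𝓝 ξ) :=
    hw.tendsto_atBot hT h₁ hτ hX (isCompact_foldGauge hF.norm_eq ξ ρ)
      (fun x hx => norm_le_of_foldGauge_le hF.norm_eq (le_max_right _ _) hx) hwg hρ.crit
  have hw0ξ : w 0 ≠ ξ := by
    intro h
    rw [h, sub_self] at hw0
    have : foldGauge l (0 : E n) = 0 := by simp [foldGauge]
    rw [this] at hw0
    exact hρ.pos.ne hw0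
  have hE : f τ (w 0) < f τ ξ := by
    by_contra! hcon
    exact hw0ξ (hw.eq_of_energy_ge h₁ hτ hX hwneg hbot hcon)
  have hanti := hw.energy_antitoneOn h₁ hτ hX convex_univ (fun s _ => hwR s)
  have hgrad := hw.gradX_tendsto_atTop h₁ hτ hX hwpos
  have hgc : Continuous (gradX f τ) := (contDiff_gradX hT h₁ hτ).continuous
  obtain ⟨p, -, hp⟩ := (isCompact_closedBall (0 : E n) R).exists_mapClusterPt
    (f := (atTop : Filter ℝ)) (u := w) (by
      rw [le_principal_iff, mem_map]
      exact Eventually.of_forall fun s => by simpa using hwR s)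
  have hpcrit : gradX f τ p = 0 := by
    have h1 : MapClusterPt (gradX f τ p) atTop (gradX f τ ∘ w) :=
      hp.continuousAt_comp hgc.continuousAt
    exact eq_of_nhds_neBot (ClusterPt.mono h1 hgrad)
  have hpE : f τ p ≤ f τ (w 0) := by
    by_contra! hcon
    have hfr := (mapClusterPt_iff_frequently.1 hp) _
      ((contDiff_space h₁ hτ).continuous.continuousAt.eventually (lt_mem_nhds hcon))
    obtain ⟨s, hs1, hs2⟩ := (hfr.and_eventually (eventually_ge_atTop 0)).exists
    exact absurd (hanti (mem_univ _) (mem_univ _) hs2) (not_le.2 hs1)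
  -- By injectivity of the time projection ξ is the only degenerate critical point at τ, and the
  -- energy at p is strictly below that at ξ.
  have hdet : (hessX f τ p).det ≠ 0 := by
    intro h0
    have := h₂.2.1 (show (τ, p) ∈ degenerateSet T f from ⟨hτ, hpcrit, h0⟩) hZ rfl
    have hpξ : p = ξ := congrArg Prod.snd this
    rw [hpξ] at hpE
    linarith
  obtain ⟨r, hr, hiso⟩ := exists_isolated_of_det_ne_zero hT h₁ hτ hdet
  have htop : Tendsto w atTop (𝓝 p) := by
    refine tendsto_of_mapClusterPt_isolated (fun U hU => ?_) hgc hgrad hp hr hiso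
    obtain ⟨a, ha⟩ := mem_atTop_sets.1 hU
    exact ⟨Ici a, mem_atTop a, fun s hs => ha s hs, isPreconnected_Ici,
      hw.continuous.continuousOn⟩
  exact ⟨w, p, hfast.contDiff hT h₁ hτ, hfast, hbot, htop, hpcrit,
    h₄ τ ξ hZ hF.psd w hfast ⟨0, hw0ξ⟩ hbot p htop⟩

/-! ### Branches of nondegenerate minima: continuation, smoothness and left limits. -/

/-- Positive definiteness of the Hessian is an open condition. -/
lemma HessPosDef.exists_nhds (hT : 0 < T) (h₁ : RegularCoercive T f) {t₀ : ℝ}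
    (ht₀ : t₀ ∈ Icc 0 T) {p : E n} (hp : HessPosDef f t₀ p) :
    ∃ r > 0, ∀ t ∈ Icc 0 T, |t - t₀| ≤ r → ∀ x ∈ Metric.closedBall p r, HessPosDef f t x := by
  obtain ⟨m, hm, hb⟩ := hp.exists_bound
  have hc := (contDiffOn_hessX hT h₁).continuousOn (t₀, p) ⟨ht₀, mem_univ _⟩
  rw [Metric.continuousWithinAt_iff] at hc
  obtain ⟨r, hr, hc⟩ := hc m hm
  refine ⟨r / 2, half_pos hr, fun t ht htt x hx z hz => ?_⟩
  have h2 := hc (x := (t, x)) ⟨ht, mem_univ _⟩ (by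
    rw [Prod.dist_eq, max_lt_iff]
    refine ⟨?_, (Metric.mem_closedBall.1 hx).trans_lt (by linarith)⟩
    rw [Real.dist_eq]
    exact htt.trans_lt (by linarith))
  rw [dist_eq_norm] at h2
  have hzn : 0 < ‖z‖ := norm_pos_iff.2 hz
  have h3 : |inner ℝ ((hessX f t x - hessX f t₀ p) z) z| < m * ‖z‖ ^ 2 := by
    refine (abs_real_inner_le_norm _ _).trans_lt ?_
    calc _ ≤ (‖hessX f t x - hessX f t₀ p‖ * ‖z‖) * ‖z‖ := by
          gcongr; exact ContinuousLinearMap.le_opNorm _ _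
      _ < (m * ‖z‖) * ‖z‖ := by gcongr
      _ = _ := by ring
  rw [sub_apply, inner_sub_left] at h3
  linarith [hb z, (abs_lt.1 h3).1]

/-- Critical points persist near a nondegenerate minimum. -/
lemma exists_critical_near (hT : 0 < T) (h₁ : RegularCoercive T f) {t₀ : ℝ}
    (ht₀ : t₀ ∈ Icc 0 T) {p : E n} (hcrit : gradX f t₀ p = 0) (hp : HessPosDef f t₀ p)
    {η : ℝ} (hη : 0 < η) :
    ∃ δ > 0, ∀ t ∈ Icc 0 T, |t - t₀| ≤ δ → ∃ x ∈ Metric.closedBall p η, gradX f t x = 0 := by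
  obtain ⟨η', hη', δ, hδ, hin⟩ := exists_inward_ball hT h₁ ht₀ hcrit hp hη
  refine ⟨δ, hδ, fun t ht htt => ?_⟩
  obtain ⟨x, hx, hmin⟩ := (isCompact_closedBall p η').exists_isMinOn
    ⟨p, Metric.mem_closedBall_self hη'.1.le⟩ (contDiff_space h₁ ht).continuous.continuousOn
  refine ⟨x, Metric.closedBall_subset_closedBall hη'.2 hx, ?_⟩
  have hder := hasFDerivAt_space_inner h₁ ht x
  -- A minimizer on the boundary is impossible: the gradient has a positive radial component, so
  -- moving towards the centre lowers f.
  have hxlt : ‖x - p‖ < η' := by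
    refine (mem_closedBall_iff_norm.1 hx).lt_of_ne fun heq => ?_
    have hcone : p - x ∈ posTangentConeAt (Metric.closedBall p η') x := by
      refine mem_posTangentConeAt_of_segment_subset ?_
      rw [add_sub_cancel]
      exact (convex_closedBall p η').segment_subset hx (Metric.mem_closedBall_self hη'.1.le)
    have h2 := (hmin.localize).hasFDerivWithinAt_nonneg hder.hasFDerivWithinAt hcone
    have h3 := hin t ht htt x heq
    rw [innerSL_apply_apply, ← neg_sub x p, inner_neg_right] at h2
    linarith
  have hloc : IsLocalMin (f t) x := by
    refine hmin.isLocalMin (mem_of_superset (Metric.isOpen_ball.mem_nhds ?_)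
      Metric.ball_subset_closedBall)
    exact mem_ball_iff_norm.2 hxlt
  have h0 := hloc.hasFDerivAt_eq_zero hder
  have := congrArg (fun L : E n →L[ℝ] ℝ => L (gradX f t x)) h0
  simpa using this

/-- Local continuation of a nondegenerate minimum. -/
lemma exists_local_branch (hT : 0 < T) (h₁ : RegularCoercive T f) {t₀ : ℝ}
    (ht₀ : t₀ ∈ Icc 0 T) {p : E n} (hcrit : gradX f t₀ p = 0) (hp : HessPosDef f t₀ p) :
    ∃ δ > 0, ∃ x : ℝ → E n, x t₀ = p ∧
      ContinuousOn x (Icc 0 T ∩ Icc (t₀ - δ) (t₀ + δ)) ∧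
      ∀ t ∈ Icc 0 T ∩ Icc (t₀ - δ) (t₀ + δ), gradX f t (x t) = 0 ∧ HessPosDef f t (x t) := by
  obtain ⟨m, hm, r₁, hr₁, hmono⟩ := hp.strong_monotone hT h₁ ht₀
  obtain ⟨r₂, hr₂, hpd⟩ := hp.exists_nhds hT h₁ ht₀
  set r := min r₁ r₂
  have hr : 0 < r := lt_min hr₁ hr₂
  obtain ⟨δ₀, hδ₀, hex⟩ := exists_critical_near hT h₁ ht₀ hcrit hp hr
  set δ := min r δ₀
  have hδ : 0 < δ := lt_min hr hδ₀
  set I := Icc 0 T ∩ Icc (t₀ - δ) (t₀ + δ)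
  have habs : ∀ t ∈ I, |t - t₀| ≤ δ := fun t ht =>
    abs_le.2 ⟨by linarith [ht.2.1], by linarith [ht.2.2]⟩
  have hex' : ∀ t, ∃ x, t ∈ I → x ∈ Metric.closedBall p r ∧ gradX f t x = 0 := by
    intro t
    by_cases ht : t ∈ I
    · obtain ⟨x, hx⟩ := hex t ht.1 ((habs t ht).trans (min_le_right _ _))
      exact ⟨x, fun _ => hx⟩
    · exact ⟨0, fun h => absurd h ht⟩
  choose x hx using hex'
  have hmono' : ∀ t ∈ I, ∀ y ∈ Metric.closedBall p r, ∀ z ∈ Metric.closedBall p r,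
      m * ‖y - z‖ ^ 2 ≤ inner ℝ (gradX f t y - gradX f t z) (y - z) := fun t ht y hy z hz =>
    hmono t ht.1 ((habs t ht).trans ((min_le_left _ _).trans (min_le_left _ _)))
      y (Metric.closedBall_subset_closedBall (min_le_left _ _) hy)
      z (Metric.closedBall_subset_closedBall (min_le_left _ _) hz)
  have ht₀I : t₀ ∈ I := ⟨ht₀, by linarith, by linarith⟩
  refine ⟨δ, hδ, x, ?_, fun s hs => ?_, fun t ht => ⟨(hx t ht).2, ?_⟩⟩
  · have h := hmono' t₀ ht₀I (x t₀) (hx t₀ ht₀I).1 p (Metric.mem_closedBall_self hr.le)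
    rw [(hx t₀ ht₀I).2, hcrit, sub_self, inner_zero_left] at h
    have : ‖x t₀ - p‖ ^ 2 ≤ 0 := by
      by_contra! hcon
      linarith [mul_pos hm hcon]
    have h2 : ‖x t₀ - p‖ = 0 := by
      have := sq_nonneg ‖x t₀ - p‖
      exact pow_eq_zero_iff (two_ne_zero) |>.1 (by linarith)
    exact sub_eq_zero.1 (norm_eq_zero.1 h2)
  -- Monotonicity at time t, where x t is critical, bounds the increment by the gradient at x s,
  -- which tends to zero as t → s. The argument is also valid at the end times 0 and T.
  · have hb : ∀ t ∈ I, ‖x t - x s‖ ≤ m⁻¹ * ‖gradX f t (x s)‖ := by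
      intro t ht
      have h := hmono' t ht (x t) (hx t ht).1 (x s) (hx s hs).1
      rw [(hx t ht).2, zero_sub] at h
      have h2 := h.trans (real_inner_le_norm _ _)
      rw [norm_neg] at h2
      rw [inv_mul_eq_div, le_div_iff₀ hm]
      rcases eq_or_lt_of_le (norm_nonneg (x t - x s)) with h0 | h0
      · rw [← h0, zero_mul]; exact norm_nonneg _
      · rw [sq, ← mul_assoc] at h2
        rw [mul_comm]
        exact le_of_mul_le_mul_right h2 h0
    have hlim : Tendsto (fun t => m⁻¹ * ‖gradX f t (x s)‖) (𝓝[I] s) (𝓝 0) := by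
      have hc : ContinuousWithinAt (fun t => gradFun f (t, x s)) I s :=
        (continuousOn_gradFun hT h₁).comp (s := I) (f := fun t : ℝ => (t, x s)) (by fun_prop)
          (fun t ht => ⟨ht.1, mem_univ _⟩) s hs
      have h2 := (hc.norm.const_mul m⁻¹).tendsto
      simpa [gradFun, (hx s hs).2] using h2
    show Tendsto x (𝓝[I] s) (𝓝 (x s))
    rw [tendsto_iff_norm_sub_tendsto_zero]
    exact squeeze_zero' (Eventually.of_forall fun _ => norm_nonneg _)
      (eventually_mem_nhdsWithin.mono hb) hlim
  · exact hpd t ht.1 ((habs t ht).trans ((min_le_left _ _).trans (min_le_right _ _))) _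
      (Metric.closedBall_subset_closedBall (min_le_right _ _) (hx t ht).1)

/-- `u` is a continuous branch of nondegenerate minima on `[a,b)`. -/
structure IsBranch (f : ℝ → E n → ℝ) (a b : ℝ) (u : ℝ → E n) : Prop where
  cont : ContinuousOn u (Ico a b)
  crit : ∀ s ∈ Ico a b, gradX f s (u s) = 0
  pos : ∀ s ∈ Ico a b, HessPosDef f s (u s)

namespace IsBranch

variable {a b b' : ℝ} {u u' : ℝ → E n}

lemma mono (hu : IsBranch f a b u) (h : b' ≤ b) : IsBranch f a b' u :=
  ⟨hu.cont.mono (Ico_subset_Ico_right h), fun s hs => hu.crit s (Ico_subset_Ico_right h hs),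
    fun s hs => hu.pos s (Ico_subset_Ico_right h hs)⟩

/-- The agreement set is closed by continuity and open because monotonicity leaves one critical
point near a nondegenerate minimum; the interval is connected. -/
lemma unique (hT : 0 < T) (h₁ : RegularCoercive T f) (ha : 0 ≤ a) (hb : b ≤ T)
    (hu : IsBranch f a b u) (hu' : IsBranch f a b u') (h0 : u a = u' a) :
    EqOn u u' (Ico a b) := by
  intro s₀ hs₀
  have hab : a < b := hs₀.1.trans_lt hs₀.2
  have : PreconnectedSpace (Ico a b) := Subtype.preconnectedSpace isPreconnected_Ico
  have hc := continuousOn_iff_continuous_domRestrict.1 hu.cont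
  have hc' := continuousOn_iff_continuous_domRestrict.1 hu'.cont
  set S : Set (Ico a b) := {s | (Ico a b).domRestrict u s = (Ico a b).domRestrict u' s}
  have hclosed : IsClosed S := isClosed_eq hc hc'
  have hopen : IsOpen S := by
    rw [isOpen_iff_mem_nhds]
    intro s hs
    have hs' : u s = u' s := hs
    have hsT : (s : ℝ) ∈ Icc 0 T := ⟨ha.trans s.2.1, s.2.2.le.trans hb⟩
    obtain ⟨m, hm, r, hr, hmono⟩ := (hu.pos s s.2).strong_monotone hT h₁ hsT
    have e1 : ∀ᶠ t in 𝓝 s, (Ico a b).domRestrict u t ∈ Metric.closedBall (u s) r :=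
      hc.continuousAt.eventually (Metric.closedBall_mem_nhds _ hr)
    have e2 : ∀ᶠ t in 𝓝 s, (Ico a b).domRestrict u' t ∈ Metric.closedBall (u' s) r :=
      hc'.continuousAt.eventually (Metric.closedBall_mem_nhds _ hr)
    have e3 : ∀ᶠ t : Ico a b in 𝓝 s, (t : ℝ) ∈ Metric.closedBall (s : ℝ) r :=
      continuous_subtype_val.continuousAt.eventually (Metric.closedBall_mem_nhds _ hr)
    filter_upwards [e1, e2, e3] with t k1 k2 k3
    rw [← hs'] at k2
    have h := hmono t ⟨ha.trans t.2.1, t.2.2.le.trans hb⟩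
      (by rwa [Metric.mem_closedBall, Real.dist_eq] at k3) (u t) k1 (u' t) k2
    rw [hu.crit t t.2, hu'.crit t t.2, sub_self, inner_zero_left] at h
    have h2 : ‖u t - u' t‖ ^ 2 ≤ 0 := by
      by_contra! hcon
      linarith [mul_pos hm hcon]
    have h3 : ‖u t - u' t‖ = 0 :=
      pow_eq_zero_iff (two_ne_zero) |>.1 (le_antisymm h2 (sq_nonneg _))
    exact sub_eq_zero.1 (norm_eq_zero.1 h3)
  have huniv := IsClopen.eq_univ ⟨hclosed, hopen⟩ ⟨⟨a, le_rfl, hab⟩, h0⟩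
  have : (⟨s₀, hs₀⟩ : Ico a b) ∈ S := by rw [huniv]; trivial
  exact this

end IsBranch

lemma exists_hess_equiv {t : ℝ} {x : E n} (h : HessPosDef f t x) :
    ∃ e : E n ≃L[ℝ] E n, (e : E n →L[ℝ] E n) = hessX f t x := by
  have hker : LinearMap.ker (hessX f t x : E n →ₗ[ℝ] E n) = ⊥ := by
    by_contra hne
    exact h.det_ne_zero (LinearMap.det_eq_zero_iff_ker_ne_bot.2 hne)
  refine ⟨(LinearEquiv.ofInjectiveEndo (hessX f t x : E n →ₗ[ℝ] E n)
    (LinearMap.ker_eq_bot.1 hker)).toContinuousLinearEquiv, ?_⟩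
  ext z
  rfl

/-- Differentiability of an implicitly defined branch. -/
lemma IsBranch.hasDerivWithinAt (hT : 0 < T) (h₁ : RegularCoercive T f) {a b : ℝ}
    (ha : 0 ≤ a) (hb : b ≤ T) {u : ℝ → E n} (hu : IsBranch f a b u) {s : ℝ} (hs : s ∈ Ico a b) :
    HasDerivWithinAt u (-((hessX f s (u s)).inverse (gradDeriv T f (s, u s) (1, 0))))
      (Ico a b) s := by
  obtain ⟨e, he⟩ := exists_hess_equiv (hu.pos s hs)
  have hI : ∀ t ∈ Ico a b, t ∈ Icc 0 T := fun t ht => ⟨ha.trans ht.1, ht.2.le.trans hb⟩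
  rw [← he, ContinuousLinearMap.inverse_equiv]
  set L := gradDeriv T f (s, u s)
  set k := e.symm (L (1, 0))
  change HasDerivWithinAt u (-k) (Ico a b) s
  have hG := hasFDerivWithinAt_gradFun hT h₁ (p := (s, u s)) ⟨hI s hs, mem_univ _⟩
  have hlim : Tendsto (fun t => (t, u t)) (𝓝[Ico a b] s) (𝓝[strip n T] (s, u s)) := by
    refine tendsto_nhdsWithin_iff.2 ⟨?_, eventually_mem_nhdsWithin.mono fun t ht =>
      ⟨hI t ht, mem_univ _⟩⟩
    exact (tendsto_id.mono_left nhdsWithin_le_nhds).prodMk_nhds (hu.cont s hs)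
  have ho := hG.isLittleO.comp_tendsto hlim
  -- The gradient vanishes along the branch, so its linearization applied to the increment is small;
  -- inverting the Hessian isolates u t - u s.
  have ho2 : (fun t => (u t - u s) + (t - s) • k) =o[𝓝[Ico a b] s]
      fun t => ((t - s, u t - u s) : ℝ × E n) := by
    have h3 : (fun t => L (t - s, u t - u s)) =o[𝓝[Ico a b] s]
        fun t => ((t - s, u t - u s) : ℝ × E n) := by
      refine (ho.neg_left).congr' ?_ (Eventually.of_forall fun t => by simp)
      filter_upwards [eventually_mem_nhdsWithin] with t ht
      simp only [Function.comp_apply, gradFun, hu.crit t ht, hu.crit s hs, sub_self, zero_sub,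
        neg_neg, Prod.mk_sub_mk]
      rfl
    have h4 := (e.symm : E n →L[ℝ] E n).isBigO_comp (fun t => L (t - s, u t - u s))
      (𝓝[Ico a b] s)
    refine (h4.trans_isLittleO h3).congr_left fun t => ?_
    have h5 : L (t - s, u t - u s) = (t - s) • L (1, 0) + e (u t - u s) := by
      have h6 : ((t - s, u t - u s) : ℝ × E n) = (t - s) • (1, 0) + (0, u t - u s) := by simp
      have h7 : e (u t - u s) = hessX f s (u s) (u t - u s) := by rw [← he]; rfl
      rw [h6, map_add, map_smul, h7, hessX_eq hT h₁ (hI s hs)]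
      simp [L]
    simp only [ContinuousLinearEquiv.coe_coe]
    rw [h5, map_add, map_smul, e.symm_apply_apply]
    simp only [k]
    abel
  rw [hasDerivWithinAt_iff_isLittleO, Asymptotics.isLittleO_iff]
  intro c hc
  -- The bound 1 / 2 absorbs ‖ψ‖ on the right; the other bound leaves the coefficient c / 2 on ‖t -
  -- s‖.
  set c' := min (1 / 2) (c / (2 * (1 + ‖k‖)))
  have hc' : 0 < c' := by positivity
  filter_upwards [ho2.def hc'] with t ht
  have e1 : u t - u s - (t - s) • -k = (u t - u s) + (t - s) • k := by
    rw [smul_neg, sub_neg_eq_add]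
  rw [e1]
  set ψ := (u t - u s) + (t - s) • k
  have n1 : ‖((t - s, u t - u s) : ℝ × E n)‖ ≤ ‖t - s‖ + ‖u t - u s‖ := by
    rw [Prod.norm_def]
    exact max_le (le_add_of_nonneg_right (norm_nonneg _)) (le_add_of_nonneg_left (norm_nonneg _))
  have n2 : ‖u t - u s‖ ≤ ‖ψ‖ + ‖t - s‖ * ‖k‖ := by
    have : u t - u s = ψ - (t - s) • k := by simp [ψ]
    rw [this]
    refine (norm_sub_le _ _).trans ?_
    rw [norm_smul]
  have n3 : ‖ψ‖ ≤ c' * ((1 + ‖k‖) * ‖t - s‖ + ‖ψ‖) := by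
    refine ht.trans ?_
    gcongr
    linarith
  have n4 : c' ≤ 1 / 2 := min_le_left _ _
  have n5 : c' * (1 + ‖k‖) ≤ c / 2 := by
    have : c' ≤ c / (2 * (1 + ‖k‖)) := min_le_right _ _
    calc c' * (1 + ‖k‖) ≤ c / (2 * (1 + ‖k‖)) * (1 + ‖k‖) := by gcongr
      _ = c / 2 := by field_simp
  have n6 : c' * (1 + ‖k‖) * ‖t - s‖ ≤ c / 2 * ‖t - s‖ := by gcongr
  have n7 : c' * ‖ψ‖ ≤ 1 / 2 * ‖ψ‖ := by gcongr
  nlinarith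

/-- Bootstrap: the derivative is a C¹ expression in (t, u t) through the inverse Hessian, so
continuity of u gives C¹ and then C². -/
lemma IsBranch.contDiffOn (hT : 0 < T) (h₁ : RegularCoercive T f) {a b : ℝ}
    (ha : 0 ≤ a) (hb : b ≤ T) {u : ℝ → E n} (hu : IsBranch f a b u) :
    ContDiffOn ℝ 2 u (Ico a b) := by
  have hud : UniqueDiffOn ℝ (Ico a b) := uniqueDiffOn_Ico a b
  have hd : ∀ s ∈ Ico a b, derivWithin u (Ico a b) s =
      -((hessX f s (u s)).inverse (gradDeriv T f (s, u s) (1, 0))) := fun s hs =>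
    (hu.hasDerivWithinAt hT h₁ ha hb hs).derivWithin (hud s hs)
  have hdiff : DifferentiableOn ℝ u (Ico a b) := fun s hs =>
    (hu.hasDerivWithinAt hT h₁ ha hb hs).differentiableWithinAt
  have hmaps : MapsTo (fun t => (t, u t)) (Ico a b) (strip n T) := fun t ht =>
    ⟨⟨ha.trans ht.1, ht.2.le.trans hb⟩, mem_univ _⟩
  have key : ∀ m : WithTop ℕ∞, m ≤ 1 → ContDiffOn ℝ m u (Ico a b) →
      ContDiffOn ℝ m (derivWithin u (Ico a b)) (Ico a b) := by
    intro m hm hum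
    have h2 : ContDiffOn ℝ m (fun t => (t, u t)) (Ico a b) := contDiffOn_id.prodMk hum
    have hH : ContDiffOn ℝ m (fun t => hessX f t (u t)) (Ico a b) :=
      ((contDiffOn_hessX hT h₁).of_le hm).comp h2 hmaps
    have hinv : ContDiffOn ℝ m (fun t => (hessX f t (u t)).inverse) (Ico a b) := by
      intro s hs
      obtain ⟨e, he⟩ := exists_hess_equiv (hu.pos s hs)
      have h3 : ContDiffAt ℝ m (ContinuousLinearMap.inverse : (E n →L[ℝ] E n) → _)
          (hessX f s (u s)) := by rw [← he]; exact contDiffAt_map_inverse e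
      exact h3.comp_contDiffWithinAt s (hH s hs)
    have hg : ContDiffOn ℝ m (fun t => gradDeriv T f (t, u t) (1, 0)) (Ico a b) :=
      (((contDiffOn_gradDeriv hT h₁).of_le hm).comp h2 hmaps).clm_apply contDiffOn_const
    exact (hinv.clm_apply hg).neg.congr hd
  have h1 : ContDiffOn ℝ 1 u (Ico a b) := by
    rw [show (1 : WithTop ℕ∞) = 0 + 1 by norm_num, contDiffOn_succ_iff_derivWithin hud]
    exact ⟨hdiff, by simp, key 0 (by simp) (contDiffOn_zero.2 hu.cont)⟩
  rw [show (2 : WithTop ℕ∞) = 1 + 1 by norm_num, contDiffOn_succ_iff_derivWithin hud]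
  exact ⟨hdiff, by simp, key 1 le_rfl h1⟩

lemma exists_critical_bound (h₁ : RegularCoercive T f) :
    ∃ R > 0, ∀ t ∈ Icc 0 T, ∀ x : E n, gradX f t x = 0 → ‖x‖ ≤ R := by
  obtain ⟨R₀, hR₀, htrap⟩ := h₁.exists_trapping
  refine ⟨R₀, hR₀, fun t ht x hx => ?_⟩
  by_contra! hcon
  have := htrap ‖x‖ hcon.le t ht x rfl
  rw [hx, inner_zero_left] at this
  exact lt_irrefl _ this

/-- A degenerate critical point with positive semidefinite Hessian is a fold. -/
lemma exists_isFold_of_mem (h₂ : FiniteDegenerate T f) (h₃ : Transversal T f) {τ : ℝ} {ξ : E n}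
    (hZ : (τ, ξ) ∈ degenerateSet T f) (hpsd : HessPosSemidef f τ ξ) : ∃ l, IsFold T f τ ξ l := by
  obtain ⟨l₀, hl₀, hker, hb, hc⟩ := h₃ τ ξ hZ hpsd
  obtain ⟨s, -, hF, -⟩ := exists_isFold h₂ hZ hpsd hl₀ hker hb hc
  exact ⟨_, hF⟩

/-- A branch of minima has a limit at the right endpoint of its interval. -/
lemma IsBranch.exists_left_limit (hT : 0 < T) (h₁ : RegularCoercive T f)
    (h₂ : FiniteDegenerate T f) (h₃ : Transversal T f) {a b : ℝ} (ha : 0 ≤ a) (hab : a < b)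
    (hb : b ≤ T) {u : ℝ → E n} (hu : IsBranch f a b u) :
    ∃ x, Tendsto u (𝓝[<] b) (𝓝 x) ∧ gradX f b x = 0 ∧ HessPosSemidef f b x := by
  have hbI : b ∈ Icc 0 T := ⟨ha.trans hab.le, hb⟩
  have hI : ∀ t ∈ Ico a b, t ∈ Icc 0 T := fun t ht => ⟨ha.trans ht.1, ht.2.le.trans hb⟩
  have hev : ∀ᶠ t in 𝓝[<] b, t ∈ Ico a b := Ico_mem_nhdsLT hab
  obtain ⟨R, hR, hcb⟩ := exists_critical_bound h₁
  have huR : ∀ t ∈ Ico a b, ‖u t‖ ≤ R := fun t ht => hcb t (hI t ht) _ (hu.crit t ht)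
  obtain ⟨p, -, hp⟩ := (isCompact_closedBall (0 : E n) R).exists_mapClusterPt
    (f := 𝓝[<] b) (u := u) (by
      rw [le_principal_iff, mem_map]
      exact hev.mono fun t ht => by simpa using huR t ht)
  -- The ultrafilter plays the role of a subsequence along which u tends to p; criticality and
  -- semidefiniteness pass to the limit.
  obtain ⟨U, hU, hUlim⟩ := mapClusterPt_iff_ultrafilter.1 hp
  have hevU : ∀ᶠ t in (U : Filter ℝ), t ∈ Ico a b := hU hev
  have hjoint : Tendsto (fun t => (t, u t)) U (𝓝[strip n T] (b, p)) := by
    refine tendsto_nhdsWithin_iff.2 ⟨?_, hevU.mono fun t ht => ⟨hI t ht, mem_univ _⟩⟩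
    exact (tendsto_id.mono_left (hU.trans nhdsWithin_le_nhds)).prodMk_nhds hUlim
  have hcrit : gradX f b p = 0 := by
    have h := ((continuousOn_gradFun hT h₁) (b, p) ⟨hbI, mem_univ _⟩).tendsto.comp hjoint
    refine tendsto_nhds_unique h (tendsto_const_nhds.congr' ?_)
    exact hevU.mono fun t ht => (hu.crit t ht).symm
  have hpsd : HessPosSemidef f b p := by
    intro z
    have h := ((contDiffOn_hessX hT h₁).continuousOn (b, p) ⟨hbI, mem_univ _⟩).tendsto.comp hjoint
    have hc : Continuous fun L : E n →L[ℝ] E n => (inner ℝ (L z) z : ℝ) := by fun_prop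
    refine ge_of_tendsto ((hc.tendsto _).comp h) ?_
    exact hevU.mono fun t ht => (hu.pos t ht).posSemidef z
  -- A degenerate p is a fold, isolated by transversality; otherwise invertibility isolates it.
  -- Together with ∇ₓf(b, u t) → 0 this makes the cluster point the limit.
  have hiso : ∃ r > 0, ∀ x ∈ Metric.closedBall p r, gradX f b x = 0 → x = p := by
    by_cases hdet : (hessX f b p).det = 0
    · obtain ⟨l, hF⟩ := exists_isFold_of_mem h₂ h₃ (τ := b) (ξ := p) ⟨hbI, hcrit, hdet⟩ hpsd
      obtain ⟨r, hr, h⟩ := hF.isolated hT h₁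
      exact ⟨r, hr, fun x hx h0 => (h b x (by simpa using hr.le) (mem_closedBall_iff_norm.1 hx)
        (by simp) h0).2⟩
    · exact exists_isolated_of_det_ne_zero hT h₁ hbI hdet
  obtain ⟨r, hr, hiso⟩ := hiso
  refine ⟨p, ?_, hcrit, hpsd⟩
  have huc : UniformContinuousOn (gradFun f) (Icc 0 T ×ˢ Metric.closedBall 0 R) :=
    (isCompact_Icc.prod (isCompact_closedBall 0 R)).uniformContinuousOn_of_continuous
      ((continuousOn_gradFun hT h₁).mono (prod_mono le_rfl (subset_univ _)))
  have hgrad : Tendsto (fun t => gradX f b (u t)) (𝓝[<] b) (𝓝 0) := by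
    rw [Metric.tendsto_nhds]
    intro η hη
    obtain ⟨δ, hδ, h⟩ := Metric.uniformContinuousOn_iff.1 huc η hη
    have hnear : ∀ᶠ t in 𝓝[<] b, dist b t < δ := by
      have : ∀ᶠ t in 𝓝 b, dist b t < δ := by
        filter_upwards [Metric.ball_mem_nhds b hδ] with t ht
        rwa [dist_comm]
      exact nhdsWithin_le_nhds this
    filter_upwards [hev, hnear] with t ht ht2
    have h3 := h (b, u t) ⟨hbI, by simpa using huR t ht⟩ (t, u t)
      ⟨hI t ht, by simpa using huR t ht⟩ (by
        rw [Prod.dist_eq]; simp only [dist_self]; exact max_lt ht2 hδ)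
    simpa [gradFun, hu.crit t ht] using h3
  refine tendsto_of_mapClusterPt_isolated (fun V hV => ?_)
    (contDiff_gradX hT h₁ hbI).continuous hgrad hp hr hiso
  obtain ⟨c, hc, hcV⟩ := (mem_nhdsLT_iff_exists_mem_Ico_Ioo_subset hab).1 hV
  refine ⟨Ioo c b, Ioo_mem_nhdsLT hc.2, hcV, isPreconnected_Ioo, hu.cont.mono fun t ht => ?_⟩
  exact ⟨hc.1.trans ht.1.le, ht.2⟩

/-- A nondegenerate minimum can be continued up to the final time or to a fold point. -/
lemma exists_maximal_branch (hT : 0 < T) (h₁ : RegularCoercive T f) (h₂ : FiniteDegenerate T f)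
    (h₃ : Transversal T f) {t₀ : ℝ} (ht₀ : t₀ ∈ Ico 0 T) {y₀ : E n} (hcrit : gradX f t₀ y₀ = 0)
    (hpos : HessPosDef f t₀ y₀) :
    ∃ t₁ ∈ Ioc t₀ T, ∃ (u : ℝ → E n) (x₁ : E n), u t₀ = y₀ ∧ IsBranch f t₀ t₁ u ∧
      Tendsto u (𝓝[<] t₁) (𝓝 x₁) ∧ (t₁ = T ∨ (t₁ < T ∧ (t₁, x₁) ∈ degenerateSet T f ∧
        ∃ l, IsFold T f t₁ x₁ l ∧ 0 < mixedDeriv T f t₁ x₁ l * thirdDeriv f t₁ x₁ l)) := by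
  set A : Set ℝ := {b | b ∈ Ioc t₀ T ∧ ∃ u, IsBranch f t₀ b u ∧ u t₀ = y₀}
  have ht₀0 := ht₀.1
  have hAne : A.Nonempty := by
    obtain ⟨δ, hδ, x, hx0, hxc, hx⟩ := exists_local_branch hT h₁ (Ico_subset_Icc_self ht₀) hcrit
      hpos
    have hsub : Ico t₀ (min (t₀ + δ) T) ⊆ Icc 0 T ∩ Icc (t₀ - δ) (t₀ + δ) := fun t ht =>
      ⟨⟨ht₀0.trans ht.1, (ht.2.trans_le (min_le_right _ _)).le⟩, by linarith [ht.1],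
        (ht.2.trans_le (min_le_left _ _)).le⟩
    exact ⟨min (t₀ + δ) T, ⟨lt_min (by linarith) ht₀.2, min_le_right _ _⟩, x,
      ⟨hxc.mono hsub, fun s hs => (hx s (hsub hs)).1, fun s hs => (hx s (hsub hs)).2⟩, hx0⟩
  have hAbdd : BddAbove A := ⟨T, fun b hb => hb.1.2⟩
  set t₁ := sSup A
  have ht₁T : t₁ ≤ T := csSup_le hAne fun b hb => hb.1.2
  have ht₀t₁ : t₀ < t₁ := by
    obtain ⟨b, hb⟩ := hAne
    exact hb.1.1.trans_le (le_csSup hAbdd hb)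
  have hex : ∀ s, ∃ b u, s ∈ Ico t₀ t₁ → s < b ∧ b ∈ Ioc t₀ T ∧ IsBranch f t₀ b u ∧ u t₀ = y₀ := by
    intro s
    by_cases hs : s ∈ Ico t₀ t₁
    · obtain ⟨b, hb, hsb⟩ := exists_lt_of_lt_csSup hAne hs.2
      obtain ⟨u, hu⟩ := hb.2
      exact ⟨b, u, fun _ => ⟨hsb, hb.1, hu⟩⟩
    · exact ⟨0, 0, fun h => absurd h hs⟩
  choose B W hBW using hex
  -- By uniqueness this diagonal choice agrees near each s with the single branch W s.
  set u : ℝ → E n := fun s => W s s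
  have hglue : ∀ b w, b ≤ T → IsBranch f t₀ b w → w t₀ = y₀ → ∀ s ∈ Ico t₀ t₁, s < b →
      u s = w s := by
    intro b w hbT hw hw0 s hs hsb
    obtain ⟨k1, k2, k3, k4⟩ := hBW s hs
    exact IsBranch.unique hT h₁ ht₀0 ((min_le_left _ _).trans hbT) (k3.mono (min_le_right b (B s)))
      (hw.mono (min_le_left b (B s))) (k4.trans hw0.symm) ⟨hs.1, lt_min hsb k1⟩
  have hu : IsBranch f t₀ t₁ u := by
    refine ⟨fun s hs => ?_, fun s hs => ?_, fun s hs => ?_⟩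
    · obtain ⟨k1, k2, k3, k4⟩ := hBW s hs
      have hcw : ContinuousWithinAt (W s) (Ico t₀ t₁) s := by
        refine (k3.cont s ⟨hs.1, k1⟩).mono_of_mem_nhdsWithin ?_
        refine mem_nhdsWithin_iff_exists_mem_nhds_inter.2 ⟨Iio (B s), Iio_mem_nhds k1, ?_⟩
        rintro t ⟨ht1, ht2⟩
        exact ⟨ht2.1, ht1⟩
      refine hcw.congr_of_eventuallyEq ?_ rfl
      have : ∀ᶠ t in 𝓝[Ico t₀ t₁] s, t < B s := nhdsWithin_le_nhds (Iio_mem_nhds k1)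
      filter_upwards [this, eventually_mem_nhdsWithin] with t ht1 ht2
      exact hglue (B s) (W s) k2.2 k3 k4 t ht2 ht1
    · obtain ⟨k1, k2, k3, k4⟩ := hBW s hs
      exact k3.crit s ⟨hs.1, k1⟩
    · obtain ⟨k1, k2, k3, k4⟩ := hBW s hs
      exact k3.pos s ⟨hs.1, k1⟩
  have hu0 : u t₀ = y₀ := (hBW t₀ ⟨le_rfl, ht₀t₁⟩).2.2.2
  obtain ⟨x₁, hlim, hcrit₁, hpsd₁⟩ := hu.exists_left_limit hT h₁ h₂ h₃ ht₀0 ht₀t₁ ht₁T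
  have ht₁I : t₁ ∈ Icc 0 T := ⟨ht₀0.trans ht₀t₁.le, ht₁T⟩
  refine ⟨t₁, ⟨ht₀t₁, ht₁T⟩, u, x₁, hu0, hu, hlim, ?_⟩
  by_cases hdet : (hessX f t₁ x₁).det = 0
  · right
    have hZ : (t₁, x₁) ∈ degenerateSet T f := ⟨ht₁I, hcrit₁, hdet⟩
    obtain ⟨l, hF⟩ := exists_isFold_of_mem h₂ h₃ hZ hpsd₁
    refine ⟨hF.mem.2, hZ, l, hF, ?_⟩
    -- Without the positive sign the fold would be isolated at earlier times, contradicting the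
    -- branch that arrives there.
    by_contra! hneg
    obtain ⟨r, hr, hiso⟩ := hF.isolated hT h₁
    have e1 : ∀ᶠ t in 𝓝[<] t₁, ‖u t - x₁‖ ≤ r := by
      filter_upwards [hlim.eventually (Metric.closedBall_mem_nhds x₁ hr)] with t ht
      exact mem_closedBall_iff_norm.1 ht
    have e2 : ∀ᶠ t in 𝓝[<] t₁, |t - t₁| ≤ r := by
      refine nhdsWithin_le_nhds ?_
      filter_upwards [Metric.closedBall_mem_nhds t₁ hr] with t ht
      rwa [Metric.mem_closedBall, Real.dist_eq] at ht
    obtain ⟨t, k1, k2, k3⟩ := (e1.and (e2.and (Ico_mem_nhdsLT ht₀t₁))).exists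
    have := hiso t (u t) k2 k1 (mul_nonneg_of_nonpos_of_nonpos (by linarith [k3.2]) hneg)
      (hu.crit t k3)
    exact k3.2.ne this.1
  -- A nondegenerate limit before T could be continued by a local branch beyond the supremum.
  · left
    by_contra hne
    have hlt : t₁ < T := lt_of_le_of_ne ht₁T hne
    have hpd := hpsd₁.posDef_of_det_ne_zero hT h₁ ht₁I hdet
    obtain ⟨δ, hδ, x, hx0, hxc, hx⟩ := exists_local_branch hT h₁ ht₁I hcrit₁ hpd
    set b := min (t₁ + δ) T
    have hb1 : t₁ < b := lt_min (by linarith) hlt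
    have hsub : Ico t₁ b ⊆ Icc 0 T ∩ Icc (t₁ - δ) (t₁ + δ) := fun t ht =>
      ⟨⟨ht₁I.1.trans ht.1, (ht.2.trans_le (min_le_right _ _)).le⟩, by linarith [ht.1],
        (ht.2.trans_le (min_le_left _ _)).le⟩
    set w : ℝ → E n := fun s => if s < t₁ then u s else x s
    have hwlt : ∀ s, s < t₁ → w s = u s := fun s hs => if_pos hs
    have hwge : ∀ s, t₁ ≤ s → w s = x s := fun s hs => if_neg (not_lt.2 hs)
    have hbA : b ∈ A := by
      refine ⟨⟨ht₀t₁.trans hb1, min_le_right _ _⟩, w, ⟨fun s hs => ?_, fun s hs => ?_,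
        fun s hs => ?_⟩, by rw [hwlt t₀ ht₀t₁, hu0]⟩
      · rcases lt_trichotomy s t₁ with h | h | h
        · have hc : ContinuousWithinAt u (Ico t₀ b) s := by
            refine (hu.cont s ⟨hs.1, h⟩).mono_of_mem_nhdsWithin ?_
            refine mem_nhdsWithin_iff_exists_mem_nhds_inter.2 ⟨Iio t₁, Iio_mem_nhds h, ?_⟩
            rintro t ⟨ht1, ht2⟩
            exact ⟨ht2.1, ht1⟩
          refine hc.congr_of_eventuallyEq ?_ (hwlt s h)
          exact nhdsWithin_le_nhds (mem_of_superset (Iio_mem_nhds h) hwlt)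
        · subst h
          have hL : ContinuousWithinAt w (Iio t₁) t₁ := by
            have : Tendsto w (𝓝[<] t₁) (𝓝 x₁) :=
              hlim.congr' (eventually_mem_nhdsWithin.mono fun t ht => (hwlt t ht).symm)
            show Tendsto w (𝓝[<] t₁) (𝓝 (w t₁))
            rwa [hwge t₁ le_rfl, hx0]
          have hR : ContinuousWithinAt w (Ico t₁ b) t₁ :=
            ((hxc.mono hsub) t₁ ⟨le_rfl, hb1⟩).congr (fun t ht => hwge t ht.1) (hwge t₁ le_rfl)
          refine (hL.union hR).mono fun t ht => ?_
          rcases lt_or_ge t t₁ with h | h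
          · exact Or.inl h
          · exact Or.inr ⟨h, ht.2⟩
        · have hc : ContinuousWithinAt x (Ico t₀ b) s := by
            refine ((hxc.mono hsub) s ⟨h.le, hs.2⟩).mono_of_mem_nhdsWithin ?_
            refine mem_nhdsWithin_iff_exists_mem_nhds_inter.2 ⟨Ioi t₁, Ioi_mem_nhds h, ?_⟩
            rintro t ⟨ht1, ht2⟩
            exact ⟨le_of_lt ht1, ht2.2⟩
          refine hc.congr_of_eventuallyEq ?_ (hwge s h.le)
          exact nhdsWithin_le_nhds (mem_of_superset (Ioi_mem_nhds h) fun t ht =>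
            hwge t (le_of_lt ht))
      · rcases lt_or_ge s t₁ with h | h
        · rw [hwlt s h]; exact hu.crit s ⟨hs.1, h⟩
        · rw [hwge s h]; exact (hx s (hsub ⟨h, hs.2⟩)).1
      · rcases lt_or_ge s t₁ with h | h
        · rw [hwlt s h]; exact hu.pos s ⟨hs.1, h⟩
        · rw [hwge s h]; exact (hx s (hsub ⟨h, hs.2⟩)).2
    exact absurd (le_csSup hAbdd hbA) (not_le.2 hb1)

/-! ### Construction of the limit evolution. -/

/-- A limit evolution on `[t₀,T]`. -/
structure IsEvolutionFrom (T : ℝ) (f : ℝ → E n → ℝ) (t₀ : ℝ) (y₀ : E n) (k : ℕ) (t : ℕ → ℝ)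
    (x : ℕ → E n) (u : ℝ → E n) (v : ℕ → ℝ → E n) : Prop where
  t_zero : t 0 = t₀
  t_last : t k = T
  t_lt : ∀ i < k, t i < t (i + 1)
  init : u t₀ = y₀
  smooth : ∀ i < k, ContDiffOn ℝ 2 u (Ico (t i) (t (i + 1)))
  critical : ∀ i < k, ∀ s ∈ Ico (t i) (t (i + 1)), gradX f s (u s) = 0 ∧ HessPosDef f s (u s)
  left_limit : ∀ i, 1 ≤ i → i ≤ k → Tendsto u (𝓝[<] (t i)) (𝓝 (x i))
  final : u T = x k
  degenerate : ∀ i, 1 ≤ i → i < k → (t i, x i) ∈ degenerateSet T f ∧ HessPosSemidef f (t i) (x i)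
  same_sign : ∀ i, 1 ≤ i → i < k → ∃ l : E n, l ≠ 0 ∧
    LinearMap.ker (hessX f (t i) (x i) : E n →ₗ[ℝ] E n) = Submodule.span ℝ {l} ∧
    0 < mixedDeriv T f (t i) (x i) l * thirdDeriv f (t i) (x i) l
  v_smooth : ∀ i, 1 ≤ i → i < k → ContDiff ℝ 2 (v i)
  v_solution : ∀ i, 1 ≤ i → i < k → IsFastSolution f (t i) (v i)
  v_atBot : ∀ i, 1 ≤ i → i < k → Tendsto (v i) atBot (𝓝 (x i))
  v_atTop : ∀ i, 1 ≤ i → i < k → Tendsto (v i) atTop (𝓝 (u (t i)))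

lemma le_of_lt_succ {k : ℕ} {t : ℕ → ℝ} (h : ∀ i < k, t i < t (i + 1)) {i j : ℕ} (hij : i ≤ j)
    (hj : j ≤ k) : t i ≤ t j := by
  induction j, hij using Nat.le_induction with
  | base => exact le_rfl
  | succ j hij ih => exact (ih (by omega)).trans (h j (by omega)).le

/-- A branch ending at the final time is an evolution without jumps. -/
lemma IsBranch.exists_evolutionFrom (hT : 0 < T) (h₁ : RegularCoercive T f) {t₀ : ℝ}
    (ht₀ : t₀ ∈ Ico 0 T) {u : ℝ → E n} {x₁ : E n} (hu : IsBranch f t₀ T u)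
    (hlim : Tendsto u (𝓝[<] T) (𝓝 x₁)) :
    ∃ k t x u' v, IsEvolutionFrom T f t₀ (u t₀) k t x u' v := by
  set w : ℝ → E n := fun s => if s < T then u s else x₁
  have hwlt : ∀ s, s < T → w s = u s := fun s hs => if_pos hs
  refine ⟨1, fun j => if j = 0 then t₀ else T, fun _ => x₁, w, fun _ _ => 0, ?_⟩
  refine ⟨rfl, rfl, ?_, hwlt t₀ ht₀.2, ?_, ?_, ?_, if_neg (lt_irrefl T), ?_, ?_, ?_, ?_, ?_, ?_⟩
  · intro i hi
    obtain rfl : i = 0 := by omega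
    simpa using ht₀.2
  · intro i hi
    obtain rfl : i = 0 := by omega
    exact (hu.contDiffOn hT h₁ ht₀.1 le_rfl).congr fun s hs => hwlt s hs.2
  · intro i hi s hs
    obtain rfl : i = 0 := by omega
    rw [hwlt s hs.2]
    exact ⟨hu.crit s hs, hu.pos s hs⟩
  · intro i hi hi'
    obtain rfl : i = 1 := by omega
    exact hlim.congr' (eventually_mem_nhdsWithin.mono fun s hs => (hwlt s hs).symm)
  all_goals intro i hi hi'; omega

/-- A branch ending at a fold, a connecting orbit and a later evolution form an evolution. -/
lemma IsEvolutionFrom.cons (hT : 0 < T) (h₁ : RegularCoercive T f) {t₀ t₁ : ℝ} (ht₀ : 0 ≤ t₀)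
    (ht₀t₁ : t₀ < t₁) (ht₁ : t₁ < T) {u₁ : ℝ → E n} {x₁ : E n} (hu : IsBranch f t₀ t₁ u₁)
    (hlim : Tendsto u₁ (𝓝[<] t₁) (𝓝 x₁)) (hZ : (t₁, x₁) ∈ degenerateSet T f) {l : E n}
    (hF : IsFold T f t₁ x₁ l) (hl : 0 < mixedDeriv T f t₁ x₁ l * thirdDeriv f t₁ x₁ l)
    {v₁ : ℝ → E n} {y₁ : E n} (hv : ContDiff ℝ 2 v₁) (hvs : IsFastSolution f t₁ v₁)
    (hvb : Tendsto v₁ atBot (𝓝 x₁)) (hvt : Tendsto v₁ atTop (𝓝 y₁))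
    {k' : ℕ} {t' : ℕ → ℝ} {x' : ℕ → E n} {u' : ℝ → E n} {v' : ℕ → ℝ → E n}
    (h' : IsEvolutionFrom T f t₁ y₁ k' t' x' u' v') :
    ∃ k t x u v, IsEvolutionFrom T f t₀ (u₁ t₀) k t x u v := by
  obtain ⟨m, rfl⟩ : ∃ m, k' = m + 1 := by
    refine Nat.exists_eq_succ_of_ne_zero ?_
    rintro rfl
    exact ht₁.ne (h'.t_zero.symm.trans h'.t_last)
  have ht'0 := h'.t_zero
  have hle : ∀ i ≤ m + 1, t₁ ≤ t' i := fun i hi => by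
    rw [← ht'0]; exact le_of_lt_succ h'.t_lt (Nat.zero_le i) hi
  set w : ℝ → E n := fun s => if s < t₁ then u₁ s else u' s
  have hwlt : ∀ s, s < t₁ → w s = u₁ s := fun s hs => if_pos hs
  have hwge : ∀ s, t₁ ≤ s → w s = u' s := fun s hs => if_neg (not_lt.2 hs)
  -- Indices of the later evolution shift by one. The values of `x` and `v` at 0 are fillers, and
  -- the new jump data at 1 replace the fillers of the later evolution.
  let t : ℕ → ℝ := fun j => match j with
    | 0 => t₀
    | i + 1 => t' i
  let x : ℕ → E n := fun j => match j with
    | 0 => x₁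
    | 1 => x₁
    | i + 2 => x' (i + 1)
  let v : ℕ → ℝ → E n := fun j => match j with
    | 0 => v₁
    | 1 => v₁
    | i + 2 => v' (i + 1)
  have ht1 : t 1 = t₁ := ht'0
  refine ⟨m + 2, t, x, w, v, ⟨rfl, h'.t_last, ?_, hwlt t₀ ht₀t₁, ?_, ?_, ?_, ?_, ?_, ?_, ?_, ?_, ?_,
    ?_⟩⟩
  · rintro (_ | i) hi
    · rw [zero_add, ht1]; exact ht₀t₁
    · exact h'.t_lt i (by omega)
  · rintro (_ | i) hi
    · rw [zero_add, ht1]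
      exact (hu.contDiffOn hT h₁ ht₀ ht₁.le).congr fun s hs => hwlt s hs.2
    · exact (h'.smooth i (by omega)).congr fun s hs => hwge s ((hle i (by omega)).trans hs.1)
  · rintro (_ | i) hi s hs
    · rw [zero_add, ht1] at hs
      rw [hwlt s hs.2]
      exact ⟨hu.crit s hs, hu.pos s hs⟩
    · rw [hwge s ((hle i (by omega)).trans hs.1)]
      exact h'.critical i (by omega) s hs
  · rintro (_ | _ | i) hi hi'
    · omega
    · rw [zero_add, ht1]
      exact hlim.congr' (eventually_mem_nhdsWithin.mono fun s hs => (hwlt s hs).symm)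
    · refine (h'.left_limit (i + 1) (by omega) (by omega)).congr' ?_
      filter_upwards [Ico_mem_nhdsLT (h'.t_lt i (by omega))] with s hs
      exact (hwge s ((hle i (by omega)).trans hs.1)).symm
  · rw [hwge T ht₁.le]; exact h'.final
  · rintro (_ | _ | i) hi hi'
    · omega
    · rw [zero_add, ht1]; exact ⟨hZ, hF.psd⟩
    · exact h'.degenerate (i + 1) (by omega) (by omega)
  · rintro (_ | _ | i) hi hi'
    · omega
    · rw [zero_add, ht1]
      exact ⟨l, norm_ne_zero_iff.1 (by rw [hF.norm_eq]; exact one_ne_zero), hF.ker, hl⟩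
    · exact h'.same_sign (i + 1) (by omega) (by omega)
  · rintro (_ | _ | i) hi hi'
    · omega
    · exact hv
    · exact h'.v_smooth (i + 1) (by omega) (by omega)
  · rintro (_ | _ | i) hi hi'
    · omega
    · rw [zero_add, ht1]; exact hvs
    · exact h'.v_solution (i + 1) (by omega) (by omega)
  · rintro (_ | _ | i) hi hi'
    · omega
    · exact hvb
    · exact h'.v_atBot (i + 1) (by omega) (by omega)
  · rintro (_ | _ | i) hi hi'
    · omega
    · rw [zero_add, ht1, hwge t₁ le_rfl, h'.init]; exact hvt
    · rw [hwge _ (hle (i + 1) (by omega))]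
      exact h'.v_atTop (i + 1) (by omega) (by omega)

/-- Induction on a bound for the number of degenerate pairs later than t₀: each jump uses up at
least one of them. -/
lemma exists_evolutionFrom (hT : 0 < T) (h₁ : RegularCoercive T f) (h₂ : FiniteDegenerate T f)
    (h₃ : Transversal T f) (h₄ : HeteroclinicToMinimum T f) (N : ℕ) :
    ∀ t₀ ∈ Ico 0 T, ∀ y₀ : E n, gradX f t₀ y₀ = 0 → HessPosDef f t₀ y₀ →
      {p ∈ degenerateSet T f | t₀ < p.1}.ncard < N →
      ∃ k t x u v, IsEvolutionFrom T f t₀ y₀ k t x u v := by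
  induction N with
  | zero => intro t₀ _ y₀ _ _ hN; omega
  | succ N ih =>
    intro t₀ ht₀ y₀ hcrit hpos hN
    obtain ⟨t₁, ht₁, u₁, x₁, rfl, hu, hlim, rfl | ⟨ht₁T, hZ, l, hF, hl⟩⟩ :=
      exists_maximal_branch hT h₁ h₂ h₃ ht₀ hcrit hpos
    · exact hu.exists_evolutionFrom hT h₁ ht₀ hlim
    · obtain ⟨v₁, y₁, hv, hvs, hvb, hvt, hy, hyp⟩ := exists_heteroclinic hT h₁ h₂ h₄ hZ hF
      have hlt : {p ∈ degenerateSet T f | t₁ < p.1}.ncard <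
          {p ∈ degenerateSet T f | t₀ < p.1}.ncard := by
        refine ncard_lt_ncard ⟨fun p hp => ⟨hp.1, ht₁.1.trans hp.2⟩, fun h => ?_⟩
          (h₂.1.subset fun p hp => hp.1)
        exact lt_irrefl t₁ (h (show (t₁, x₁) ∈ _ from ⟨hZ, ht₁.1⟩)).2
      obtain ⟨k', t', x', u', v', h'⟩ := ih t₁ ⟨ht₀.1.trans ht₁.1.le, ht₁T⟩ y₁ hy hyp (by omega)
      exact h'.cons hT h₁ ht₀.1 ht₁.1 ht₁T hu hlim hZ hF hl hv hvs hvb hvt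

/-- A limit evolution exists. -/
lemma exists_isLimitEvolution (hT : 0 < T) (h₁ : RegularCoercive T f) (h₂ : FiniteDegenerate T f)
    (h₃ : Transversal T f) (h₄ : HeteroclinicToMinimum T f) {y₀ : E n} (hy₀ : gradX f 0 y₀ = 0)
    (hy₀' : HessPosDef f 0 y₀) : ∃ k t x u v, IsLimitEvolution T f y₀ k t x u v := by
  obtain ⟨k, t, x, u, v, h⟩ := exists_evolutionFrom hT h₁ h₂ h₃ h₄ _ 0 ⟨le_rfl, hT⟩ y₀ hy₀ hy₀'
    (Nat.lt_succ_self _)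
  exact ⟨k, t, x, u, v, h.t_zero, h.t_last, h.t_lt, h.init, h.smooth, h.critical, h.left_limit,
    h.final, h.degenerate, h.same_sign, h.v_smooth, h.v_solution, h.v_atBot, h.v_atTop⟩

/-! ### Tracking of branches and blow-up of the perturbed solutions. -/

/-- A family of solutions of the singularly perturbed problem, bounded by `R` for small `ε`. -/
structure IsEpsFamily (T : ℝ) (f : ℝ → E n → ℝ) (R : ℝ) (uε : ℝ → ℝ → E n) : Prop where
  sol : ∀ ε > 0, IsEpsSolution T f ε (uε ε 0) (uε ε)
  bound : ∀ᶠ ε in 𝓝[>] 0, ∀ t ∈ Icc 0 T, ‖uε ε t‖ ≤ R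

lemma IsEpsFamily.mono {R R' : ℝ} {uε : ℝ → ℝ → E n} (h : IsEpsFamily T f R uε) (hR : R ≤ R') :
    IsEpsFamily T f R' uε :=
  ⟨h.sol, h.bound.mono fun _ hε t ht => (hε t ht).trans hR⟩

lemma exists_isEpsFamily (h₁ : RegularCoercive T f) {y : ℝ → E n} {y₀ : E n} {uε : ℝ → ℝ → E n}
    (hu : ∀ ε, 0 < ε → IsEpsSolution T f ε (y ε) (uε ε)) (hy : Tendsto y (𝓝[>] 0) (𝓝 y₀)) :
    ∃ R > 0, IsEpsFamily T f R uε := by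
  obtain ⟨R₀, hR₀, htrap⟩ := h₁.exists_trapping
  set R := max R₀ (‖y₀‖ + 1)
  have hR : 0 < R := lt_of_lt_of_le hR₀ (le_max_left _ _)
  have hlt : ‖y₀‖ < R := lt_of_lt_of_le (by linarith) (le_max_right _ _)
  refine ⟨R, hR, fun ε hε => ⟨rfl, (hu ε hε).2⟩, ?_⟩
  filter_upwards [hy.norm.eventually_lt_const hlt, self_mem_nhdsWithin] with ε h hε
  exact (hu ε hε).norm_le hε hR.le (htrap R (le_max_left _ _)) h.le

lemma eventually_nhdsGT_of_Ioo {P : ℝ → Prop} {ε₀ : ℝ} (hε₀ : 0 < ε₀) (h : ∀ ε ∈ Ioo 0 ε₀, P ε) :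
    ∀ᶠ ε in 𝓝[>] 0, P ε :=
  mem_of_superset (Ioo_mem_nhdsGT hε₀) h

/-- Uniform strong monotonicity of the gradient along a branch of minima. -/
lemma IsBranch.exists_strong_monotone (hT : 0 < T) (h₁ : RegularCoercive T f) {a b d : ℝ}
    (ha : 0 ≤ a) (hb : b ≤ T) {u : ℝ → E n} (hu : IsBranch f a b u) (hd : d < b) :
    ∃ m > 0, ∃ r > 0, ∀ t ∈ Icc a d, ∀ x, ‖x - u t‖ ≤ r →
      m * ‖x - u t‖ ^ 2 ≤ inner ℝ (gradX f t x) (x - u t) := by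
  have hsub : Icc a d ⊆ Ico a b := fun t ht => ⟨ht.1, ht.2.trans_lt hd⟩
  refine isCompact_Icc.induction_on (p := fun A : Set ℝ => ∃ m > 0, ∃ r > 0, ∀ t ∈ A, ∀ x,
    ‖x - u t‖ ≤ r → m * ‖x - u t‖ ^ 2 ≤ inner ℝ (gradX f t x) (x - u t))
    ⟨1, one_pos, 1, one_pos, by simp⟩ ?_ ?_ ?_
  · rintro A B hAB ⟨m, hm, r, hr, h⟩
    exact ⟨m, hm, r, hr, fun t ht => h t (hAB ht)⟩
  · rintro A B ⟨m, hm, r, hr, h⟩ ⟨m', hm', r', hr', h'⟩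
    refine ⟨min m m', lt_min hm hm', min r r', lt_min hr hr', fun t ht x hx => ?_⟩
    rcases ht with ht | ht
    · refine le_trans ?_ (h t ht x (hx.trans (min_le_left _ _)))
      gcongr; exact min_le_left _ _
    · refine le_trans ?_ (h' t ht x (hx.trans (min_le_right _ _)))
      gcongr; exact min_le_right _ _
  · intro t₀ ht₀
    have hI : ∀ t ∈ Icc a d, t ∈ Icc 0 T := fun t ht =>
      ⟨ha.trans ht.1, ht.2.trans (hd.le.trans hb)⟩
    obtain ⟨m, hm, r, hr, h⟩ := (hu.pos t₀ (hsub ht₀)).strong_monotone hT h₁ (hI t₀ ht₀)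
    have hc : ContinuousWithinAt u (Icc a d) t₀ := (hu.cont.mono hsub) t₀ ht₀
    refine ⟨{t | t ∈ Icc a d ∧ |t - t₀| ≤ r ∧ ‖u t - u t₀‖ ≤ r / 2}, ?_, m, hm, r / 2, half_pos hr,
      ?_⟩
    · have e1 : ∀ᶠ t in 𝓝[Icc a d] t₀, |t - t₀| ≤ r := by
        refine nhdsWithin_le_nhds ?_
        filter_upwards [Metric.closedBall_mem_nhds t₀ hr] with t ht
        rwa [Metric.mem_closedBall, Real.dist_eq] at ht
      have e2 : ∀ᶠ t in 𝓝[Icc a d] t₀, ‖u t - u t₀‖ ≤ r / 2 := by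
        filter_upwards [hc.eventually (Metric.closedBall_mem_nhds (u t₀) (half_pos hr))] with t ht
        exact mem_closedBall_iff_norm.1 ht
      filter_upwards [eventually_mem_nhdsWithin, e1, e2] with t k1 k2 k3
      exact ⟨k1, k2, k3⟩
    · rintro t ⟨k1, k2, k3⟩ x hx
      have h3 : ‖x - u t₀‖ ≤ r := by
        have := norm_sub_le_norm_sub_add_norm_sub x (u t) (u t₀)
        linarith
      have := h t (hI t k1) k2 x (mem_closedBall_iff_norm.2 h3) (u t)
        (mem_closedBall_iff_norm.2 (by linarith))
      rwa [hu.crit t (hsub k1), sub_zero] at this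

/-- Solutions starting near a branch of minima follow it. -/
lemma IsBranch.exists_tracking (hT : 0 < T) (h₁ : RegularCoercive T f) {a b d : ℝ}
    (ha : 0 ≤ a) (hb : b ≤ T) {u : ℝ → E n} (hu : IsBranch f a b u) (hd : d < b) {η : ℝ}
    (hη : 0 < η) :
    ∃ η' ∈ Ioc 0 η, ∃ ε₀ > 0, ∀ ε ∈ Ioo 0 ε₀, ∀ (y : E n) (w : ℝ → E n), IsEpsSolution T f ε y w →
      ∀ c, a ≤ c → ‖w c - u c‖ ≤ η' → ∀ t ∈ Icc c d, ‖w t - u t‖ ≤ η' := by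
  obtain ⟨m, hm, r, hr, hmon⟩ := hu.exists_strong_monotone hT h₁ ha hb hd
  have hsub : Icc a d ⊆ Ico a b := fun t ht => ⟨ht.1, ht.2.trans_lt hd⟩
  have hsm := hu.contDiffOn hT h₁ ha hb
  have hdc : ContinuousOn (derivWithin u (Ico a b)) (Ico a b) :=
    hsm.continuousOn_derivWithin (uniqueDiffOn_Ico a b) (by norm_num)
  obtain ⟨M, hM⟩ := isCompact_Icc.exists_bound_of_continuousOn (hdc.mono hsub)
  set η' := min η r
  have hη' : 0 < η' := lt_min hη hr
  -- On the tube of radius η' the inward speed is at least m η' / ε, while the branch moves with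
  -- speed at most |M|.
  refine ⟨η', ⟨hη', min_le_left _ _⟩, m * η' / (|M| + 1), by positivity, ?_⟩
  intro ε hε y w hw c hac h0
  have hsub' : Icc c d ⊆ Icc a d := Icc_subset_Icc_left hac
  have hsub0 : Icc c d ⊆ Icc 0 T := Icc_subset_Icc (ha.trans hac) (hd.le.trans hb)
  refine norm_le_of_inward (e := fun t => w t - u t)
    (e' := fun t => -(ε⁻¹ • gradX f t (w t)) - derivWithin u (Ico a b) t) hη'.le ?_ h0 ?_
  · intro t ht
    refine ((hw.2 t (hsub0 ht)).mono hsub0).sub ?_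
    exact ((hsm.differentiableOn (by norm_num)) t (hsub (hsub' ht))).hasDerivWithinAt.mono
      (hsub'.trans hsub)
  · intro t ht hnorm
    have ht' := hsub' (Ico_subset_Icc_self ht)
    have k1 := hmon t ht' (w t) (by rw [hnorm]; exact min_le_right _ _)
    rw [hnorm] at k1
    have k2 := hM t ht'
    have k3 := abs_real_inner_le_norm (w t - u t) (derivWithin u (Ico a b) t)
    rw [hnorm] at k3
    have k4 : η' * ‖derivWithin u (Ico a b) t‖ ≤ η' * (|M|) := by
      gcongr; exact k2.trans (le_abs_self M)
    rw [inner_sub_right, inner_neg_right, inner_smul_right, real_inner_comm]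
    have k5 : |M| + 1 < ε⁻¹ * (m * η') := by
      have := (lt_div_iff₀ (by positivity)).1 hε.2
      rw [lt_inv_mul_iff₀ hε.1]
      exact this
    have k6 : ε⁻¹ * (m * η' ^ 2) ≤ ε⁻¹ * inner ℝ (gradX f t (w t)) (w t - u t) :=
      mul_le_mul_of_nonneg_left k1 (inv_pos.2 hε.1).le
    have k7 : η' * (|M| + 1) < η' * (ε⁻¹ * (m * η')) := mul_lt_mul_of_pos_left k5 hη'
    have k8 := neg_abs_le (inner ℝ (w t - u t) (derivWithin u (Ico a b) t))
    nlinarith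

/-- Uniform convergence to a branch of minima follows from closeness at suitable starting times. -/
lemma IsEpsFamily.tendstoUniformlyOn (hT : 0 < T) (h₁ : RegularCoercive T f) {R : ℝ}
    {uε : ℝ → ℝ → E n} (hf : IsEpsFamily T f R uε) {a b c d : ℝ}
    (ha : 0 ≤ a) (hb : b ≤ T) {u : ℝ → E n} (hu : IsBranch f a b u) (hd : d < b)
    (hstart : ∀ η > 0, ∃ c' ∈ Icc a c, ∀ᶠ ε in 𝓝[>] 0, ‖uε ε c' - u c'‖ ≤ η) :
    TendstoUniformlyOn uε u (𝓝[>] 0) (Icc c d) := by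
  rw [Metric.tendstoUniformlyOn_iff]
  intro η hη
  obtain ⟨η', hη', ε₀, hε₀, htr⟩ := hu.exists_tracking hT h₁ ha hb hd (half_pos hη)
  obtain ⟨c', hc', hev⟩ := hstart η' hη'.1
  filter_upwards [hev, Ioo_mem_nhdsGT hε₀] with ε k1 k2 t ht
  have := htr ε k2 _ _ (hf.sol ε k2.1) c' hc'.1 k1 t ⟨hc'.2.trans ht.1, ht.2⟩
  rw [dist_comm, dist_eq_norm]
  linarith [hη'.2]

/-- Solutions entering a small ball around a nondegenerate minimum remain there for a while. -/
lemma exists_eps_trap (hT : 0 < T) (h₁ : RegularCoercive T f) {τ : ℝ} (hτ : τ ∈ Icc 0 T) {p : E n}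
    (hcrit : gradX f τ p = 0) (hp : HessPosDef f τ p) {η : ℝ} (hη : 0 < η) :
    ∃ η' ∈ Ioc 0 η, ∃ δ > 0, ∀ ε > 0, ∀ (y : E n) (w : ℝ → E n), IsEpsSolution T f ε y w →
      ∀ c, 0 ≤ c → τ - δ ≤ c → ‖w c - p‖ ≤ η' →
        ∀ t ∈ Icc c (min (τ + δ) T), ‖w t - p‖ ≤ η' := by
  obtain ⟨η', hη', δ, hδ, h⟩ := exists_inward_ball hT h₁ hτ hcrit hp hη
  refine ⟨η', hη', δ, hδ, fun ε hε y w hw c hc hcδ h0 => ?_⟩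
  refine hw.mem_closedBall hε hc (min_le_right _ _) hη'.1.le (fun t ht => ?_) h0
  refine h t ⟨hc.trans ht.1, ht.2.trans (min_le_right _ _)⟩ (abs_le.2 ⟨?_, ?_⟩)
  · linarith [ht.1]
  · linarith [ht.2.trans (min_le_left _ _)]

/-- Rescaled solutions converge to trajectories of the fast system. -/
lemma IsEpsFamily.eventually_blowup (hT : 0 < T) (h₁ : RegularCoercive T f) {R : ℝ}
    {uε : ℝ → ℝ → E n} (hf : IsEpsFamily T f R uε) {τ : ℝ} (hτ : τ ∈ Ioo 0 T) {X : E n → E n}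
    {K : NNReal} {M : ℝ} (hX : IsTruncation f τ R X K M) {F : Filter ℝ} (hF : F ≤ 𝓝[>] 0)
    {σ : ℝ → ℝ} (hσ : Tendsto σ F (𝓝 τ)) {z : ℝ → E n} (hz : IsFlowLine X z)
    (hlim : Tendsto (fun ε => uε ε (σ ε)) F (𝓝 (z 0))) (S : ℝ) {η : ℝ} (hη : 0 < η) :
    ∀ᶠ ε in F, ∀ s ∈ Icc (-S) S, σ ε + ε * s ∈ Icc 0 T ∧ ‖uε ε (σ ε + ε * s) - z s‖ ≤ η := by
  obtain ⟨δ, hδ, h⟩ := exists_blowup_bound hT h₁ hτ hX.one_le hX.lipschitz hX.agree S hη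
  have hε : Tendsto (fun ε : ℝ => ε) F (𝓝 0) := tendsto_id.mono_left (hF.trans nhdsWithin_le_nhds)
  have e1 : Tendsto (fun ε => |σ ε - τ| + ε * S) F (𝓝 0) := by
    simpa using ((hσ.sub_const τ).abs).add (hε.mul_const S)
  have e2 : Tendsto (fun ε => ‖uε ε (σ ε) - z 0‖) F (𝓝 0) := by
    simpa using (hlim.sub_const (z 0)).norm
  have e3 : ∀ᶠ ε in F, (0 : ℝ) < ε := hF self_mem_nhdsWithin
  filter_upwards [e1.eventually_le_const hδ, e2.eventually_le_const hδ, e3, hF hf.bound]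
    with ε k1 k2 k3 k4
  exact h ε k3 _ _ (hf.sol ε k3) k4 (σ ε) k1 z hz k2

/-! ### The transition at a fold. -/

section Jump

variable {R ρ τ M : ℝ} {uε : ℝ → ℝ → E n} {ξ l p : E n} {X : E n → E n} {K : NNReal}
  {v : ℝ → E n}

lemma exists_first_gauge_exit (hρ : 0 < ρ) (hv : Continuous v) (hvb : Tendsto v atBot (𝓝 ξ))
    (hvt : Tendsto v atTop (𝓝 p)) (hp : ρ < foldGauge l (p - ξ)) :
    ∃ s₀, foldGauge l (v s₀ - ξ) = ρ ∧ ∀ s ≤ s₀, foldGauge l (v s - ξ) ≤ ρ := by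
  have hcg : Continuous fun x : E n => foldGauge l (x - ξ) :=
    (continuous_foldGauge l).comp (continuous_id.sub continuous_const)
  have h0 : foldGauge l (ξ - ξ) = 0 := by simp [foldGauge]
  have e1 := ((hcg.tendsto ξ).comp hvb).eventually_lt_const
    (show foldGauge l (ξ - ξ) < ρ by rwa [h0])
  have e2 := ((hcg.tendsto p).comp hvt).eventually_const_lt hp
  obtain ⟨a, ha⟩ := eventually_atBot.1 e1
  obtain ⟨b, hb, hab⟩ := (e2.and (eventually_ge_atTop a)).exists
  obtain ⟨s₀, hs₀, heq, hlt⟩ := exists_first_exit hab (hcg.comp hv).continuousOn (ha a le_rfl) hb.le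
  refine ⟨s₀, heq, fun s hs => ?_⟩
  rcases le_or_gt s a with h | h
  · exact (ha s h).le
  · rcases hs.lt_or_eq with h' | rfl
    · exact (hlt s ⟨h.le, h'⟩).le
    · exact heq.le

/-- Existence of a first time at which the solutions leave the neighbourhood of a fold point. -/
lemma IsEpsFamily.exists_exit_time (hT : 0 < T) (h₁ : RegularCoercive T f)
    (hf : IsEpsFamily T f R uε) (hF : IsFold T f τ ξ l)
    (hs : 0 < mixedDeriv T f τ ξ l * thirdDeriv f τ ξ l) (hρ : IsFoldRadius T f τ ξ l ρ)
    (happ : ∀ η > 0, ∃ δ > 0, ∀ c < τ, ∀ᶠ ε in 𝓝[>] 0, ∀ t ∈ Icc (τ - δ) c, ‖uε ε t - ξ‖ ≤ η) :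
    ∃ σ : ℝ → ℝ, ∃ δ > 0, δ ≤ τ ∧ Tendsto σ (𝓝[>] 0) (𝓝 τ) ∧ ∀ᶠ ε in 𝓝[>] 0,
      foldGauge l (uε ε (σ ε) - ξ) = ρ ∧ ∀ t ∈ Icc (τ - δ) (σ ε), foldGauge l (uε ε t - ξ) ≤ ρ := by
  have hl := hF.norm_eq
  have hcg : Continuous fun x : E n => foldGauge l (x - ξ) :=
    (continuous_foldGauge l).comp (continuous_id.sub continuous_const)
  obtain ⟨δ₀, hδ₀, hnear⟩ := happ (ρ / 2) (half_pos hρ.pos)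
  obtain ⟨δ₁, hδ₁, hlater⟩ := hρ.later hs
  set δ := min δ₀ τ
  have hδ : 0 < δ := lt_min hδ₀ hF.mem.1
  have hδτ : δ ≤ τ := min_le_right _ _
  have hδδ₀ : δ ≤ δ₀ := min_le_left _ _
  have hτT := hF.mem.2
  -- The window begins at τ + θ/2 because at time τ the neighbourhood still contains the critical
  -- point ξ.
  have hexit : ∀ θ > 0, θ ≤ δ₁ → θ ≤ T - τ → ∀ᶠ ε in 𝓝[>] 0, ∃ t ∈ Icc (τ + θ / 2) (τ + θ),
      ρ < foldGauge l (uε ε t - ξ) := by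
    intro θ hθ hθ1 hθ2
    obtain ⟨ε₀, hε₀, h⟩ := exists_eps_exit hT h₁ (c := τ + θ / 2) (d := τ + θ)
      (by linarith) (by linarith) (by linarith) (isCompact_foldGauge hl ξ ρ)
      (fun t ht x hx => hlater t (by linarith [ht.1]) (by linarith [ht.2]) x hx)
    refine eventually_nhdsGT_of_Ioo hε₀ fun ε hε => ?_
    obtain ⟨t, ht, hn⟩ := h ε hε _ _ (hf.sol ε hε.1)
    exact ⟨t, ht, not_le.1 hn⟩
  have hex : ∀ᶠ ε in 𝓝[>] (0 : ℝ), ∃ σ, τ - δ < σ ∧ foldGauge l (uε ε σ - ξ) = ρ ∧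
      ∀ t ∈ Ico (τ - δ) σ, foldGauge l (uε ε t - ξ) < ρ := by
    set θ := min δ₁ (T - τ)
    have hθ : 0 < θ := lt_min hδ₁ (by linarith)
    have hθ2 : θ ≤ T - τ := min_le_right _ _
    filter_upwards [hexit θ hθ (min_le_left _ _) hθ2, hnear (τ - δ) (by linarith),
      self_mem_nhdsWithin] with ε ⟨t, ht, hgt⟩ k1 hε
    have hc : ContinuousOn (fun t => foldGauge l (uε ε t - ξ)) (Icc (τ - δ) t) :=
      hcg.comp_continuousOn ((hf.sol ε hε).continuousOn.mono
        (Icc_subset_Icc (by linarith) (by linarith [ht.2])))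
    have h0 : foldGauge l (uε ε (τ - δ) - ξ) < ρ := by
      have := foldGauge_le_norm hl (uε ε (τ - δ) - ξ)
      have := k1 (τ - δ) ⟨by linarith, le_rfl⟩
      linarith [hρ.pos]
    obtain ⟨σ, hσ, heq, hlt⟩ := exists_first_exit (by linarith [ht.1]) hc h0 hgt.le
    exact ⟨σ, hσ.1, heq, hlt⟩
  obtain ⟨σ, hσ⟩ := hex.choice
  refine ⟨σ, δ, hδ, hδτ, ?_, ?_⟩
  · rw [Metric.tendsto_nhds]
    intro η hη
    set θ := min (η / 2) (min δ₁ (T - τ))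
    have hθ : 0 < θ := lt_min (half_pos hη) (lt_min hδ₁ (by linarith))
    have hθη : θ ≤ η / 2 := min_le_left _ _
    filter_upwards [hσ, hexit θ hθ ((min_le_right _ _).trans (min_le_left _ _))
      ((min_le_right _ _).trans (min_le_right _ _)), hnear (τ - θ) (by linarith)]
      with ε ⟨k1, k2, k3⟩ ⟨t, ht, hgt⟩ k4
    -- Closeness to ξ up to τ - θ excludes an earlier exit; the forced exit by τ + θ excludes a
    -- later one.
    rw [Real.dist_eq, abs_lt]
    constructor
    · by_contra! hcon
      have h5 := k4 (σ ε) ⟨by linarith, by linarith⟩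
      have := foldGauge_le_norm hl (uε ε (σ ε) - ξ)
      linarith [hρ.pos]
    · by_contra! hcon
      have := k3 t ⟨by linarith [ht.1], by linarith [ht.2]⟩
      linarith
  · filter_upwards [hσ] with ε ⟨k1, k2, k3⟩
    refine ⟨k2, fun t ht => ?_⟩
    rcases ht.2.lt_or_eq with h | rfl
    · exact (k3 t ⟨ht.1, h⟩).le
    · exact k2.le

/-- Near a fold point the rescaled solutions converge to the orbit emanating from the fold. -/
lemma IsEpsFamily.exists_jump_time (hT : 0 < T) (h₁ : RegularCoercive T f)
    (hf : IsEpsFamily T f R uε) (hF : IsFold T f τ ξ l)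
    (hs : 0 < mixedDeriv T f τ ξ l * thirdDeriv f τ ξ l) (hρ : IsFoldRadius T f τ ξ l ρ)
    (hX : IsTruncation f τ R X K M) (hR : ‖ξ‖ + 2 * ρ ≤ R) (hv : IsFlowLine X v)
    (hvb : Tendsto v atBot (𝓝 ξ)) (hvt : Tendsto v atTop (𝓝 p)) (hp : ρ < foldGauge l (p - ξ))
    (happ : ∀ η > 0, ∃ δ > 0, ∀ c < τ, ∀ᶠ ε in 𝓝[>] 0, ∀ t ∈ Icc (τ - δ) c, ‖uε ε t - ξ‖ ≤ η) :
    ∃ (σ : ℝ → ℝ) (s₀ : ℝ), ∃ δ > 0, Tendsto σ (𝓝[>] 0) (𝓝 τ) ∧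
      (∀ᶠ ε in 𝓝[>] 0, ∀ t ∈ Icc (τ - δ) (σ ε + ε * s₀), foldGauge l (uε ε t - ξ) ≤ ρ) ∧
      ∀ S, ∀ η > 0, ∀ᶠ ε in 𝓝[>] 0, ∀ s ∈ Icc (-S) S,
        σ ε + ε * s ∈ Icc 0 T ∧ ‖uε ε (σ ε + ε * s) - v s‖ ≤ η := by
  have hcg : Continuous fun x : E n => foldGauge l (x - ξ) :=
    (continuous_foldGauge l).comp (continuous_id.sub continuous_const)
  obtain ⟨s₀, hs₀, hvle⟩ := exists_first_gauge_exit hρ.pos hv.continuous hvb hvt hp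
  obtain ⟨σ, δ, hδ, hδτ, hσ, hev⟩ := hf.exists_exit_time hT h₁ hF hs hρ happ
  have hid : Tendsto (fun ε : ℝ => ε) (𝓝[>] 0) (𝓝 0) := tendsto_id.mono_left nhdsWithin_le_nhds
  have hz := hv.shift s₀
  have hσI : ∀ᶠ ε in 𝓝[>] 0, σ ε ∈ Icc 0 T := hσ.eventually (Icc_mem_nhds hF.mem.1 hF.mem.2)
  have hlim : Tendsto (fun ε => uε ε (σ ε)) (𝓝[>] 0) (𝓝 (v (s₀ + 0))) := by
    -- Every limit point q of the exit positions starts a fast trajectory with its whole past in the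
    -- neighbourhood, and uniqueness of the exit point identifies q.
    rw [tendsto_iff_ultrafilter]
    intro U hU
    have hmem : ∀ᶠ ε in (U : Filter ℝ), uε ε (σ ε) ∈ {x | foldGauge l (x - ξ) ≤ ρ} := by
      have h : ∀ᶠ ε in (U : Filter ℝ), foldGauge l (uε ε (σ ε) - ξ) = ρ ∧ _ := hU hev
      exact h.mono fun ε h => h.1.le
    obtain ⟨q, -, hq⟩ := (isCompact_foldGauge hF.norm_eq ξ ρ).ultrafilter_le_nhds
      (U.map fun ε => uε ε (σ ε)) (by rw [le_principal_iff]; exact hmem)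
    have hq : Tendsto (fun ε => uε ε (σ ε)) U (𝓝 q) := hq
    obtain ⟨z, hz0, hzf⟩ := hX.exists_flowLine q
    have hblow : ∀ S, ∀ η > 0, ∀ᶠ ε in (U : Filter ℝ), ∀ s ∈ Icc (-S) S,
        σ ε + ε * s ∈ Icc 0 T ∧ ‖uε ε (σ ε + ε * s) - z s‖ ≤ η := fun S η hη =>
      hf.eventually_blowup hT h₁ hF.mem hX hU (hσ.mono_left hU) hzf (by rwa [hz0]) S hη
    have hzle : ∀ s ≤ 0, foldGauge l (z s - ξ) ≤ ρ := by
      intro s hs0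
      have hpt : Tendsto (fun ε => uε ε (σ ε + ε * s)) U (𝓝 (z s)) := by
        rw [Metric.tendsto_nhds]
        intro η hη
        filter_upwards [hblow |s| (η / 2) (half_pos hη)] with ε hε
        rw [dist_eq_norm]
        linarith [(hε s ⟨neg_abs_le s, le_abs_self s⟩).2]
      have hst : Tendsto (fun ε => σ ε + ε * s) (𝓝[>] 0) (𝓝 τ) := by
        simpa using hσ.add (hid.mul_const s)
      refine le_of_tendsto ((hcg.tendsto _).comp hpt) (hU ?_)
      filter_upwards [hev, hst.eventually_const_le (show τ - δ < τ by linarith),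
        self_mem_nhdsWithin] with ε k1 k2 k3
      have : ε * s ≤ 0 := mul_nonpos_of_nonneg_of_nonpos (le_of_lt k3) hs0
      exact k1.2 _ ⟨k2, by linarith⟩
    have hq_eq : foldGauge l (z 0 - ξ) = ρ := by
      rw [hz0]
      refine tendsto_nhds_unique ((hcg.tendsto _).comp hq) (tendsto_const_nhds.congr' (hU ?_))
      filter_upwards [hev] with ε h using h.1.symm
    have := hρ.exit_unique hT h₁ hF hX hR hzf hz hzle
      (fun s hs0 => hvle (s₀ + s) (by linarith)) (by rw [hq_eq, add_zero, hs₀])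
    rw [← this, hz0]
    exact hq
  -- The exit occurs at v s₀; this shift aligns rescaled time 0 with time 0 of v.
  refine ⟨fun ε => σ ε - ε * s₀, s₀, δ, hδ, ?_, ?_, fun S η hη => ?_⟩
  · simpa using hσ.sub (hid.mul_const s₀)
  · filter_upwards [hev] with ε h
    rw [sub_add_cancel]
    exact h.2
  · filter_upwards [hf.eventually_blowup hT h₁ hF.mem hX le_rfl hσ hz hlim (S + |s₀|) hη]
      with ε h s hs
    have := h (s - s₀) ⟨by linarith [hs.1, le_abs_self s₀], by linarith [hs.2, neg_abs_le s₀]⟩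
    rw [add_sub_cancel, show σ ε + ε * (s - s₀) = σ ε - ε * s₀ + ε * s by ring] at this
    exact this

/-- The behaviour of the solutions near a jump time `τ`: along the blow-up times `σ` they converge
to the orbit `v`, they are close to its origin `ξ` before and to its endpoint `p` after. -/
structure IsJump (T : ℝ) (uε : ℝ → ℝ → E n) (τ : ℝ) (ξ p : E n) (v : ℝ → E n) (σ : ℝ → ℝ) :
    Prop where
  tendsto : Tendsto σ (𝓝[>] 0) (𝓝 τ)
  blowup : ∀ S, ∀ η > 0, ∀ᶠ ε in 𝓝[>] 0, ∀ s ∈ Icc (-S) S,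
    σ ε + ε * s ∈ Icc 0 T ∧ ‖uε ε (σ ε + ε * s) - v s‖ ≤ η
  before : ∀ η > 0, ∃ δ > 0, ∃ S, ∀ᶠ ε in 𝓝[>] 0, ∀ t ∈ Icc (τ - δ) (σ ε + ε * S),
    ‖uε ε t - ξ‖ ≤ η
  after : ∀ η > 0, ∃ δ > 0, ∃ S, ∀ᶠ ε in 𝓝[>] 0, ∀ t ∈ Icc (σ ε + ε * S) (τ + δ),
    ‖uε ε t - p‖ ≤ η

lemma exists_norm_le_of_tendsto (hv : Continuous v) (hvb : Tendsto v atBot (𝓝 ξ))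
    (hvt : Tendsto v atTop (𝓝 p)) : ∃ B, ∀ s, ‖v s‖ ≤ B := by
  obtain ⟨a, ha⟩ := eventually_atBot.1 (hvb.norm.eventually_le_const (lt_add_one ‖ξ‖))
  obtain ⟨b, hb⟩ := eventually_atTop.1 (hvt.norm.eventually_le_const (lt_add_one ‖p‖))
  obtain ⟨B, hB⟩ := (isCompact_Icc (a := a) (b := b)).exists_bound_of_continuousOn hv.continuousOn
  refine ⟨max B (max (‖ξ‖ + 1) (‖p‖ + 1)), fun s => ?_⟩
  rcases le_or_gt s a with h | h
  · exact (ha s h).trans ((le_max_left _ _).trans (le_max_right _ _))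
  rcases le_or_gt b s with h' | h'
  · exact (hb s h').trans ((le_max_right _ _).trans (le_max_right _ _))
  · exact (hB s ⟨h.le, h'.le⟩).trans (le_max_left _ _)

/-- Before the jump, exits from small and fixed neighbourhoods differ by O(ε), so closeness to ξ
lasts until a bounded rescaled time. After it, v leads the solution into a trapping ball around p.
-/
lemma IsEpsFamily.exists_isJump (hT : 0 < T) (h₁ : RegularCoercive T f)
    (hf : IsEpsFamily T f R uε) (hR : 0 < R) (hF : IsFold T f τ ξ l)
    (hs : 0 < mixedDeriv T f τ ξ l * thirdDeriv f τ ξ l) (hv : IsFastSolution f τ v)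
    (hvb : Tendsto v atBot (𝓝 ξ)) (hvt : Tendsto v atTop (𝓝 p)) (hne : p ≠ ξ)
    (hcrit : gradX f τ p = 0) (hpos : HessPosDef f τ p)
    (happ : ∀ η > 0, ∃ δ > 0, ∀ c < τ, ∀ᶠ ε in 𝓝[>] 0, ∀ t ∈ Icc (τ - δ) c, ‖uε ε t - ξ‖ ≤ η) :
    ∃ σ, IsJump T uε τ ξ p v σ := by
  have hl := hF.norm_eq
  have hcg : Continuous fun x : E n => foldGauge l (x - ξ) :=
    (continuous_foldGauge l).comp (continuous_id.sub continuous_const)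
  obtain ⟨ρ₀, hρ₀⟩ := hF.exists_isFoldRadius hT h₁
  have hvc : Continuous v := continuous_iff_continuousAt.2 fun s => (hv s).continuousAt
  obtain ⟨B, hB⟩ := exists_norm_le_of_tendsto hvc hvb hvt
  have hgp : 0 < foldGauge l (p - ξ) := by
    have h1 := norm_le_foldGauge hl (p - ξ)
    have h2 := norm_pos_iff.2 (sub_ne_zero.2 hne)
    linarith
  set ρ := min ρ₀ (foldGauge l (p - ξ) / 2)
  have hρpos : 0 < ρ := lt_min hρ₀.pos (half_pos hgp)
  have hρlt : ρ < foldGauge l (p - ξ) := (min_le_right _ _).trans_lt (half_lt_self hgp)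
  set R' := max R (max B (‖ξ‖ + 2 * ρ))
  have hf' := hf.mono (le_max_left R (max B (‖ξ‖ + 2 * ρ)))
  have hBR : B ≤ R' := (le_max_left _ _).trans (le_max_right _ _)
  have hρR : ‖ξ‖ + 2 * ρ ≤ R' := (le_max_right _ _).trans (le_max_right _ _)
  obtain ⟨X, K, M, hX⟩ := exists_isTruncation hT h₁ hF.mem_Icc (hR.trans_le (le_max_left R
    (max B (‖ξ‖ + 2 * ρ))))
  have hvX : IsFlowLine X v := hv.isFlowLine hX fun s => (hB s).trans hBR
  have hid : Tendsto (fun ε : ℝ => ε) (𝓝[>] 0) (𝓝 0) := tendsto_id.mono_left nhdsWithin_le_nhds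
  obtain ⟨σ, s₀, δ, hδ, hσ, hin, hbl⟩ := hf'.exists_jump_time hT h₁ hF hs
    (hρ₀.mono hρpos (min_le_left _ _)) hX hρR hvX hvb hvt hρlt happ
  refine ⟨σ, hσ, hbl, fun η hη => ?_, fun η hη => ?_⟩
  · set ρ' := min ρ (η / 2)
    have hρ' : 0 < ρ' := lt_min hρpos (half_pos hη)
    have hρ'ρ : ρ' ≤ ρ := min_le_left _ _
    obtain ⟨σ', s₀', δ', hδ', hσ', hin', hbl'⟩ := hf'.exists_jump_time hT h₁ hF hs
      (hρ₀.mono hρ' (hρ'ρ.trans (min_le_left _ _))) hX (by linarith) hvX hvb hvt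
      (hρ'ρ.trans_lt hρlt) happ
    -- At σ' + ε s₁ the solution is already outside the ρ-neighbourhood, so σ + ε s₀ < σ' + ε s₁.
    -- Hence times up to σ + ε (s₀ - s₁ + s₀') precede the exit from the ρ'-neighbourhood.
    obtain ⟨s₁, hs₁⟩ := (((hcg.tendsto p).comp hvt).eventually_const_lt hρlt).exists
    have hpt : Tendsto (fun ε => uε ε (σ' ε + ε * s₁)) (𝓝[>] 0) (𝓝 (v s₁)) := by
      rw [Metric.tendsto_nhds]
      intro κ hκ
      filter_upwards [hbl' |s₁| (κ / 2) (half_pos hκ)] with ε hε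
      rw [dist_eq_norm]
      linarith [(hε s₁ ⟨neg_abs_le s₁, le_abs_self s₁⟩).2]
    have hst : Tendsto (fun ε => σ' ε + ε * s₁) (𝓝[>] 0) (𝓝 τ) := by
      simpa using hσ'.add (hid.mul_const s₁)
    refine ⟨δ', hδ', s₀ - s₁ + s₀', ?_⟩
    filter_upwards [hin, hin', ((hcg.tendsto _).comp hpt).eventually_const_lt hs₁,
      hst.eventually_const_le (show τ - δ < τ by linarith)] with ε k1 k2 k3 k4 t ht
    have hlt : σ ε + ε * s₀ < σ' ε + ε * s₁ := by
      by_contra! hcon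
      exact absurd (k1 _ ⟨k4, hcon⟩) (not_le.2 k3)
    have h5 := k2 t ⟨ht.1, by nlinarith [ht.2]⟩
    have h6 := norm_le_foldGauge hl (uε ε t - ξ)
    have h7 : ρ' ≤ η / 2 := min_le_right _ _
    linarith
  · obtain ⟨η', hη', δ', hδ', htrap⟩ := exists_eps_trap hT h₁ hF.mem_Icc hcrit hpos hη
    have hclose : ∀ᶠ s in atTop, ‖v s - p‖ < η' / 2 := by
      filter_upwards [hvt.eventually (Metric.ball_mem_nhds p (half_pos hη'.1))] with s h
      exact mem_ball_iff_norm.1 h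
    obtain ⟨S, hS⟩ := hclose.exists
    set δ'' := min δ' (T - τ)
    have hδ'' : 0 < δ'' := lt_min hδ' (by linarith [hF.mem.2])
    have hst : Tendsto (fun ε => σ ε + ε * S) (𝓝[>] 0) (𝓝 τ) := by
      simpa using hσ.add (hid.mul_const S)
    refine ⟨δ'', hδ'', S, ?_⟩
    filter_upwards [hbl |S| (η' / 2) (half_pos hη'.1),
      hst.eventually_const_le (show τ - δ' < τ by linarith), self_mem_nhdsWithin]
      with ε k1 k2 hε t ht
    obtain ⟨k3, k4⟩ := k1 S ⟨neg_abs_le S, le_abs_self S⟩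
    have h5 : ‖uε ε (σ ε + ε * S) - p‖ ≤ η' := by
      have := norm_sub_le_norm_sub_add_norm_sub (uε ε (σ ε + ε * S)) (v S) p
      linarith
    have h6 : τ + δ'' ≤ min (τ + δ') T := le_min (by linarith [min_le_left δ' (T - τ)])
      (by linarith [min_le_right δ' (T - τ)])
    exact (htrap ε hε _ _ (hf.sol ε hε) _ k3.1 k2 h5 t ⟨ht.1, ht.2.trans h6⟩).trans hη'.2

end Jump

/-! ### Convergence to a given limit evolution. -/

lemma exists_mem_Ico_of_lt_succ {k : ℕ} {t : ℕ → ℝ} {s : ℝ} (h0 : t 0 ≤ s) (hk : s < t k) :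
    ∃ i < k, s ∈ Ico (t i) (t (i + 1)) := by
  induction k with
  | zero => exact absurd h0 (not_le.2 hk)
  | succ k ih =>
    rcases lt_or_ge s (t k) with h | h
    · obtain ⟨i, hi, h⟩ := ih h
      exact ⟨i, by omega, h⟩
    · exact ⟨k, by omega, h, hk⟩

lemma tendstoUniformlyOn_union {α : Type*} {F : ℝ → α → E n} {g : α → E n} {l : Filter ℝ}
    {A B : Set α} (hA : TendstoUniformlyOn F g l A) (hB : TendstoUniformlyOn F g l B) :
    TendstoUniformlyOn F g l (A ∪ B) := fun V hV => by
  filter_upwards [hA V hV, hB V hV] with ε h1 h2 s hs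
  exact hs.elim (h1 s) (h2 s)

namespace IsLimitEvolution

variable {y₀ : E n} {k : ℕ} {t : ℕ → ℝ} {x : ℕ → E n} {u : ℝ → E n} {v : ℕ → ℝ → E n}
  {R : ℝ} {uε : ℝ → ℝ → E n}

lemma isBranch (h : IsLimitEvolution T f y₀ k t x u v) {i : ℕ} (hi : i < k) :
    IsBranch f (t i) (t (i + 1)) u :=
  ⟨(h.smooth i hi).continuousOn, fun s hs => (h.critical i hi s hs).1,
    fun s hs => (h.critical i hi s hs).2⟩

lemma mem_Icc (h : IsLimitEvolution T f y₀ k t x u v) {i : ℕ} (hi : i ≤ k) : t i ∈ Icc 0 T := by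
  rw [← h.t_zero, ← h.t_last]
  exact ⟨le_of_lt_succ h.t_lt (Nat.zero_le i) hi, le_of_lt_succ h.t_lt hi le_rfl⟩

lemma k_pos (hT : 0 < T) (h : IsLimitEvolution T f y₀ k t x u v) : 0 < k := by
  rcases Nat.eq_zero_or_pos k with rfl | hk
  · exact absurd (h.t_zero.symm.trans h.t_last) hT.ne
  · exact hk

lemma exists_isFold (h₂ : FiniteDegenerate T f) (h : IsLimitEvolution T f y₀ k t x u v) {i : ℕ}
    (hi : 1 ≤ i) (hik : i < k) : ∃ l, IsFold T f (t i) (x i) l ∧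
      0 < mixedDeriv T f (t i) (x i) l * thirdDeriv f (t i) (x i) l := by
  obtain ⟨hZ, hpsd⟩ := h.degenerate i hi hik
  obtain ⟨l, hl, hker, hpos⟩ := h.same_sign i hi hik
  obtain ⟨s, hs, hF, heq⟩ := SlowGradient.exists_isFold h₂ hZ hpsd hl hker
    (left_ne_zero_of_mul hpos.ne') (right_ne_zero_of_mul hpos.ne')
  exact ⟨_, hF, by rw [heq]; positivity⟩

/-- Convergence before a jump time implies that solutions approach the fold point. -/
lemma approach (h : IsLimitEvolution T f y₀ k t x u v) {i : ℕ} (hi : i < k)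
    (hconv : ∀ c d, t i < c → d < t (i + 1) → TendstoUniformlyOn uε u (𝓝[>] 0) (Icc c d)) :
    ∀ η > 0, ∃ δ > 0, ∀ c < t (i + 1), ∀ᶠ ε in 𝓝[>] 0, ∀ s ∈ Icc (t (i + 1) - δ) c,
      ‖uε ε s - x (i + 1)‖ ≤ η := by
  intro η hη
  have hlim := h.left_limit (i + 1) (by omega) (by omega)
  have e : ∀ᶠ s in 𝓝[<] (t (i + 1)), ‖u s - x (i + 1)‖ < η / 2 := by
    filter_upwards [hlim.eventually (Metric.ball_mem_nhds _ (half_pos hη))] with s hs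
    exact mem_ball_iff_norm.1 hs
  obtain ⟨a, ha, hsub⟩ := (mem_nhdsLT_iff_exists_mem_Ico_Ioo_subset (h.t_lt i hi)).1 e
  refine ⟨(t (i + 1) - a) / 2, by linarith [ha.2], fun c hc => ?_⟩
  have hu := hconv (t (i + 1) - (t (i + 1) - a) / 2) c (by linarith [ha.1, ha.2]) hc
  filter_upwards [Metric.tendstoUniformlyOn_iff.1 hu (η / 2) (half_pos hη)] with ε hε s hs
  have k1 := hε s hs
  rw [dist_comm, dist_eq_norm] at k1
  have k2 : ‖u s - x (i + 1)‖ < η / 2 := hsub ⟨by linarith [hs.1, ha.2], hs.2.trans_lt hc⟩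
  linarith [norm_sub_le_norm_sub_add_norm_sub (uε ε s) (u s) (x (i + 1))]

/-- The orbit really leaves the fold: its endpoint has an invertible Hessian, whereas the fold does
not. -/
lemma exists_isJump (hT : 0 < T) (h₁ : RegularCoercive T f) (h₂ : FiniteDegenerate T f)
    (h : IsLimitEvolution T f y₀ k t x u v) (hR : 0 < R) (hf : IsEpsFamily T f R uε) {i : ℕ}
    (hik : i + 1 < k)
    (hconv : ∀ c d, t i < c → d < t (i + 1) → TendstoUniformlyOn uε u (𝓝[>] 0) (Icc c d)) :
    ∃ σ, IsJump T uε (t (i + 1)) (x (i + 1)) (u (t (i + 1))) (v (i + 1)) σ := by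
  obtain ⟨l, hF, hs⟩ := h.exists_isFold h₂ (i := i + 1) (by omega) hik
  obtain ⟨hcrit, hpos⟩ := h.critical (i + 1) hik (t (i + 1)) ⟨le_rfl, h.t_lt _ hik⟩
  refine hf.exists_isJump hT h₁ hR hF hs (h.v_solution _ (by omega) hik)
    (h.v_atBot _ (by omega) hik) (h.v_atTop _ (by omega) hik) (fun heq => ?_) hcrit hpos
    (h.approach (by omega) hconv)
  rw [heq] at hpos
  exact hpos.det_ne_zero (h.degenerate (i + 1) (by omega) hik).1.2.2

/-- Closeness to the branch shortly after a jump. -/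
lemma exists_start (h : IsLimitEvolution T f y₀ k t x u v) {i : ℕ} (hik : i < k) {σ : ℝ → ℝ}
    {ξ : E n} {w : ℝ → E n} (hJ : IsJump T uε (t i) ξ (u (t i)) w σ) {c : ℝ} (hc : t i < c) :
    ∀ η > 0, ∃ c' ∈ Icc (t i) c, ∀ᶠ ε in 𝓝[>] 0, ‖uε ε c' - u c'‖ ≤ η := by
  intro η hη
  have hlt := h.t_lt i hik
  obtain ⟨δ, hδ, S, hS⟩ := hJ.after (η / 2) (half_pos hη)
  have hcont : Tendsto u (𝓝[>] (t i)) (𝓝 (u (t i))) :=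
    ((h.isBranch hik).cont (t i) ⟨le_rfl, hlt⟩).mono_of_mem_nhdsWithin (Ico_mem_nhdsGT hlt)
  have e1 : ∀ᶠ s in 𝓝[>] (t i), ‖u s - u (t i)‖ < η / 2 := by
    filter_upwards [hcont.eventually (Metric.ball_mem_nhds _ (half_pos hη))] with s hs
    exact mem_ball_iff_norm.1 hs
  have e2 : ∀ᶠ s in 𝓝[>] (t i), s ∈ Ioo (t i) (min c (t i + δ)) :=
    Ioo_mem_nhdsGT (lt_min hc (by linarith))
  obtain ⟨c', k1, k2⟩ := (e1.and e2).exists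
  have hst : Tendsto (fun ε => σ ε + ε * S) (𝓝[>] 0) (𝓝 (t i)) := by
    have hid : Tendsto (fun ε : ℝ => ε) (𝓝[>] 0) (𝓝 0) := tendsto_id.mono_left nhdsWithin_le_nhds
    simpa using hJ.tendsto.add (hid.mul_const S)
  refine ⟨c', ⟨k2.1.le, (k2.2.trans_le (min_le_left _ _)).le⟩, ?_⟩
  filter_upwards [hS, hst.eventually_le_const k2.1] with ε h1 h2
  have := h1 c' ⟨h2, (k2.2.trans_le (min_le_right _ _)).le⟩
  have := norm_sub_le_norm_sub_add_norm_sub (uε ε c') (u (t i)) (u c')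
  rw [norm_sub_rev (u (t i))] at this
  linarith

/-- There is no initial layer: the data converge to the minimum itself, so tracking starts at time
0. -/
lemma tendstoUniformlyOn_initial (hT : 0 < T) (h₁ : RegularCoercive T f)
    (h : IsLimitEvolution T f y₀ k t x u v) (hf : IsEpsFamily T f R uε)
    (h0 : Tendsto (fun ε => uε ε 0) (𝓝[>] 0) (𝓝 y₀)) {d : ℝ} (hd : d < t 1) :
    TendstoUniformlyOn uε u (𝓝[>] 0) (Icc 0 d) := by
  have hk := h.k_pos hT
  have hb := h.isBranch hk
  rw [h.t_zero, zero_add] at hb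
  refine hf.tendstoUniformlyOn hT h₁ le_rfl (h.mem_Icc hk).2 hb hd fun η hη =>
    ⟨0, ⟨le_rfl, le_rfl⟩, ?_⟩
  rw [h.init]
  filter_upwards [h0.eventually (Metric.closedBall_mem_nhds _ hη)] with ε hε
  exact mem_closedBall_iff_norm.1 hε

/-- The solutions converge uniformly to `u` between two jump times. -/
lemma tendstoUniformlyOn_between (hT : 0 < T) (h₁ : RegularCoercive T f)
    (h₂ : FiniteDegenerate T f) (h : IsLimitEvolution T f y₀ k t x u v) (hR : 0 < R)
    (hf : IsEpsFamily T f R uε) (h0 : Tendsto (fun ε => uε ε 0) (𝓝[>] 0) (𝓝 y₀)) :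
    ∀ i < k, ∀ c d, t i < c → d < t (i + 1) → TendstoUniformlyOn uε u (𝓝[>] 0) (Icc c d) := by
  intro i
  induction i with
  | zero =>
    intro _ c d hc hd
    rw [h.t_zero] at hc
    exact (h.tendstoUniformlyOn_initial hT h₁ hf h0 hd).mono (Icc_subset_Icc_left hc.le)
  | succ i ih =>
    intro hi c d hc hd
    obtain ⟨σ, hJ⟩ := h.exists_isJump hT h₁ h₂ hR hf hi (ih (by omega))
    exact hf.tendstoUniformlyOn hT h₁ (h.mem_Icc hi.le).1 (h.mem_Icc hi).2 (h.isBranch hi) hd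
      (h.exists_start hi hJ hc)

/-- The solutions converge uniformly to `u` up to the final time. -/
lemma tendstoUniformlyOn_final (hT : 0 < T) (h₁ : RegularCoercive T f) (h₂ : FiniteDegenerate T f)
    (h₃ : Transversal T f) (h : IsLimitEvolution T f y₀ k t x u v) (hf : IsEpsFamily T f R uε)
    {i : ℕ} (hi : i + 1 = k)
    (hconv : ∀ c d, t i < c → d < t (i + 1) → TendstoUniformlyOn uε u (𝓝[>] 0) (Icc c d))
    {c : ℝ} (hc : t i < c) : TendstoUniformlyOn uε u (𝓝[>] 0) (Icc c T) := by
  have hik : i < k := by omega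
  have htk : t (i + 1) = T := by rw [hi]; exact h.t_last
  have hlt : t i < T := htk ▸ h.t_lt i hik
  have hb := h.isBranch hik
  have hlim := h.left_limit (i + 1) (by omega) hi.le
  rw [htk] at hb hlim hconv
  have hTI : T ∈ Icc 0 T := ⟨hT.le, le_rfl⟩
  have hfin : u T = x (i + 1) := by rw [hi]; exact h.final
  obtain ⟨p, hp, hcrit, hpsd⟩ := hb.exists_left_limit hT h₁ h₂ h₃ (h.mem_Icc hik.le).1 hlt le_rfl
  have hpx : p = x (i + 1) := tendsto_nhds_unique hp hlim
  rw [← hpx] at hfin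
  -- T is not a degenerate time, so the left limit is a nondegenerate minimum, and its trapping ball
  -- carries the estimate up to T.
  have hdet : (hessX f T p).det ≠ 0 := fun hdet => h₂.2.2.2 ⟨(T, p), ⟨hTI, hcrit, hdet⟩, rfl⟩
  have hpos := hpsd.posDef_of_det_ne_zero hT h₁ hTI hdet
  rw [Metric.tendstoUniformlyOn_iff]
  intro η hη
  obtain ⟨η', hη', δ, hδ, htrap⟩ := exists_eps_trap hT h₁ hTI hcrit hpos
    (show 0 < η / 3 by positivity)
  have e : ∀ᶠ s in 𝓝[<] T, ‖u s - p‖ < η' / 2 := by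
    filter_upwards [hp.eventually (Metric.ball_mem_nhds _ (half_pos hη'.1))] with s hs
    exact mem_ball_iff_norm.1 hs
  obtain ⟨a, ha, hsub⟩ := (mem_nhdsLT_iff_exists_mem_Ico_Ioo_subset hlt).1 e
  obtain ⟨c', hc'1, hc'2⟩ := exists_between (show max a (T - δ) < T from
    max_lt ha.2 (by linarith))
  have hac' : a < c' := (le_max_left _ _).trans_lt hc'1
  have hδc' : T - δ < c' := (le_max_right _ _).trans_lt hc'1
  have hti : 0 ≤ t i := (h.mem_Icc hik.le).1
  -- The left end min c c' keeps the interval nonempty, so that closeness at c' is available even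
  -- when c > c'.
  have hu1 := hconv (min c c') c' (lt_min hc (ha.1.trans_lt hac')) hc'2
  filter_upwards [Metric.tendstoUniformlyOn_iff.1 hu1 (η' / 2) (half_pos hη'.1),
    self_mem_nhdsWithin] with ε k1 hε s hs
  rcases le_or_gt s c' with hsc | hsc
  · have := k1 s ⟨(min_le_left _ _).trans hs.1, hsc⟩
    linarith [hη'.1, hη'.2]
  · have k2 := k1 c' ⟨min_le_right _ _, le_rfl⟩
    rw [dist_comm, dist_eq_norm] at k2
    have k3 : ‖u c' - p‖ < η' / 2 := hsub ⟨hac', hc'2⟩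
    have k4 := norm_sub_le_norm_sub_add_norm_sub (uε ε c') (u c') p
    have k5 := htrap ε hε _ _ (hf.sol ε hε) c' (by linarith [ha.1]) hδc'.le (by linarith) s
      ⟨hsc.le, le_min (by linarith [hs.2]) hs.2⟩
    have k6 : ‖u s - p‖ ≤ η' / 2 := by
      rcases hs.2.lt_or_eq with hsT | rfl
      · exact (hsub ⟨hac'.trans hsc, hsT⟩ : ‖u s - p‖ < η' / 2).le
      · rw [hfin, sub_self, norm_zero]; exact (half_pos hη'.1).le
    have k7 := norm_sub_le_norm_sub_add_norm_sub (u s) p (uε ε s)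
    rw [norm_sub_rev p] at k7
    rw [dist_eq_norm]
    linarith [hη'.2]

/-- Local uniform convergence away from the jump times. -/
lemma exists_nhds_tendstoUniformlyOn (hT : 0 < T) (h₁ : RegularCoercive T f)
    (h₂ : FiniteDegenerate T f) (h₃ : Transversal T f) (h : IsLimitEvolution T f y₀ k t x u v)
    (hR : 0 < R) (hf : IsEpsFamily T f R uε) (h0 : Tendsto (fun ε => uε ε 0) (𝓝[>] 0) (𝓝 y₀))
    {s : ℝ} (hs : s ∈ Icc 0 T) (hsj : s ∉ jumpTimes k t) :
    ∃ N ∈ 𝓝[Icc 0 T] s, TendstoUniformlyOn uε u (𝓝[>] 0) N := by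
  have hbet := h.tendstoUniformlyOn_between hT h₁ h₂ hR hf h0
  have hk := h.k_pos hT
  rcases hs.2.lt_or_eq with hsT | rfl
  · obtain ⟨i, hi, his⟩ := exists_mem_Ico_of_lt_succ (k := k) (t := t) (s := s)
      (by rw [h.t_zero]; exact hs.1) (by rwa [h.t_last])
    obtain ⟨d, hd1, hd2⟩ := exists_between his.2
    rcases his.1.lt_or_eq with hlt | heq
    · obtain ⟨c, hc1, hc2⟩ := exists_between hlt
      exact ⟨Icc c d, nhdsWithin_le_nhds (Icc_mem_nhds hc2 hd1), hbet i hi c d hc1 hd2⟩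
    · have hi0 : i = 0 := by
        by_contra hne
        exact hsj ⟨i, by omega, hi, heq.symm⟩
      subst hi0
      refine ⟨Icc 0 d, ?_, h.tendstoUniformlyOn_initial hT h₁ hf h0 hd2⟩
      refine mem_nhdsWithin_iff_exists_mem_nhds_inter.2 ⟨Iic d, Iic_mem_nhds hd1, ?_⟩
      rintro r ⟨hr1, hr2⟩
      exact ⟨hr2.1, hr1⟩
  · obtain ⟨i, rfl⟩ := Nat.exists_eq_succ_of_ne_zero hk.ne'
    have hlt : t i < s := by
      have := h.t_lt i (Nat.lt_succ_self i)
      rwa [← h.t_last]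
    obtain ⟨c, hc1, hc2⟩ := exists_between hlt
    refine ⟨Icc c s, ?_, h.tendstoUniformlyOn_final hT h₁ h₂ h₃ hf rfl
      (hbet i (Nat.lt_succ_self i)) hc1⟩
    refine mem_nhdsWithin_iff_exists_mem_nhds_inter.2 ⟨Ici c, Ici_mem_nhds hc2, ?_⟩
    rintro r ⟨hr1, hr2⟩
    exact ⟨hr1, hr2.2⟩

/-- Uniform convergence on compact sets without jump times. -/
lemma tendstoUniformlyOn_compact (hT : 0 < T) (h₁ : RegularCoercive T f)
    (h₂ : FiniteDegenerate T f) (h₃ : Transversal T f) (h : IsLimitEvolution T f y₀ k t x u v)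
    (hR : 0 < R) (hf : IsEpsFamily T f R uε) (h0 : Tendsto (fun ε => uε ε 0) (𝓝[>] 0) (𝓝 y₀))
    {K : Set ℝ} (hK : IsCompact K) (hKs : K ⊆ Icc 0 T \ jumpTimes k t) :
    TendstoUniformlyOn uε u (𝓝[>] 0) K := by
  refine hK.induction_on (p := fun A => TendstoUniformlyOn uε u (𝓝[>] 0) A)
    tendstoUniformlyOn_empty (fun A B hAB hB => hB.mono hAB)
    (fun A B hA hB => tendstoUniformlyOn_union hA hB) fun s hs => ?_
  obtain ⟨N, hN, hu⟩ := h.exists_nhds_tendstoUniformlyOn hT h₁ h₂ h₃ hR hf h0 (hKs hs).1 (hKs hs).2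
  exact ⟨N, nhdsWithin_mono s (fun r hr => (hKs hr).1) hN, hu⟩

lemma exists_isJump_of_mem (hT : 0 < T) (h₁ : RegularCoercive T f) (h₂ : FiniteDegenerate T f)
    (h : IsLimitEvolution T f y₀ k t x u v) (hR : 0 < R) (hf : IsEpsFamily T f R uε)
    (h0 : Tendsto (fun ε => uε ε 0) (𝓝[>] 0) (𝓝 y₀)) {i : ℕ} (hi : 1 ≤ i) (hik : i < k) :
    ∃ σ, IsJump T uε (t i) (x i) (u (t i)) (v i) σ := by
  obtain ⟨j, rfl⟩ := Nat.exists_eq_succ_of_ne_zero (by omega : i ≠ 0)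
  exact h.exists_isJump hT h₁ h₂ hR hf hik
    (h.tendstoUniformlyOn_between hT h₁ h₂ hR hf h0 j (by omega))

/-- Near a jump time the solutions are close to the completed graph. -/
lemma _root_.SlowGradient.IsJump.eventually_infDist {i : ℕ} (hi : 1 ≤ i) (hik : i < k)
    {σ : ℝ → ℝ} (hJ : IsJump T uε (t i) (x i) (u (t i)) (v i) σ) {η : ℝ}
    (hη : 0 < η) : ∃ δ > 0, ∀ᶠ ε in 𝓝[>] 0, ∀ s ∈ Icc (t i - δ) (t i + δ),
      Metric.infDist (s, uε ε s) (completedGraph T k t x u v) < η := by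
  obtain ⟨δ₁, hδ₁, S₁, hS₁⟩ := hJ.before (η / 2) (half_pos hη)
  obtain ⟨δ₂, hδ₂, S₂, hS₂⟩ := hJ.after (η / 2) (half_pos hη)
  set δ := min (η / 2) (min δ₁ δ₂)
  have hδη : δ ≤ η / 2 := min_le_left _ _
  have hδδ₁ : δ ≤ δ₁ := (min_le_right _ _).trans (min_le_left _ _)
  have hδδ₂ : δ ≤ δ₂ := (min_le_right _ _).trans (min_le_right _ _)
  refine ⟨δ, lt_min (half_pos hη) (lt_min hδ₁ hδ₂), ?_⟩
  filter_upwards [hS₁, hS₂, hJ.blowup (max |S₁| |S₂|) (η / 2) (half_pos hη), self_mem_nhdsWithin]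
    with ε k1 k2 k3 hε s hs
  have key : ∀ p ∈ range (v i) ∪ {x i, u (t i)}, ‖uε ε s - p‖ ≤ η / 2 →
      Metric.infDist (s, uε ε s) (completedGraph T k t x u v) < η := by
    intro p hp hle
    refine (Metric.infDist_le_dist_of_mem (y := (t i, p))
      (Or.inr ⟨i, hi, hik, rfl, hp⟩)).trans_lt ?_
    rw [Prod.dist_eq, max_lt_iff]
    constructor
    · rw [Real.dist_eq, abs_lt]
      constructor <;> linarith [hs.1, hs.2]
    · rw [dist_eq_norm]; linarith
  have hε' : (0 : ℝ) < ε := hε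
  -- Three regimes: still near the fold, already near the new minimum, or at a rescaled time between
  -- S₁ and S₂, where the solution follows the connecting orbit.
  rcases le_or_gt s (σ ε + ε * S₁) with h1 | h1
  · exact key (x i) (Or.inr (Or.inl rfl)) (k1 s ⟨by linarith [hs.1], h1⟩)
  rcases le_or_gt (σ ε + ε * S₂) s with h2 | h2
  · exact key (u (t i)) (Or.inr (Or.inr rfl)) (k2 s ⟨h2, by linarith [hs.2]⟩)
  · have hr1 : S₁ < (s - σ ε) / ε := by rw [lt_div_iff₀ hε']; linarith
    have hr2 : (s - σ ε) / ε < S₂ := by rw [div_lt_iff₀ hε']; linarith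
    have heq : σ ε + ε * ((s - σ ε) / ε) = s := by field_simp; ring
    have h4 := (k3 ((s - σ ε) / ε)
      ⟨by linarith [neg_abs_le S₁, le_max_left |S₁| |S₂|],
        by linarith [le_abs_self S₂, le_max_right |S₁| |S₂|]⟩).2
    rw [heq] at h4
    exact key _ (Or.inl ⟨_, rfl⟩) h4

/-- Uniform convergence of the distance to the completed graph. -/
lemma tendstoUniformlyOn_infDist (hT : 0 < T) (h₁ : RegularCoercive T f)
    (h₂ : FiniteDegenerate T f) (h₃ : Transversal T f) (h : IsLimitEvolution T f y₀ k t x u v)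
    (hR : 0 < R) (hf : IsEpsFamily T f R uε) (h0 : Tendsto (fun ε => uε ε 0) (𝓝[>] 0) (𝓝 y₀)) :
    TendstoUniformlyOn
      (fun ε s => Metric.infDist (s, uε ε s) (completedGraph T k t x u v)) (fun _ => 0)
      (𝓝[>] 0) (Icc 0 T) := by
  rw [Metric.tendstoUniformlyOn_iff]
  intro η hη
  have key : ∀ᶠ ε in 𝓝[>] (0 : ℝ), ∀ s ∈ Icc 0 T,
      Metric.infDist (s, uε ε s) (completedGraph T k t x u v) < η := by
    refine isCompact_Icc.induction_on (p := fun A => ∀ᶠ ε in 𝓝[>] (0 : ℝ), ∀ s ∈ A,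
      Metric.infDist (s, uε ε s) (completedGraph T k t x u v) < η) (by simp) ?_ ?_ ?_
    · exact fun A B hAB hB => hB.mono fun ε hε s hs => hε s (hAB hs)
    · intro A B hA hB
      filter_upwards [hA, hB] with ε k1 k2 s hs
      exact hs.elim (k1 s) (k2 s)
    · intro s hs
      by_cases hsj : s ∈ jumpTimes k t
      · obtain ⟨i, hi, hik, rfl⟩ := hsj
        obtain ⟨σ, hJ⟩ := h.exists_isJump_of_mem hT h₁ h₂ hR hf h0 hi hik
        obtain ⟨δ, hδ, hev⟩ := hJ.eventually_infDist hi hik hη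
        exact ⟨_, nhdsWithin_le_nhds (Icc_mem_nhds (by linarith) (by linarith)), hev⟩
      · obtain ⟨N, hN, hu⟩ := h.exists_nhds_tendstoUniformlyOn hT h₁ h₂ h₃ hR hf h0 hs hsj
        refine ⟨N ∩ Icc 0 T, inter_mem hN self_mem_nhdsWithin, ?_⟩
        filter_upwards [Metric.tendstoUniformlyOn_iff.1 hu η hη] with ε hε r hr
        refine (Metric.infDist_le_dist_of_mem (y := (r, u r)) (Or.inl ⟨hr.2, rfl⟩)).trans_lt ?_
        rw [Prod.dist_eq, max_lt_iff, dist_self, dist_comm]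
        exact ⟨hη, hε r hr.1⟩
  filter_upwards [key] with ε hε s hs
  rw [Real.dist_eq, zero_sub, abs_neg, abs_of_nonneg Metric.infDist_nonneg]
  exact hε s hs

/-- Convergence of the rescaled solutions at a jump time. -/
lemma _root_.SlowGradient.IsJump.tendstoUniformlyOn {τ : ℝ} {ξ p : E n} {w : ℝ → E n} {σ : ℝ → ℝ}
    (hJ : IsJump T uε τ ξ p w σ) {K : Set ℝ} (hK : IsCompact K) :
    TendstoUniformlyOn (fun ε s => uε ε (σ ε + ε * s)) w (𝓝[>] 0) K := by
  rw [Metric.tendstoUniformlyOn_iff]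
  intro η hη
  obtain ⟨S, hS⟩ := hK.isBounded.exists_norm_le
  filter_upwards [hJ.blowup S (η / 2) (half_pos hη)] with ε hε s hs
  rw [dist_comm, dist_eq_norm]
  have := (hε s (abs_le.1 (hS s hs))).2
  linarith

end IsLimitEvolution

end SlowGradient

open SlowGradient in
theorem mainTheorem1 {n : ℕ} (T : ℝ) (hT : 0 < T) (f : ℝ → E n → ℝ)
    (h₁ : RegularCoercive T f) (h₂ : FiniteDegenerate T f) (h₃ : Transversal T f)
    (h₄ : HeteroclinicToMinimum T f)
    (y₀ : E n) (hy₀ : gradX f 0 y₀ = 0) (hy₀' : HessPosDef f 0 y₀) :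
    (∃ (k : ℕ) (t : ℕ → ℝ) (x : ℕ → E n) (u : ℝ → E n) (v : ℕ → ℝ → E n),
      IsLimitEvolution T f y₀ k t x u v) ∧
    ∀ (k : ℕ) (t : ℕ → ℝ) (x : ℕ → E n) (u : ℝ → E n) (v : ℕ → ℝ → E n),
      IsLimitEvolution T f y₀ k t x u v →
      ∀ (y : ℝ → E n) (uε : ℝ → ℝ → E n),
        (∀ ε, 0 < ε → IsEpsSolution T f ε (y ε) (uε ε)) →
        Tendsto y (𝓝[>] 0) (𝓝 y₀) →
        (∀ K : Set ℝ, IsCompact K → K ⊆ Icc 0 T \ jumpTimes k t →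
          TendstoUniformlyOn uε u (𝓝[>] 0) K) ∧
        (∀ i, 1 ≤ i → i < k → ∃ τ : ℝ → ℝ, Tendsto τ (𝓝[>] 0) (𝓝 (t i)) ∧
          ∀ K : Set ℝ, IsCompact K →
            TendstoUniformlyOn (fun ε s => uε ε (τ ε + ε * s)) (v i) (𝓝[>] 0) K) ∧
        TendstoUniformlyOn
          (fun ε s => Metric.infDist (s, uε ε s) (completedGraph T k t x u v)) (fun _ => 0)
          (𝓝[>] 0) (Icc 0 T) := by
  refine ⟨exists_isLimitEvolution hT h₁ h₂ h₃ h₄ hy₀ hy₀', ?_⟩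
  intro k t x u v h y uε hu hy
  obtain ⟨R, hR, hf⟩ := exists_isEpsFamily h₁ hu hy
  have h0 : Tendsto (fun ε => uε ε 0) (𝓝[>] 0) (𝓝 y₀) := by
    refine hy.congr' ?_
    filter_upwards [self_mem_nhdsWithin] with ε hε using (hu ε hε).1.symm
  refine ⟨fun K hK hKs => h.tendstoUniformlyOn_compact hT h₁ h₂ h₃ hR hf h0 hK hKs,
    fun i hi hik => ?_, h.tendstoUniformlyOn_infDist hT h₁ h₂ h₃ hR hf h0⟩
  obtain ⟨σ, hJ⟩ := h.exists_isJump_of_mem hT h₁ h₂ hR hf h0 hi hik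
  exact ⟨σ, hJ.tendsto, fun K hK => hJ.tendstoUniformlyOn hK⟩
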